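/- Units: $[\hat q_j,\hat p_l]=i\delta_{jl}$. Let $k\ge 1$, $n=2k-1$, $a>0$, $\zeta\in\mathbb C$, and write $c=\cosh 2|\zeta|$, $s=\sinh 2|\zeta|$. In the TRS03 $(k,2k-1)$ scheme the dealer prepares the two-mode squeezed vacuum $$\Phi(y,x)=\pi^{-1/2}\exp\!\Big[-\tfrac{e^{-2|\zeta|}(x+y)^2}{4}-\tfrac{e^{2|\zeta|}(y-x)^2}{4}\Big]$$ ($y$ the reference, $x$ the secret), $k-1$ ancillas $\varphi_a(y_i)$ and $k-1$ ancillas $\varphi_{1/a}(z_i)$, where $\varphi_w(t)=(\pi w^2)^{-1/4}e^{-t^2/2w^2}$. An invertible linear encoding of the coordinates $(x,y_1,\dots,y_{k-1},z_1,\dots,z_{k-1})$ is applied, followed by an invertible linear transformation of the first $k$ shares; a linear map $g$ acts on wave functions by $\Psi\mapsto|\det g|^{-1/2}\,\Psi\circ g^{-1}$. The resulting coordinate functions of the shares are $\xi_i=\alpha_i x+\sum_j\beta_{ij}y_j+\sum_j\gamma_{ij}z_j$ $(1\le i\le n)$, and it is required that $\alpha_1=1$, $\beta_1=0$, $\alpha_{i+1}=\alpha_{k+i}$,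 $\beta_{i+1}=\beta_{k+i}$ for $1\le i\le k-1$. Then $(\beta_{i+1,j})_{i,j=1}^{k-1}$ is invertible. Let $v^2=\sum_j\gamma_{1j}^2$ and $u^2=\sum_j u_j^2$, where $u\in\mathbb R^{k-1}$ is given by $\alpha_{i+1}=\sum_j u_j\beta_{i+1,j}$. Put $A=a^2+cv^2$, $B=a^2+cu^2$. Let $\rho^{RS}$ be the joint state of the reference (mode 1) and the extracted secret (share 1, mode 2), obtained by tracing out the shares $2,\dots,n$, and let $\rho^R,\rho^S$ be its reductions. (1) Density matrix: $$\begin{aligned}\rho^{RS}(\omega,\eta;\omega',\eta')=\frac a\pi\sqrt{\frac1A}\,\exp\Big\{&\big(-\tfrac c2+\tfrac{s^2v^2}{4A}\big)(\omega^2+\omega'^2)+\big(-\tfrac c2+\tfrac{c^2v^2}{4A}-\tfrac{u^2}{4a^2}\big)(\eta^2+\eta'^2)\\&+\big(s-\tfrac{csv^2}{2A}\big)(\omega\eta+\omega'\eta')-\tfrac{csv^2}{2A}(\eta\omega'+\eta'\omega)+\tfrac{s^2v^2}{2A}\,\omega\omega'+\big(\tfrac{c^2v^2}{2A}+\tfrac{u^2}{2a^2}\big)\eta\eta'\Big\}.\end{aligned}$$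 (2) Wigner function $W(x)=(2\pi)^{-4}\int e^{-ix^{\top}\xi}\operatorname{tr}[\rho^{RS}e^{i\hat x^{\top}\xi}]\,d^4\xi$: $$\begin{aligned}W(q_1,p_1,q_2,p_2)=\frac{a^2}{\pi^2\sqrt{AB}}\exp\Big\{&-\tfrac{a^2c+v^2}{A}q_1^2-\tfrac{a^2c}{A}q_2^2+\tfrac{2a^2s}{A}q_1q_2\\&-\tfrac{a^2c+u^2}{B}p_1^2-\tfrac{a^2c}{B}p_2^2-\tfrac{2a^2s}{B}p_1p_2\Big\}.\end{aligned}$$ (3) $\rho^{RS}$ is Gaussian with zero mean, and its covariance matrix $V_{ij}=\operatorname{tr}[\rho\{\Delta\hat x_i,\Delta\hat x_j\}]$ (normalized so that the vacuum has $V=I$), in the order $(q_1,p_1,q_2,p_2)$, is $$V=\begin{pmatrix}V_R&C\\C^{\top}&V_S\end{pmatrix},\quad V_R=\begin{pmatrix}c&0\\0&c\end{pmatrix},\quad V_S=\begin{pmatrix}c+v^2/a^2&0\\0&c+u^2/a^2\end{pmatrix},\quad C=\begin{pmatrix}s&0\\0&-s\end{pmatrix};$$ $\rho^R$ and $\rho^S$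 are Gaussian with zero mean and covariance matrices $V_R$ and $V_S$. (4) The symplectic eigenvalues of $V_R$, $V_S$ and $V$ (in the sense of Williamson's normal form) are $$\nu_R=\sqrt{\det V_R}=c,\qquad \nu_S=\sqrt{\det V_S}=\sqrt{(c+v^2/a^2)(c+u^2/a^2)},\qquad \nu_\pm=\sqrt{\frac{\Delta\pm\sqrt{\Delta^2-4\det V}}2},$$ with $\Delta=\det V_R+\det V_S+2\det C=c^2+(c+v^2/a^2)(c+u^2/a^2)-2s^2$ and $\det V=(1+cv^2/a^2)(1+cu^2/a^2)$; moreover $\Delta^2\ge4\det V$, $\nu_R\ge1$, $\nu_S\ge 1$ and $\nu_+\ge\nu_-\ge1$. (5) $\rho^{RS},\rho^R,\rho^S$ are density operators with finite von Neumann entropy $H(\rho)=-\operatorname{tr}\rho\log_2\rho$, and with $h(\nu)=\frac{\nu+1}2\log_2\frac{\nu+1}2-\frac{\nu-1}2\log_2\frac{\nu-1}2$ (and $0\log_2 0=0$), $$H(\rho^R)=h(\nu_R),\quad H(\rho^S)=h(\nu_S),\quad H(\rho^{RS})=h(\nu_+)+h(\nu_-),$$ so that the quantum mutual information $H(\rho^R)+H(\rho^S)-H(\rho^{RS})$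 is $I(R;S)=h(\nu_R)+h(\nu_S)-h(\nu_+)-h(\nu_-)$, an explicit function of $|\zeta|$, $a$, $v^2$, $u^2$. -/

import Mathlib

open MeasureTheory
open scoped ComplexConjugate

noncomputable section

namespace CVSharing

/-! ### States of finitely many modes in the position representation

Units: `[q_j, p_k] = i δ_jk`, `a = (q + i p) / √2`. -/

/-- Wave functions of `n` modes. -/
abbrev Wave (n : ℕ) := (Fin n → ℝ) → ℂ

/-- Density matrices `ρ(x, x') = ⟨x| ρ |x'⟩` of `n` modes in the position representation. -/
abbrev PositionKernel (n : ℕ) := (Fin n → ℝ) → (Fin n → ℝ) → ℂ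

/-- Phase space of `n` modes; `Sum.inl j` is the position `q_j` and `Sum.inr j` the momentum `p_j`. -/
abbrev Phase (n : ℕ) := Fin n ⊕ Fin n → ℝ

/-- `tr A = ∫ ⟨x| A |x⟩ dx` exists and equals `c`. -/
def HasTrace {n : ℕ} (A : PositionKernel n) (c : ℂ) : Prop :=
  Integrable (fun x => A x x) ∧ ∫ x, A x x = c

/-- The position kernel of the product `T ρ` for an operator `T` acting on wave functions. -/
def applyLeft {n : ℕ} (T : Wave n → Wave n) (ρ : PositionKernel n) : PositionKernel n :=
  fun x x' => T (fun z => ρ z x') x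

/-- The quadrature operators: `q_j` is multiplication by `x_j` and `p_j = -i ∂/∂x_j`. -/
def quadrature {n : ℕ} : Fin n ⊕ Fin n → Wave n → Wave n
  | Sum.inl j => fun ψ x => (x j : ℂ) * ψ x
  | Sum.inr j => fun ψ x => -Complex.I * lineDeriv ℝ ψ x (Pi.single j 1)

/-- The Weyl operator `exp (i ∑ⱼ (s_j q_j + t_j p_j))`, with `s = ζ ∘ Sum.inl`, `t = ζ ∘ Sum.inr`,
which maps `ψ` to `x ↦ exp (i (s ⬝ x + s ⬝ t / 2)) ψ (x + t)`. -/
def weyl {n : ℕ} (ζ : Phase n) (ψ : Wave n) : Wave n := fun x =>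
  Complex.exp (Complex.I *
    ((∑ j, ζ (Sum.inl j) * x j + (∑ j, ζ (Sum.inl j) * ζ (Sum.inr j)) / 2 : ℝ) : ℂ)) *
    ψ (fun j => x j + ζ (Sum.inr j))

/-- `W` is the Wigner function of `ρ`, i.e. `W(x) = (2π)^(-2n) ∫ exp(-i xᵀζ) χ(ζ) dζ`, where
`χ(ζ) = tr [ρ D(ζ)]` is the characteristic function formed with the Weyl operators `D(ζ)`. -/
def IsWigner {n : ℕ} (ρ : PositionKernel n) (W : Phase n → ℝ) : Prop :=
  ∃ χ : Phase n → ℂ, (∀ ζ, HasTrace (applyLeft (weyl ζ) ρ) (χ ζ)) ∧ Integrable χ ∧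
    ∀ x : Phase n,
      (W x : ℂ) = ((2 * Real.pi) ^ (2 * n))⁻¹ *
        ∫ ζ : Phase n, Complex.exp (-Complex.I * ((∑ i, x i * ζ i : ℝ) : ℂ)) * χ ζ

/-- `m` is the vector of first moments `tr (x̂_i ρ)`. -/
def IsMean {n : ℕ} (ρ : PositionKernel n) (m : Phase n) : Prop :=
  ∀ i, HasTrace (applyLeft (quadrature i) ρ) (m i)

/-- The centred quadrature `Δx̂_i = x̂_i - m_i`. -/
def centred {n : ℕ} (m : Phase n) (i : Fin n ⊕ Fin n) (ψ : Wave n) : Wave n :=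
  fun x => quadrature i ψ x - (m i : ℂ) * ψ x

/-- `V` is the covariance matrix `V_ij = tr [ρ {Δx̂_i, Δx̂_j}]` of a state with first moments `m`;
the normalization is the one in which the vacuum has covariance matrix `1`. -/
def IsCovariance {n : ℕ} (ρ : PositionKernel n) (m : Phase n)
    (V : Matrix (Fin n ⊕ Fin n) (Fin n ⊕ Fin n) ℝ) : Prop :=
  IsMean ρ m ∧ ∀ i j, HasTrace
    (applyLeft (fun ψ x => centred m i (centred m j ψ) x + centred m j (centred m i ψ) x) ρ) (V i j)

/-- `ρ` is a Gaussian state with first moments `m` and covariance matrix `V`: these are its moments,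
and its Wigner function is the Gaussian probability density with mean `m` and covariance `V / 2`. -/
def IsGaussian {n : ℕ} (ρ : PositionKernel n) (m : Phase n)
    (V : Matrix (Fin n ⊕ Fin n) (Fin n ⊕ Fin n) ℝ) : Prop :=
  IsCovariance ρ m V ∧ V.PosDef ∧
    IsWigner ρ fun x =>
      (Real.pi ^ n * √V.det)⁻¹ * Real.exp (-((x - m) ⬝ᵥ V⁻¹.mulVec (x - m)))

/-- `ν` is the symplectic spectrum of `V`: `V = S (diag ν ⊕ diag ν) Sᵀ` with `S` symplectic
(positions listed before momenta). -/
def IsSymplecticSpectrum {n : ℕ} (V : Matrix (Fin n ⊕ Fin n) (Fin n ⊕ Fin n) ℝ)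
    (ν : Fin n → ℝ) : Prop :=
  (∀ j, 0 < ν j) ∧ ∃ S ∈ Matrix.symplecticGroup (Fin n) ℝ,
    V = S * Matrix.diagonal (Sum.elim ν ν) * S.transpose

/-- The `2 × 2` block of `V` with rows `(q_i, p_i)` and columns `(q_j, p_j)`. -/
def modeBlock {n : ℕ} (V : Matrix (Fin n ⊕ Fin n) (Fin n ⊕ Fin n) ℝ) (i j : Fin n) :
    Matrix (Fin 1 ⊕ Fin 1) (Fin 1 ⊕ Fin 1) ℝ :=
  V.submatrix (Sum.map (fun _ => i) (fun _ => i)) (Sum.map (fun _ => j) (fun _ => j))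

/-- `Δ = det A + det B + 2 det C` for a two-mode matrix with diagonal blocks `A`, `B` and
off-diagonal block `C`. -/
def blockInvariant (V : Matrix (Fin 2 ⊕ Fin 2) (Fin 2 ⊕ Fin 2) ℝ) : ℝ :=
  (modeBlock V 0 0).det + (modeBlock V 1 1).det + 2 * (modeBlock V 0 1).det

/-! ### Density operators, entropy, mutual information -/

/-- The Hilbert space `L²(ℝⁿ)` of `n` modes. -/
abbrev ModeSpace (n : ℕ) := Lp ℂ 2 (volume : Measure (Fin n → ℝ))

/-- `T` is the operator on `L²(ℝⁿ)` with position kernel `K`. -/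
def HasKernel {n : ℕ} (T : ModeSpace n →L[ℂ] ModeSpace n) (K : PositionKernel n) : Prop :=
  ∀ ψ : ModeSpace n, ∀ᵐ x : Fin n → ℝ,
    Integrable (fun y => K x y * ψ y) ∧ T ψ x = ∫ y, K x y * ψ y

/-- An operator on `L²(ℝⁿ)` is determined by its position kernel. -/
theorem HasKernel.unique {n : ℕ} {T T' : ModeSpace n →L[ℂ] ModeSpace n} {K : PositionKernel n}
    (h : HasKernel T K) (h' : HasKernel T' K) : T = T' := by
  ext1 ψ
  apply Lp.ext
  filter_upwards [h ψ, h' ψ] with x hx hx'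
  rw [hx.2, hx'.2]

/-- Positive trace-class operators of trace one. -/
def IsDensityOperator {n : ℕ} (ρ : ModeSpace n →L[ℂ] ModeSpace n) : Prop :=
  ρ.IsPositive ∧ ∀ (ι : Type) (b : HilbertBasis ι ℂ (ModeSpace n)),
    HasSum (fun i => inner ℂ (b i) (ρ (b i))) (1 : ℂ)

/-- The contribution of the number `p` to the Shannon entropy (in bits) of the spectrum of `ρ`:
`- p log₂ p`, counted with the multiplicity of `p` as an eigenvalue of `ρ`. -/
def spectralEntropy {n : ℕ} (ρ : ModeSpace n →L[ℂ] ModeSpace n) (p : ℝ) : ℝ :=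
  Module.finrank ℂ (Module.End.eigenspace (ρ : ModeSpace n →ₗ[ℂ] ModeSpace n) (p : ℂ)) *
    (-(p * Real.logb 2 p))

/-- The von Neumann entropy `-tr (ρ log₂ ρ)`, the Shannon entropy of the spectrum. -/
def vonNeumannEntropy {n : ℕ} (ρ : ModeSpace n →L[ℂ] ModeSpace n) : ℝ :=
  ∑' p : ℝ, spectralEntropy ρ p

/-- `I(A;B) = H(A) + H(B) - H(AB)`. -/
def quantumMutualInformation {l m n : ℕ} (ρA : ModeSpace l →L[ℂ] ModeSpace l)
    (ρB : ModeSpace m →L[ℂ] ModeSpace m) (ρAB : ModeSpace n →L[ℂ] ModeSpace n) : ℝ :=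
  vonNeumannEntropy ρA + vonNeumannEntropy ρB - vonNeumannEntropy ρAB

/-- `(ν+1)/2 log₂ ((ν+1)/2) - (ν-1)/2 log₂ ((ν-1)/2)`. -/
def modeEntropy (ν : ℝ) : ℝ :=
  (ν + 1) / 2 * Real.logb 2 ((ν + 1) / 2) - (ν - 1) / 2 * Real.logb 2 ((ν - 1) / 2)

/-- Partial trace of a two-mode state over the second mode. -/
def traceSecond (ρ : PositionKernel 2) : PositionKernel 1 :=
  fun x x' => ∫ t : ℝ, ρ ![x 0, t] ![x' 0, t]

/-- Partial trace of a two-mode state over the first mode. -/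
def traceFirst (ρ : PositionKernel 2) : PositionKernel 1 :=
  fun x x' => ∫ t : ℝ, ρ ![t, x 0] ![t, x' 0]

/-! ### The sharing scheme -/

/-- The `k` collaborating players, `Sum.inl ()` being the one who ends up with the secret. -/
abbrev Collaborators (k : ℕ) := Unit ⊕ Fin (k - 1)

/-- The `2k - 1` shares: those of the `k` collaborating players, then the other `k - 1`.
As labels of the dealer's input modes: `Sum.inl (Sum.inl ())` is the secret (coordinate `x`),
`Sum.inl (Sum.inr i)` the ancillas with coordinates `y_i`, `Sum.inr i` those with coordinates
`z_i`. -/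
abbrev Share (k : ℕ) := Collaborators k ⊕ Fin (k - 1)

/-- The squeezed vacuum `φ_w(x) = (π w²)^(-1/4) exp (-x² / (2 w²))`. -/
def squeezedVacuum (w x : ℝ) : ℂ :=
  ((Real.pi * w ^ 2) ^ (-(1 / 4) : ℝ) * Real.exp (-x ^ 2 / (2 * w ^ 2)) : ℝ)

/-- The two-mode squeezed vacuum wave function of the reference (`y`) and the secret (`x`). -/
def twoModeSqueezedVacuum (ζ : ℂ) (y x : ℝ) : ℂ :=
  ((√Real.pi)⁻¹ * Real.exp (-(Real.exp (-2 * ‖ζ‖) * (x + y) ^ 2 / 4)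
    - Real.exp (2 * ‖ζ‖) * (y - x) ^ 2 / 4) : ℝ)

/-- The dealer's input: two-mode squeezed vacuum, `k - 1` ancillas `φ_a` and `k - 1` ancillas
`φ_{1/a}`. -/
def inputWave (k : ℕ) (ζ : ℂ) (a y : ℝ) (x : Share k → ℝ) : ℂ :=
  twoModeSqueezedVacuum ζ y (x (Sum.inl (Sum.inl ()))) *
    (∏ i : Fin (k - 1), squeezedVacuum a (x (Sum.inl (Sum.inr i)))) *
    ∏ i : Fin (k - 1), squeezedVacuum (1 / a) (x (Sum.inr i))

/-- The unitary of the linear canonical point transformation `g`, which maps the state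
`∫ Ψ(x) |x⟩ dx` to `|det g|^(1/2) ∫ Ψ(x) |g x⟩ dx`, i.e. `Ψ` to `|det g|^(-1/2) Ψ(g⁻¹ ·)`. -/
def pointTransform {ι : Type*} [Fintype ι] [DecidableEq ι] (g : Matrix ι ι ℝ)
    (Ψ : (ι → ℝ) → ℂ) : (ι → ℝ) → ℂ :=
  fun w => ((|g.det| ^ (-(1 / 2) : ℝ) : ℝ) : ℂ) * Ψ (g⁻¹.mulVec w)

/-- The collaborating players' transformation, extended by the identity on the other shares. -/
def extendDecode {k : ℕ} (d : Matrix (Collaborators k) (Collaborators k) ℝ) :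
    Matrix (Share k) (Share k) ℝ :=
  Matrix.fromBlocks d 0 0 1

/-- The dealer's encoding `g_i = ∑_j g_ij f_j` together with a linear transformation by `k` players
after which the coordinate functions `ξ_i(x) = α_i x + ∑_j β_ij y_j + ∑_j γ_ij z_j` of the shares
satisfy `α_1 = 1`, `β_1 = 0`, `α_{i+1} = α_{k+i}` and `β_{i+1} = β_{k+i}`. -/
structure Scheme (k : ℕ) where
  encode : Matrix (Share k) (Share k) ℝ
  decode : Matrix (Collaborators k) (Collaborators k) ℝ
  isUnit_encode : IsUnit encode.det
  isUnit_decode : IsUnit decode.det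
  alpha_secret : (extendDecode decode * encode) (Sum.inl (Sum.inl ())) (Sum.inl (Sum.inl ())) = 1
  beta_secret : ∀ j, (extendDecode decode * encode) (Sum.inl (Sum.inl ())) (Sum.inl (Sum.inr j)) = 0
  alpha_eq : ∀ i, (extendDecode decode * encode) (Sum.inl (Sum.inr i)) (Sum.inl (Sum.inl ())) =
    (extendDecode decode * encode) (Sum.inr i) (Sum.inl (Sum.inl ()))
  beta_eq : ∀ i j, (extendDecode decode * encode) (Sum.inl (Sum.inr i)) (Sum.inl (Sum.inr j)) =
    (extendDecode decode * encode) (Sum.inr i) (Sum.inl (Sum.inr j))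

namespace Scheme

variable {k : ℕ} (P : Scheme k)

/-- The coefficient matrix of the functions `ξ_i`. -/
def xi : Matrix (Share k) (Share k) ℝ := extendDecode P.decode * P.encode

/-- The coefficients `α_{i+1}`. -/
def alpha (i : Fin (k - 1)) : ℝ := P.xi (Sum.inl (Sum.inr i)) (Sum.inl (Sum.inl ()))

/-- The coefficients `β_{i+1, j}`. -/
def beta : Matrix (Fin (k - 1)) (Fin (k - 1)) ℝ :=
  Matrix.of fun i j => P.xi (Sum.inl (Sum.inr i)) (Sum.inl (Sum.inr j))

/-- The vector `v = γ_1 = (γ_{1,1}, …, γ_{1,k-1})`. -/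
def v (j : Fin (k - 1)) : ℝ := P.xi (Sum.inl (Sum.inl ())) (Sum.inr j)

/-- The joint wave function of the reference (`y`) and all shares after encoding and decoding. -/
def totalWave (ζ : ℂ) (a y : ℝ) : (Share k → ℝ) → ℂ :=
  pointTransform (extendDecode P.decode) (pointTransform P.encode (inputWave k ζ a y))

/-- Share coordinates from that of share 1 and those of all other shares. -/
def assemble (η : ℝ) (e : Fin (k - 1) ⊕ Fin (k - 1) → ℝ) : Share k → ℝ :=
  Sum.elim (Sum.elim (fun _ => η) (fun i => e (Sum.inl i))) (fun i => e (Sum.inr i))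

/-- The integrand of the partial trace of `|Ψ⟩⟨Ψ|` over the shares other than share 1. -/
def traceIntegrand (ζ : ℂ) (a : ℝ) (x x' : Fin 2 → ℝ) (e : Fin (k - 1) ⊕ Fin (k - 1) → ℝ) : ℂ :=
  P.totalWave ζ a (x 0) (assemble (x 1) e) * conj (P.totalWave ζ a (x' 0) (assemble (x' 1) e))

/-- The joint state of the reference (mode `0`) and the extracted secret (mode `1`), obtained by
tracing out all shares other than share 1. -/
def extractedState (ζ : ℂ) (a : ℝ) : PositionKernel 2 :=
  fun x x' => ∫ e, P.traceIntegrand ζ a x x' e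

end Scheme

end CVSharing

end

open MeasureTheory
open scoped ComplexConjugate

noncomputable section

namespace CVSharing

open Matrix

/-! ### Real symmetric matrices -/

section Diagonalization

variable {ι : Type*} [Fintype ι] [DecidableEq ι]

/-! Every wave function involved is a real Gaussian. In the dealer's coordinates the total wave
function is a product of Gaussians, and in the share coordinates it is this product composed with
`P.xi⁻¹`. Fix the coordinate `η` of share 1. Since `α = β u`, and the same `α` and `β` occur in both
groups of remaining shares, shifting the `y`-ancillas by `η u` makes the remaining share coordinates
a linear image of ancilla variables under a matrix `residual` that does not involve `η`
(`xi_mulVec_inputCoord`). Hence one substitution serves ket and bra, its Jacobian cancels the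
normalization of the point transformations (`det_residual`), and the partial trace is a Gaussian
integral whose quadratic form is diagonal up to a rank-one term (`ancilla_integral`). The outcome is
`gaussKernel M N`, where `M` and `N` are the position and momentum blocks of `V`.

The rest is a study of `gaussKernel M N` for positive definite `M`, `N` in any number of modes. Its
characteristic function is `exp (-ζᵀ (M ⊕ N) ζ / 4)`, whose Fourier transform is the Wigner
function; the moments come from differentiating the kernel. A simultaneous diagonalization `M = L ν
Lᵀ`, `Lᵀ N L = ν` yields Williamson's normal form, and in the coordinates `L⁻¹ x` the kernel is a
product of one-mode thermal kernels (`gaussKernel_eq_prod`).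

A thermal kernel sends the wave packet with parameter `ξ` to a multiple of the one with parameter `r
ξ`, `r = (ν - 1) / (ν + 1)`, while the overlap of a packet with the `m`-th Hermite function is
proportional to `(i ξ)^m exp (-ξ² / 2) / √m!`. So the operator with eigenvalues `2 / (ν + 1) * r^m`
in the Hermite basis agrees with the kernel on all packets. These are total because the Fourier
transform is injective, and the agreement extends to all of `L²` (`hasKernel_of_total`). For `ν ≥ 1`
the spectrum is a product of geometric distributions, which gives positivity, trace one and the
entropy as a sum of `modeEntropy (ν j)` (`exists_operator_gaussKernel`).

For two modes `M N` is similar to `diag ν²`, so `Δ = tr (M N)` and `det V` determine the symplectic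
spectrum. The bound `1 ≤ ν₋` reduces to `Δ ≥ 2` and `det V - Δ + 1 = s² v² u² / a⁴ ≥ 0`. -/

theorem exists_orthogonal_diagonal {A : Matrix ι ι ℝ} (hA : A.PosDef) :
    ∃ (O : Matrix ι ι ℝ) (μ : ι → ℝ), O * Oᵀ = 1 ∧ Oᵀ * O = 1 ∧ (∀ i, 0 < μ i) ∧
      A = O * diagonal μ * Oᵀ := by
  refine ⟨hA.1.eigenvectorUnitary, hA.1.eigenvalues, ?_, ?_, hA.eigenvalues_pos, ?_⟩
  · have := Unitary.mul_star_self_of_mem hA.1.eigenvectorUnitary.2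
    rwa [star_eq_conjTranspose, conjTranspose_eq_transpose_of_trivial] at this
  · have := Unitary.star_mul_self_of_mem hA.1.eigenvectorUnitary.2
    rwa [star_eq_conjTranspose, conjTranspose_eq_transpose_of_trivial] at this
  · have := hA.1.spectral_theorem
    rw [Unitary.conjStarAlgAut_apply] at this
    refine this.trans ?_
    rw [← conjTranspose_eq_transpose_of_trivial]
    rfl

theorem isUnit_det_of_mul_transpose {O : Matrix ι ι ℝ} (h : O * Oᵀ = 1) : IsUnit O.det := by
  have := congrArg det h
  rw [det_mul, det_one] at this
  exact IsUnit.of_mul_eq_one _ this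

/-- A positive definite real matrix has a factorization `A = Bᵀ B`. -/
theorem exists_transpose_mul_self {A : Matrix ι ι ℝ} (hA : A.PosDef) :
    ∃ B : Matrix ι ι ℝ, IsUnit B.det ∧ A = Bᵀ * B := by
  obtain ⟨O, μ, h1, -, hμ, rfl⟩ := exists_orthogonal_diagonal hA
  refine ⟨diagonal (fun i => √(μ i)) * Oᵀ, ?_, ?_⟩
  · rw [det_mul, det_transpose, det_diagonal]
    refine IsUnit.mul ?_ (isUnit_det_of_mul_transpose h1)
    exact (Finset.prod_ne_zero_iff.2 fun i _ => (Real.sqrt_pos.2 (hμ i)).ne').isUnit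
  · rw [transpose_mul, transpose_transpose, diagonal_transpose]
    have : diagonal μ = diagonal (fun i => √(μ i)) * diagonal (fun i => √(μ i)) := by
      rw [diagonal_mul_diagonal]
      congr 1; ext i; exact (Real.mul_self_sqrt (hμ i).le).symm
    rw [this]; simp only [Matrix.mul_assoc]

/-- Simultaneous diagonalization of two positive definite matrices, one by congruence with `L`,
the other one by congruence with the contragredient matrix. -/
theorem exists_simultaneous_diagonal {M N : Matrix ι ι ℝ} (hM : M.PosDef) (hN : N.PosDef) :
    ∃ (L : Matrix ι ι ℝ) (ν : ι → ℝ), IsUnit L.det ∧ (∀ i, 0 < ν i) ∧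
      M = L * diagonal ν * Lᵀ ∧ Lᵀ * N * L = diagonal ν := by
  obtain ⟨B, hB, rfl⟩ := exists_transpose_mul_self hM
  have hinj : Function.Injective (Bᵀ).mulVec :=
    mulVec_injective_iff_isUnit.2 ((isUnit_iff_isUnit_det _).2 (by rwa [det_transpose]))
  have hP : (B * N * Bᵀ).PosDef := by
    have := hN.conjTranspose_mul_mul_same (B := Bᵀ) hinj
    rwa [conjTranspose_eq_transpose_of_trivial, transpose_transpose] at this
  obtain ⟨O, μ, h1, h2, hμ, h⟩ := exists_orthogonal_diagonal hP
  have hd : IsUnit (diagonal fun i => (√√(μ i))⁻¹).det := by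
    rw [det_diagonal]
    exact (Finset.prod_ne_zero_iff.2 fun i _ =>
      (inv_pos.2 (Real.sqrt_pos.2 (Real.sqrt_pos.2 (hμ i)))).ne').isUnit
  have hdd : ∀ i, √√(μ i) * √√(μ i) = √(μ i) := fun i => Real.mul_self_sqrt (Real.sqrt_nonneg _)
  have hdd' : ∀ i, √(μ i) * √(μ i) = μ i := fun i => Real.mul_self_sqrt (hμ i).le
  have hpos : ∀ i, 0 < √√(μ i) := fun i => Real.sqrt_pos.2 (Real.sqrt_pos.2 (hμ i))
  -- With `M = Bᵀ B` and `B N Bᵀ = O μ Oᵀ`, the choice `L = Bᵀ O μ^(-1/4)` balances both conditions: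
  -- `L √μ Lᵀ = Bᵀ B`, and `Lᵀ N L = μ^(-1/4) μ μ^(-1/4) = √μ`.
  refine ⟨Bᵀ * O * diagonal fun i => (√√(μ i))⁻¹, fun i => √(μ i), ?_,
    fun i => Real.sqrt_pos.2 (hμ i), ?_, ?_⟩
  · rw [det_mul, det_mul, det_transpose]
    exact (hB.mul (isUnit_det_of_mul_transpose h1)).mul hd
  · have e : (diagonal fun i => (√√(μ i))⁻¹) * diagonal (fun i => √(μ i)) *
        (diagonal fun i => (√√(μ i))⁻¹) = 1 := by
      rw [diagonal_mul_diagonal, diagonal_mul_diagonal, ← diagonal_one]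
      congr 1; ext i
      have := (hpos i).ne'
      calc (√√(μ i))⁻¹ * √(μ i) * (√√(μ i))⁻¹ = (√√(μ i))⁻¹ * (√√(μ i) * √√(μ i)) * (√√(μ i))⁻¹ := by
            rw [hdd i]
        _ = 1 := by field_simp
    calc Bᵀ * B = Bᵀ * (O * Oᵀ) * B := by rw [h1, Matrix.mul_one]
      _ = Bᵀ * (O * ((diagonal fun i => (√√(μ i))⁻¹) * diagonal (fun i => √(μ i)) *
        (diagonal fun i => (√√(μ i))⁻¹)) * Oᵀ) * B := by rw [e, Matrix.mul_one]
      _ = _ := by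
        simp only [transpose_mul, diagonal_transpose, transpose_transpose, Matrix.mul_assoc]
  · have e : (diagonal fun i => (√√(μ i))⁻¹) * diagonal μ *
        (diagonal fun i => (√√(μ i))⁻¹) = diagonal (fun i => √(μ i)) := by
      rw [diagonal_mul_diagonal, diagonal_mul_diagonal]
      congr 1; ext i
      have := (hpos i).ne'
      calc (√√(μ i))⁻¹ * μ i * (√√(μ i))⁻¹ = (√√(μ i))⁻¹ * ((√√(μ i) * √√(μ i)) * (√√(μ i) * √√(μ i))) *
            (√√(μ i))⁻¹ := by rw [hdd i, hdd' i]
        _ = √√(μ i) * √√(μ i) := by field_simp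
        _ = √(μ i) := hdd i
    calc (Bᵀ * O * diagonal fun i => (√√(μ i))⁻¹)ᵀ * N * (Bᵀ * O * diagonal fun i => (√√(μ i))⁻¹)
        = (diagonal fun i => (√√(μ i))⁻¹) * Oᵀ * (B * N * Bᵀ) * O *
          (diagonal fun i => (√√(μ i))⁻¹) := by
          simp only [transpose_mul, diagonal_transpose, transpose_transpose, Matrix.mul_assoc]
      _ = (diagonal fun i => (√√(μ i))⁻¹) * (Oᵀ * O) * diagonal μ * (Oᵀ * O) *
          (diagonal fun i => (√√(μ i))⁻¹) := by
          rw [h]; simp only [Matrix.mul_assoc]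
      _ = _ := by rw [h2, Matrix.mul_one, Matrix.mul_one, e]

end Diagonalization

/-! ### Linear changes of variables and Gaussian integrals -/

section Gaussian

variable {ι : Type*} [Fintype ι] [DecidableEq ι]

/-- An invertible matrix as a measurable equivalence. -/
def mulVecEquiv (L : Matrix ι ι ℝ) (hL : IsUnit L.det) : (ι → ℝ) ≃ᵐ (ι → ℝ) where
  toFun y := L *ᵥ y
  invFun x := L⁻¹ *ᵥ x
  left_inv y := by simp [mulVec_mulVec, nonsing_inv_mul L hL]
  right_inv x := by simp [mulVec_mulVec, mul_nonsing_inv L hL]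
  measurable_toFun := (Continuous.matrix_mulVec continuous_const continuous_id).measurable
  measurable_invFun := (Continuous.matrix_mulVec continuous_const continuous_id).measurable

theorem map_mulVecEquiv (L : Matrix ι ι ℝ) (hL : IsUnit L.det) :
    Measure.map (mulVecEquiv L hL) volume = ENNReal.ofReal |L.det|⁻¹ • volume := by
  have := Real.map_matrix_volume_pi_eq_smul_volume_pi hL.ne_zero
  rw [abs_inv] at this
  exact this

theorem integral_mulVec {E : Type*} [NormedAddCommGroup E] [NormedSpace ℝ E]
    (L : Matrix ι ι ℝ) (hL : IsUnit L.det) (f : (ι → ℝ) → E) :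
    ∫ y, f (L *ᵥ y) = |L.det|⁻¹ • ∫ x, f x := by
  have := (MeasureTheory.integral_map_equiv (μ := volume) (mulVecEquiv L hL) f).symm
  rw [map_mulVecEquiv, integral_smul_measure,
    ENNReal.toReal_ofReal (inv_nonneg.2 (abs_nonneg _))] at this
  exact this

theorem integrable_mulVec_iff {E : Type*} [NormedAddCommGroup E]
    (L : Matrix ι ι ℝ) (hL : IsUnit L.det) (f : (ι → ℝ) → E) :
    Integrable (fun y => f (L *ᵥ y)) ↔ Integrable f := by
  have := MeasureTheory.integrable_map_equiv (μ := volume) (mulVecEquiv L hL) f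
  rw [map_mulVecEquiv, integrable_smul_measure] at this
  · exact this.symm
  · simpa using hL.ne_zero
  · exact ENNReal.ofReal_ne_top

/-- The Gaussian integral with quadratic form `P` and linear term `P w`. -/
theorem gaussian_integral {P : Matrix ι ι ℝ} (hP : P.PosDef) (w b : ι → ℂ)
    (hb : b = P.map Complex.ofReal *ᵥ w) :
    Integrable (fun x : ι → ℝ => Complex.exp (-((x ⬝ᵥ P *ᵥ x : ℝ) : ℂ) + ∑ i, b i * x i)) ∧
    ∫ x : ι → ℝ, Complex.exp (-((x ⬝ᵥ P *ᵥ x : ℝ) : ℂ) + ∑ i, b i * x i) =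
      ((√(Real.pi ^ Fintype.card ι / P.det) : ℝ) : ℂ) * Complex.exp ((w ⬝ᵥ b) / 4) := by
  obtain ⟨B, hB, rfl⟩ := exists_transpose_mul_self hP
  subst hb
  set B' := B.map Complex.ofReal with hB'
  have hmap : (Bᵀ * B).map Complex.ofReal = B'ᵀ * B' := by
    exact Matrix.map_mul (L := Bᵀ) (M := B) (f := Complex.ofRealHom)
  -- In the coordinates `B x` the quadratic form is the sum of squares, and the linear term `Bᵀ B w`
  -- becomes `B w`, so the standard Gaussian integral applies.
  set F : (ι → ℝ) → ℂ := fun y =>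
    Complex.exp (-1 * ∑ i, (y i : ℂ) ^ 2 + ∑ i, (B' *ᵥ w) i * y i) with hF
  have key : (fun x : ι → ℝ => Complex.exp (-((x ⬝ᵥ (Bᵀ * B) *ᵥ x : ℝ) : ℂ) +
      ∑ i, ((Bᵀ * B).map Complex.ofReal *ᵥ w) i * x i)) = fun x => F (B *ᵥ x) := by
    ext x
    have h1 : x ⬝ᵥ (Bᵀ * B) *ᵥ x = ∑ i, (B *ᵥ x) i ^ 2 := by
      rw [← mulVec_mulVec, dotProduct_mulVec, vecMul_transpose]
      simp [dotProduct, sq]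
    have h2 : ∑ i, ((Bᵀ * B).map Complex.ofReal *ᵥ w) i * x i =
        ∑ i, (B' *ᵥ w) i * ((B *ᵥ x) i : ℝ) := by
      have e1 : ∀ i, (((B *ᵥ x) i : ℝ) : ℂ) = (B' *ᵥ fun j => (x j : ℂ)) i := by
        intro i; simp [hB', mulVec, dotProduct]
      simp_rw [e1]
      rw [hmap]
      change (_ ⬝ᵥ fun j => (x j : ℂ)) = _ ⬝ᵥ _
      rw [← mulVec_mulVec, mulVec_transpose, dotProduct_mulVec]
    simp only [hF]
    rw [h1, h2]; push_cast; ring_nf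
  rw [key]
  have hone : 0 < (1 : ℂ).re := by simp
  refine ⟨(integrable_mulVec_iff B hB F).2
    (GaussianFourier.integrable_cexp_neg_mul_sum_add hone _), ?_⟩
  rw [integral_mulVec B hB F, hF, GaussianFourier.integral_cexp_neg_mul_sum_add hone]
  have h3 : ∑ i, (B' *ᵥ w) i ^ 2 = w ⬝ᵥ ((Bᵀ * B).map Complex.ofReal *ᵥ w) := by
    rw [hmap, ← mulVec_mulVec, mulVec_transpose, ← dotProduct_comm, ← dotProduct_mulVec]
    simp [dotProduct, sq]
  rw [h3, mul_one]
  have h4 : √(Real.pi ^ Fintype.card ι / (Bᵀ * B).det) =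
      |B.det|⁻¹ * Real.pi ^ ((Fintype.card ι : ℝ) / 2) := by
    rw [det_mul, det_transpose, Real.sqrt_div (by positivity), Real.sqrt_mul_self_eq_abs,
      Real.sqrt_eq_rpow, ← Real.rpow_natCast, ← Real.rpow_mul Real.pi_pos.le, div_eq_inv_mul]
    congr 2; ring
  rw [h4, Complex.real_smul, Complex.ofReal_mul, Complex.ofReal_cpow Real.pi_pos.le]
  push_cast
  simp [mul_assoc]

theorem integral_mul_exp_neg_sq : ∫ t : ℝ, t * Real.exp (-t ^ 2) = 0 := by
  have h := integral_neg_eq_self (fun t : ℝ => t * Real.exp (-t ^ 2)) volume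
  have : ∫ t : ℝ, (-t) * Real.exp (-(-t) ^ 2) = - ∫ t : ℝ, t * Real.exp (-t ^ 2) := by
    rw [← integral_neg]; congr 1; ext t; rw [neg_sq]; ring
  linarith

theorem integrable_pow_mul_exp_neg_sq (n : ℕ) :
    Integrable fun t : ℝ => t ^ n * Real.exp (-t ^ 2) := by
  have := integrable_rpow_mul_exp_neg_mul_sq one_pos (s := n) (by linarith [n.cast_nonneg (α := ℝ)])
  simpa using this

theorem integral_sq_mul_exp_neg_sq : ∫ t : ℝ, t ^ 2 * Real.exp (-t ^ 2) = √Real.pi / 2 := by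
  have hderiv : ∀ t : ℝ, HasDerivAt (fun t : ℝ => Real.exp (-t ^ 2)) (-2 * t * Real.exp (-t ^ 2)) t := by
    intro t
    have : HasDerivAt (fun t : ℝ => Real.exp (-t ^ 2))
        (Real.exp (-t ^ 2) * -(((2 : ℕ) : ℝ) * t ^ (2 - 1))) t := ((hasDerivAt_pow 2 t).neg).exp
    refine this.congr_deriv ?_
    simp; ring
  have h0 := integrable_pow_mul_exp_neg_sq 0
  have h1 := integrable_pow_mul_exp_neg_sq 1
  have h2 := integrable_pow_mul_exp_neg_sq 2
  -- Integration by parts of `t` against `(exp (-t²))'`, which reduces the second moment to the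
  -- zeroth.
  have := integral_mul_deriv_eq_deriv_mul_of_integrable (u := fun t : ℝ => t) (u' := fun _ => 1)
    (v := fun t : ℝ => Real.exp (-t ^ 2)) (v' := fun t => -2 * t * Real.exp (-t ^ 2))
    (fun t _ => hasDerivAt_id t) (fun t _ => hderiv t)
    (by
      have := h2.const_mul (-2)
      refine this.congr (Filter.Eventually.of_forall fun t => ?_)
      simp [Pi.mul_apply]; ring)
    (by simpa [Pi.mul_def] using h0)
    (by simpa [Pi.mul_def] using h1)
  have e1 : ∫ t : ℝ, t * (-2 * t * Real.exp (-t ^ 2)) = -2 * ∫ t : ℝ, t ^ 2 * Real.exp (-t ^ 2) := by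
    rw [← integral_const_mul]; congr 1; ext t; ring
  have e2 := integral_gaussian 1
  simp only [neg_mul, one_mul, div_one] at e2
  simp only [one_mul] at this
  rw [e2] at this
  simp only [neg_mul] at e1 this
  linarith

/-- Zeroth, first and second moments of `exp (-|y|²)`. -/
theorem integral_exp_neg_sum_sq {ι : Type*} [Fintype ι] :
    Integrable (fun y : ι → ℝ => Real.exp (-∑ i, y i ^ 2)) ∧
      ∫ y : ι → ℝ, Real.exp (-∑ i, y i ^ 2) = √Real.pi ^ Fintype.card ι := by
  have e : (fun y : ι → ℝ => Real.exp (-∑ i, y i ^ 2)) =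
      fun y : ι → ℝ => ∏ i, (fun (_ : ι) t => Real.exp (-t ^ 2)) i (y i) := by
    ext y; rw [← Finset.sum_neg_distrib, Real.exp_sum]
  have hi := integrable_pow_mul_exp_neg_sq 0
  simp only [pow_zero, one_mul] at hi
  have e2 := integral_gaussian 1
  simp only [neg_mul, one_mul, div_one] at e2
  rw [e]
  refine ⟨Integrable.fintype_prod fun _ => hi, ?_⟩
  rw [integral_fintype_prod_volume_eq_prod fun (_ : ι) (t : ℝ) => Real.exp (-t ^ 2)]
  simp [e2]

/-- Writing the coordinate as a product of factors that are `1` except at `k` makes the integrand a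
product of one-variable functions; the factor at `k` is odd. -/
theorem integral_mul_exp_neg_sum_sq (k : ι) :
    Integrable (fun y : ι → ℝ => y k * Real.exp (-∑ i, y i ^ 2)) ∧
      ∫ y : ι → ℝ, y k * Real.exp (-∑ i, y i ^ 2) = 0 := by
  have e : (fun y : ι → ℝ => y k * Real.exp (-∑ i, y i ^ 2)) =
      fun y : ι → ℝ => ∏ i, (fun (i : ι) t => (if i = k then t else 1) * Real.exp (-t ^ 2)) i (y i) := by
    ext y; rw [← Finset.sum_neg_distrib, Real.exp_sum]
    simp only [Finset.prod_mul_distrib, Finset.prod_ite_eq', Finset.mem_univ, if_true]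
  have h0 := integrable_pow_mul_exp_neg_sq 0
  have h1 := integrable_pow_mul_exp_neg_sq 1
  rw [e]
  constructor
  · refine Integrable.fintype_prod
      (f := fun (i : ι) t => (if i = k then t else 1) * Real.exp (-t ^ 2)) fun i => ?_
    by_cases h : i = k
    · simpa [h] using h1
    · simpa [h] using h0
  · rw [integral_fintype_prod_volume_eq_prod fun (i : ι) (t : ℝ) =>
      (if i = k then t else 1) * Real.exp (-t ^ 2)]
    refine Finset.prod_eq_zero (Finset.mem_univ k) ?_
    simpa using integral_mul_exp_neg_sq

/-- The same factorization with two marked coordinates: an odd factor remains unless they coincide,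
and then one second moment `√π / 2` appears. -/
theorem integral_mul_mul_exp_neg_sum_sq (k l : ι) :
    Integrable (fun y : ι → ℝ => y k * y l * Real.exp (-∑ i, y i ^ 2)) ∧
      ∫ y : ι → ℝ, y k * y l * Real.exp (-∑ i, y i ^ 2) =
        if k = l then √Real.pi ^ Fintype.card ι / 2 else 0 := by
  have e : (fun y : ι → ℝ => y k * y l * Real.exp (-∑ i, y i ^ 2)) =
      fun y : ι → ℝ => ∏ i, (fun (i : ι) t =>
        (if i = k then t else 1) * (if i = l then t else 1) * Real.exp (-t ^ 2)) i (y i) := by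
    ext y; rw [← Finset.sum_neg_distrib, Real.exp_sum]
    simp only [Finset.prod_mul_distrib, Finset.prod_ite_eq', Finset.mem_univ, if_true]
  have h0 := integrable_pow_mul_exp_neg_sq 0
  have h1 := integrable_pow_mul_exp_neg_sq 1
  have h2 := integrable_pow_mul_exp_neg_sq 2
  have e2 := integral_gaussian 1
  simp only [neg_mul, one_mul, div_one] at e2
  rw [e]
  constructor
  · refine Integrable.fintype_prod (f := fun (i : ι) t =>
        (if i = k then t else 1) * (if i = l then t else 1) * Real.exp (-t ^ 2)) fun i => ?_
    by_cases h : i = k <;> by_cases h' : i = l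
    · simpa [← h, ← h', ← sq] using h2
    · simpa [h, h', show k ≠ l from fun e => h' (h.trans e)] using h1
    · simpa [h, h', show l ≠ k from fun e => h (h'.trans e)] using h1
    · simpa [h, h'] using h0
  · rw [integral_fintype_prod_volume_eq_prod fun (i : ι) (t : ℝ) =>
      (if i = k then t else 1) * (if i = l then t else 1) * Real.exp (-t ^ 2)]
    split_ifs with hkl
    · subst hkl
      rw [← Finset.mul_prod_erase _ _ (Finset.mem_univ k)]
      have : ∀ i ∈ Finset.univ.erase k, (∫ t : ℝ,
          (if i = k then t else 1) * (if i = k then t else 1) * Real.exp (-t ^ 2)) = √Real.pi := by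
        intro i hi
        simpa [Finset.ne_of_mem_erase hi] using e2
      rw [Finset.prod_congr rfl this]
      simp only [if_true, ← sq, integral_sq_mul_exp_neg_sq, Finset.prod_const,
        Finset.card_erase_of_mem (Finset.mem_univ k), Finset.card_univ]
      have hc : Fintype.card ι = (Fintype.card ι - 1) + 1 :=
        (Nat.succ_pred_eq_of_pos (Fintype.card_pos_iff.2 ⟨k⟩)).symm
      conv_rhs => rw [hc, pow_succ]
      ring
    · refine Finset.prod_eq_zero (Finset.mem_univ k) ?_
      simpa [hkl] using integral_mul_exp_neg_sq

end Gaussian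

end CVSharing

end

noncomputable section

namespace CVSharing

open Matrix

/-! ### Gaussian states without position-momentum correlations -/

section GaussKernel

variable {n : ℕ}

/-- The density `x ↦ (det (π M))^(-1/2) exp (-xᵀ M⁻¹ x)` of the normal distribution with
covariance matrix `M / 2`. -/
def gaussDensity (M : Matrix (Fin n) (Fin n) ℝ) (x : Fin n → ℝ) : ℝ :=
  (√(Real.pi ^ n * M.det))⁻¹ * Real.exp (-(x ⬝ᵥ M⁻¹ *ᵥ x))

/-- The position kernel of the centred Gaussian state with covariance matrix `M ⊕ N`. -/
def gaussKernel (M N : Matrix (Fin n) (Fin n) ℝ) : PositionKernel n := fun x x' =>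
  (((√(Real.pi ^ n * M.det))⁻¹ * Real.exp (-((x + x') ⬝ᵥ M⁻¹ *ᵥ (x + x')) / 4
    - (x - x') ⬝ᵥ N *ᵥ (x - x') / 4) : ℝ) : ℂ)

variable {M N : Matrix (Fin n) (Fin n) ℝ}

theorem gaussKernel_self (x : Fin n → ℝ) : gaussKernel M N x x = gaussDensity M x := by
  simp only [gaussKernel, gaussDensity, sub_self, zero_dotProduct, zero_div, sub_zero]
  have : (x + x) ⬝ᵥ M⁻¹ *ᵥ (x + x) = 4 * (x ⬝ᵥ M⁻¹ *ᵥ x) := by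
    simp [mulVec_add, dotProduct_add, add_dotProduct]; ring
  rw [this]; congr 3; ring

/-- With `M = Bᵀ B` the substitution `x = Bᵀ y` turns the density into a multiple of `exp (-|y|²)`
and `p ⬝ x` into `(B p) ⬝ y`. The second moment of `y` is half the identity, which gives `(B p) ⬝ (B
q) / 2 = p ⬝ M q / 2`. -/
theorem gaussDensity_moments (hM : M.PosDef) :
    (Integrable (gaussDensity M) ∧ ∫ x, gaussDensity M x = 1) ∧
    (∀ p : Fin n → ℝ, Integrable (fun x => p ⬝ᵥ x * gaussDensity M x) ∧
      ∫ x, p ⬝ᵥ x * gaussDensity M x = 0) ∧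
    ∀ p q : Fin n → ℝ, Integrable (fun x => p ⬝ᵥ x * q ⬝ᵥ x * gaussDensity M x) ∧
      ∫ x, p ⬝ᵥ x * q ⬝ᵥ x * gaussDensity M x = p ⬝ᵥ M *ᵥ q / 2 := by
  obtain ⟨B, hB, hMB⟩ := exists_transpose_mul_self hM
  have hBT : IsUnit Bᵀ.det := by rwa [det_transpose]
  set c := (√(Real.pi ^ n * M.det))⁻¹ with hc
  have hd : ∀ y, gaussDensity M (Bᵀ *ᵥ y) = c * Real.exp (-∑ i, y i ^ 2) := by
    intro y
    have : (Bᵀ *ᵥ y) ⬝ᵥ M⁻¹ *ᵥ (Bᵀ *ᵥ y) = ∑ i, y i ^ 2 := by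
      rw [hMB, Matrix.mul_inv_rev, mulVec_mulVec, Matrix.mul_assoc, nonsing_inv_mul _ hBT, Matrix.mul_one,
        mulVec_transpose, ← dotProduct_mulVec, mulVec_mulVec, mul_nonsing_inv _ hB, one_mulVec]
      simp [dotProduct, sq]
    rw [gaussDensity, this]
  have hdot : ∀ p y, p ⬝ᵥ (Bᵀ *ᵥ y) = ∑ k, (B *ᵥ p) k * y k := by
    intro p y
    rw [dotProduct_mulVec, vecMul_transpose]; rfl
  have hdet : |Bᵀ.det|⁻¹ * (c⁻¹ : ℝ)  = √Real.pi ^ n := by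
    have h : |B.det| ≠ 0 := abs_ne_zero.2 hB.ne_zero
    rw [hc, inv_inv, hMB, det_mul, det_transpose, Real.sqrt_mul (by positivity),
      Real.sqrt_mul_self_eq_abs]
    have : √(Real.pi ^ n) = √Real.pi ^ n := by
      rw [Real.sqrt_eq_iff_eq_sq (by positivity) (by positivity), ← pow_mul, mul_comm, pow_mul,
        Real.sq_sqrt Real.pi_pos.le]
    rw [this]; field_simp
  have hc0 : c ≠ 0 := by
    rw [hc]; exact inv_ne_zero (Real.sqrt_pos.2 (mul_pos (by positivity) hM.det_pos)).ne'
  have hb0 : |Bᵀ.det| ≠ 0 := abs_ne_zero.2 hBT.ne_zero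
  -- Transfers an integral over `y` against `exp (-|y|²)` to one over `x`; the Jacobian and the
  -- normalization `c` combine to `√π ^ n`.
  have main : ∀ (f g : (Fin n → ℝ) → ℝ) (I : ℝ), (∀ y, f (Bᵀ *ᵥ y) = g y) →
      Integrable (fun y => g y * Real.exp (-∑ i, y i ^ 2)) →
      ∫ y, g y * Real.exp (-∑ i, y i ^ 2) = √Real.pi ^ n * I →
      Integrable (fun x => f x * gaussDensity M x) ∧ ∫ x, f x * gaussDensity M x = I := by
    intro f g I hfg hi hI
    have e : (fun y => f (Bᵀ *ᵥ y) * gaussDensity M (Bᵀ *ᵥ y)) =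
        fun y => c * (g y * Real.exp (-∑ i, y i ^ 2)) := by
      ext y; rw [hfg, hd]; ring
    constructor
    · rw [← integrable_mulVec_iff Bᵀ hBT, e]
      exact hi.const_mul c
    · have := integral_mulVec Bᵀ hBT fun x => f x * gaussDensity M x
      rw [e, integral_const_mul, hI, ← hdet, smul_eq_mul] at this
      field_simp at this
      exact this.symm
  refine ⟨?_, fun p => ?_, fun p q => ?_⟩
  · have h := integral_exp_neg_sum_sq (ι := Fin n)
    have := main (fun _ => 1) (fun _ => 1) 1 (fun _ => rfl) (by simpa using h.1)
      (by simpa using h.2)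
    simpa using this
  · refine main (fun x => p ⬝ᵥ x) _ 0 (hdot p) ?_ ?_
    · simp_rw [Finset.sum_mul, mul_assoc]
      exact integrable_finsetSum _ fun k _ => (integral_mul_exp_neg_sum_sq k).1.const_mul _
    · simp_rw [Finset.sum_mul, mul_assoc]
      rw [integral_finsetSum _ fun k _ => (integral_mul_exp_neg_sum_sq k).1.const_mul _]
      simp_rw [integral_const_mul, (integral_mul_exp_neg_sum_sq _).2]
      simp
  · have e : ∀ y : Fin n → ℝ, (∑ k, (B *ᵥ p) k * y k) * (∑ k, (B *ᵥ q) k * y k) *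
        Real.exp (-∑ i, y i ^ 2) = ∑ k, ∑ l, (B *ᵥ p) k * (B *ᵥ q) l *
          (y k * y l * Real.exp (-∑ i, y i ^ 2)) := by
      intro y
      rw [Finset.sum_mul_sum, Finset.sum_mul]
      refine Finset.sum_congr rfl fun k _ => ?_
      rw [Finset.sum_mul]
      exact Finset.sum_congr rfl fun l _ => by ring
    have hi : ∀ k l, Integrable fun y : Fin n → ℝ => (B *ᵥ p) k * (B *ᵥ q) l *
          (y k * y l * Real.exp (-∑ i, y i ^ 2)) := fun k l =>
      (integral_mul_mul_exp_neg_sum_sq k l).1.const_mul _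
    refine main (fun x => p ⬝ᵥ x * q ⬝ᵥ x)
      (fun y => (∑ k, (B *ᵥ p) k * y k) * (∑ k, (B *ᵥ q) k * y k)) (p ⬝ᵥ M *ᵥ q / 2)
      (fun y => by rw [hdot, hdot]) ?_ ?_
    · simp_rw [e]
      exact integrable_finsetSum _ fun k _ => integrable_finsetSum _ fun l _ => hi k l
    · simp_rw [e]
      rw [integral_finsetSum _ fun k _ => integrable_finsetSum _ fun l _ => hi k l]
      simp_rw [integral_finsetSum _ fun l _ => hi _ l, integral_const_mul,
        (integral_mul_mul_exp_neg_sum_sq _ _).2]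
      simp only [mul_ite, mul_zero, Finset.sum_ite_eq, Finset.mem_univ, if_true, Fintype.card_fin]
      rw [hMB, ← mulVec_mulVec, dotProduct_mulVec, vecMul_transpose]
      simp only [dotProduct, Finset.sum_div, Finset.mul_sum]
      exact Finset.sum_congr rfl fun k _ => by ring

/-- The characteristic function of a Gaussian state. -/
theorem hasTrace_weyl_gaussKernel (hM : M.PosDef) (ζ : Phase n) :
    HasTrace (applyLeft (weyl ζ) (gaussKernel M N))
      (Complex.exp (-((ζ ⬝ᵥ fromBlocks M 0 0 N *ᵥ ζ : ℝ) : ℂ) / 4)) := by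
  set s : Fin n → ℝ := ζ ∘ Sum.inl with hs
  set t : Fin n → ℝ := ζ ∘ Sum.inr with ht
  set c := (√(Real.pi ^ n * M.det))⁻¹ with hc
  have hMu : IsUnit M.det := hM.det_pos.ne'.isUnit
  have hζ : ζ ⬝ᵥ fromBlocks M 0 0 N *ᵥ ζ = s ⬝ᵥ M *ᵥ s + t ⬝ᵥ N *ᵥ t := by
    rw [fromBlocks_mulVec]
    simp [dotProduct, Fintype.sum_sum_type, hs, ht]
  set G : (Fin n → ℝ) → ℂ := fun z =>
    Complex.exp (-((z ⬝ᵥ M⁻¹ *ᵥ z : ℝ) : ℂ) + ∑ i, (Complex.I * s i) * z i) with hG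
  -- After the shift by `t` the two arguments of the kernel have sum `2 (x + t / 2)` and difference
  -- `t`. So `N` contributes only a constant factor, and the phase `s ⬝ t / 2` of the Weyl operator
  -- is absorbed by recentring at `x + t / 2`.
  have key : (fun x => applyLeft (weyl ζ) (gaussKernel M N) x x) = fun x =>
      (c * Complex.exp (-((t ⬝ᵥ N *ᵥ t : ℝ) : ℂ) / 4)) * G (x + (1 / 2 : ℝ) • t) := by
    ext x
    simp only [applyLeft, weyl, gaussKernel, hG]
    change Complex.exp (Complex.I * ((∑ j, s j * x j + (∑ j, s j * t j) / 2 : ℝ) : ℂ)) *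
      ((c * Real.exp (-((x + t + x) ⬝ᵥ M⁻¹ *ᵥ (x + t + x)) / 4
        - (x + t - x) ⬝ᵥ N *ᵥ (x + t - x) / 4) : ℝ) : ℂ) = _
    have e1 : x + t + x = (2 : ℝ) • (x + (1 / 2 : ℝ) • t) := by
      ext i; simp; ring
    have e2 : x + t - x = t := by simp
    rw [e1, e2]
    set z := x + (1 / 2 : ℝ) • t with hz
    have e3 : ∑ j, s j * x j + (∑ j, s j * t j) / 2 = ∑ j, s j * z j := by
      rw [Finset.sum_div, ← Finset.sum_add_distrib]
      exact Finset.sum_congr rfl fun j _ => by simp [hz]; ring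
    rw [e3]
    push_cast
    rw [mul_left_comm, mul_assoc, ← Complex.exp_add, ← Complex.exp_add]
    congr 2
    rw [Finset.mul_sum]
    have : (2 : ℝ) • z ⬝ᵥ M⁻¹ *ᵥ ((2 : ℝ) • z) = 4 * (z ⬝ᵥ M⁻¹ *ᵥ z) := by
      simp [mulVec_smul]; ring
    rw [this]; push_cast
    have : ∑ i, Complex.I * (↑(s i) * ↑(z i)) = ∑ i, Complex.I * ↑(s i) * (z i : ℂ) :=
      Finset.sum_congr rfl fun i _ => by ring
    rw [this]; ring
  have hgi := gaussian_integral hM.inv (M.map Complex.ofReal *ᵥ fun i => Complex.I * s i)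
    (fun i => Complex.I * s i) (by
      rw [mulVec_mulVec]
      have : M⁻¹.map Complex.ofReal * M.map Complex.ofReal = 1 := by
        have := Matrix.map_mul (L := M⁻¹) (M := M) (f := Complex.ofRealHom)
        rw [nonsing_inv_mul _ hMu] at this
        refine this.symm.trans ?_
        simp
      rw [this, one_mulVec])
  rw [HasTrace, key]
  refine ⟨(Integrable.comp_add_right hgi.1 _).const_mul _, ?_⟩
  rw [integral_const_mul, integral_add_right_eq_self G, hgi.2]
  have hdet : √(Real.pi ^ Fintype.card (Fin n) / M⁻¹.det) = c⁻¹ := by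
    rw [hc, inv_inv, Fintype.card_fin, det_nonsing_inv, Ring.inverse_eq_inv', div_inv_eq_mul]
  have hc0 : (c : ℂ) ≠ 0 := by
    rw [Complex.ofReal_ne_zero, hc]
    exact inv_ne_zero (Real.sqrt_pos.2 (mul_pos (by positivity) hM.det_pos)).ne'
  have hw : (M.map Complex.ofReal *ᵥ fun i => Complex.I * s i) ⬝ᵥ (fun i => Complex.I * s i) =
      -((s ⬝ᵥ M *ᵥ s : ℝ) : ℂ) := by
    simp only [dotProduct, mulVec, Matrix.map_apply]
    push_cast
    rw [← Finset.sum_neg_distrib]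
    refine Finset.sum_congr rfl fun i _ => ?_
    rw [Finset.sum_mul, Finset.mul_sum, ← Finset.sum_neg_distrib]
    refine Finset.sum_congr rfl fun j _ => ?_
    linear_combination ((M i j : ℂ) * s j * s i) * Complex.I_sq
  clear_value c
  rw [hdet, hw, hζ, Complex.ofReal_inv]
  have : (c : ℂ) * Complex.exp (-((t ⬝ᵥ N *ᵥ t : ℝ) : ℂ) / 4) *
      ((c : ℂ)⁻¹ * Complex.exp (-((s ⬝ᵥ M *ᵥ s : ℝ) : ℂ) / 4)) =
      Complex.exp (-((t ⬝ᵥ N *ᵥ t : ℝ) : ℂ) / 4) * Complex.exp (-((s ⬝ᵥ M *ᵥ s : ℝ) : ℂ) / 4) := by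
    field_simp
  rw [this, ← Complex.exp_add]; push_cast; ring_nf

theorem posDef_fromBlocks (hM : M.PosDef) (hN : N.PosDef) : (fromBlocks M 0 0 N).PosDef := by
  refine PosDef.of_dotProduct_mulVec_pos ?_ fun x hx => ?_
  · rw [IsHermitian, fromBlocks_conjTranspose, hM.1, hN.1]; simp
  · have : star x ⬝ᵥ fromBlocks M 0 0 N *ᵥ x =
        star (x ∘ Sum.inl) ⬝ᵥ M *ᵥ (x ∘ Sum.inl) + star (x ∘ Sum.inr) ⬝ᵥ N *ᵥ (x ∘ Sum.inr) := by
      rw [fromBlocks_mulVec]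
      simp [dotProduct, Fintype.sum_sum_type]
    rw [this]
    have h1 := hM.posSemidef.dotProduct_mulVec_nonneg (x ∘ Sum.inl)
    have h2 := hN.posSemidef.dotProduct_mulVec_nonneg (x ∘ Sum.inr)
    by_cases h : x ∘ Sum.inl = 0
    · have h' : x ∘ Sum.inr ≠ 0 := by
        intro h'; apply hx; ext i; cases i with
        | inl i => exact congrFun h i
        | inr i => exact congrFun h' i
      have := hN.dotProduct_mulVec_pos h'
      linarith
    · have := hM.dotProduct_mulVec_pos h
      linarith

theorem isWigner_gaussKernel (hM : M.PosDef) (hN : N.PosDef) :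
    IsWigner (gaussKernel M N) fun x => (Real.pi ^ n * √(fromBlocks M 0 0 N).det)⁻¹ *
      Real.exp (-((x - 0) ⬝ᵥ (fromBlocks M 0 0 N)⁻¹.mulVec (x - 0))) := by
  set V := fromBlocks M 0 0 N with hV
  have hVp : V.PosDef := posDef_fromBlocks hM hN
  have hVu : IsUnit V.det := hVp.det_pos.ne'.isUnit
  have hPp : ((1 / 4 : ℝ) • V).PosDef := hVp.smul (by norm_num)
  have hχ := hasTrace_weyl_gaussKernel (N := N) hM
  rw [← hV] at hχ
  -- The characteristic function has quadratic form `V / 4`, so the Fourier phase `-i x` equals `(V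
  -- / 4) w` for `w = -4 i V⁻¹ x`, and `w ⬝ b / 4` becomes `-x ⬝ V⁻¹ x`.
  have hint := fun x : Phase n => gaussian_integral hPp
    (fun i => -4 * Complex.I * (V⁻¹ *ᵥ x) i) (fun i => -Complex.I * x i) (by
      ext i
      have : x = V *ᵥ (V⁻¹ *ᵥ x) := by rw [mulVec_mulVec, mul_nonsing_inv _ hVu, one_mulVec]
      conv_lhs => rw [this]
      generalize V⁻¹ *ᵥ x = y
      simp only [mulVec, dotProduct, Matrix.map_apply, Matrix.smul_apply, smul_eq_mul]
      push_cast
      rw [Finset.mul_sum]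
      exact Finset.sum_congr rfl fun j _ => by ring)
  have hq : ∀ ζ : Phase n, ζ ⬝ᵥ ((1 / 4 : ℝ) • V) *ᵥ ζ = (ζ ⬝ᵥ V *ᵥ ζ) / 4 := by
    intro ζ; rw [smul_mulVec, dotProduct_smul, smul_eq_mul]; ring
  refine ⟨_, hχ, ?_, fun x => ?_⟩
  · have := (hint 0).1
    simp only [hq] at this
    simpa [neg_div] using this
  · have h := (hint x).2
    simp only [hq] at h
    have e : ∀ ζ : Phase n, Complex.exp (-Complex.I * ((∑ i, x i * ζ i : ℝ) : ℂ)) *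
        Complex.exp (-((ζ ⬝ᵥ V *ᵥ ζ : ℝ) : ℂ) / 4) =
        Complex.exp (-((ζ ⬝ᵥ V *ᵥ ζ / 4 : ℝ) : ℂ) + ∑ i, -Complex.I * ↑(x i) * ↑(ζ i)) := by
      intro ζ
      rw [← Complex.exp_add]; congr 1
      push_cast
      rw [Finset.mul_sum, add_comm]
      congr 1
      · ring
      · exact Finset.sum_congr rfl fun j _ => by ring
    simp_rw [e]
    rw [h]
    have hw : (fun i => -4 * Complex.I * ((V⁻¹ *ᵥ x) i : ℂ)) ⬝ᵥ (fun i => -Complex.I * (x i : ℂ)) / 4 =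
        ((-(x ⬝ᵥ V⁻¹ *ᵥ x) : ℝ) : ℂ) := by
      simp only [dotProduct]
      push_cast
      rw [Finset.sum_div, ← Finset.sum_neg_distrib]
      refine Finset.sum_congr rfl fun j _ => ?_
      linear_combination (((V⁻¹ *ᵥ x) j : ℂ) * x j) * Complex.I_sq
    rw [hw, sub_zero, ← Complex.ofReal_exp]
    have hd : √(Real.pi ^ Fintype.card (Fin n ⊕ Fin n) / ((1 / 4 : ℝ) • V).det) =
        (4 * Real.pi) ^ n * (√V.det)⁻¹ := by
      rw [det_smul, Fintype.card_sum, Fintype.card_fin]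
      have : Real.pi ^ (n + n) / ((1 / 4 : ℝ) ^ (n + n) * V.det) =
          ((4 * Real.pi) ^ n) ^ 2 / V.det := by
        have := hVu.ne_zero
        rw [← pow_mul, mul_pow, one_div, inv_pow]; field_simp; ring
      rw [this, Real.sqrt_div (by positivity), Real.sqrt_sq (by positivity), div_eq_mul_inv]
    rw [hd]
    norm_cast
    rw [← mul_assoc]
    congr 2
    have h1 : √V.det ≠ 0 := (Real.sqrt_pos.2 hVp.det_pos).ne'
    have h2 := Real.pi_pos.ne'
    rw [mul_pow, mul_pow, mul_inv, pow_mul (2 : ℝ) 2 n, pow_mul Real.pi 2 n]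
    norm_num
    field_simp
    ring

end GaussKernel

end CVSharing

end

noncomputable section

namespace CVSharing

open Matrix

/-! ### Moments, covariance matrix and Williamson normal form of a Gaussian kernel -/

section GaussKernelMoments

variable {n : ℕ} {M N : Matrix (Fin n) (Fin n) ℝ}

/-- The logarithmic derivative of `x ↦ gaussKernel M N x x'` in direction `j`. -/
def gaussSlope (M N : Matrix (Fin n) (Fin n) ℝ) (x x' : Fin n → ℝ) (j : Fin n) : ℝ :=
  -(M⁻¹ *ᵥ (x + x')) j / 2 - (N *ᵥ (x - x')) j / 2

theorem hasDerivAt_quadratic {A : Matrix (Fin n) (Fin n) ℝ} (hA : A.IsHermitian)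
    (u : Fin n → ℝ) (j : Fin n) :
    HasDerivAt (fun t : ℝ => (u + t • Pi.single j (1 : ℝ)) ⬝ᵥ A *ᵥ (u + t • Pi.single j (1 : ℝ)))
      (2 * (A *ᵥ u) j) 0 := by
  have hs : u ᵥ* A = A *ᵥ u := by
    rw [← mulVec_transpose, ← conjTranspose_eq_transpose_of_trivial, hA]
  have e : (fun t : ℝ => (u + t • Pi.single j (1 : ℝ)) ⬝ᵥ A *ᵥ (u + t • Pi.single j (1 : ℝ))) =
      fun t => u ⬝ᵥ A *ᵥ u + t * (2 * (A *ᵥ u) j) + t ^ 2 * A j j := by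
    ext t
    have h1 : u ⬝ᵥ A *ᵥ Pi.single j (1 : ℝ) = (A *ᵥ u) j := by
      rw [dotProduct_mulVec, hs]; simp
    simp only [mulVec_add, mulVec_smul, dotProduct_add, add_dotProduct, dotProduct_smul,
      smul_dotProduct, smul_eq_mul, h1]
    simp
    ring
  rw [e]
  have h1 := ((hasDerivAt_id (0 : ℝ)).mul_const (2 * (A *ᵥ u) j)).const_add (u ⬝ᵥ A *ᵥ u)
  have h2 := (hasDerivAt_pow 2 (0 : ℝ)).mul_const (A j j)
  refine (h1.add h2).congr_deriv ?_
  simp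

theorem hasLineDerivAt_gaussKernel (hM : M.PosDef) (hN : N.PosDef) (x x' : Fin n → ℝ) (j : Fin n) :
    HasLineDerivAt ℝ (fun z => gaussKernel M N z x') (gaussSlope M N x x' j * gaussKernel M N x x')
      x (Pi.single j 1) := by
  have h1 := hasDerivAt_quadratic hM.inv.1 (x + x') j
  have h2 := hasDerivAt_quadratic hN.1 (x - x') j
  have h3 := (((h1.fun_neg.div_const 4).fun_sub (h2.div_const 4)).exp.const_mul
    (√(Real.pi ^ n * M.det))⁻¹).ofReal_comp
  unfold HasLineDerivAt
  have e : ∀ t : ℝ, x + t • Pi.single j (1 : ℝ) + x' = x + x' + t • Pi.single j (1 : ℝ) :=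
    fun t => by abel
  have e' : ∀ t : ℝ, x + t • Pi.single j (1 : ℝ) - x' = x - x' + t • Pi.single j (1 : ℝ) :=
    fun t => by abel
  simp only [gaussKernel, e, e']
  refine h3.congr_deriv ?_
  simp only [zero_smul, add_zero, gaussSlope]
  push_cast
  ring

/-- The prefactor `c p` is what a first quadrature leaves behind; this is the product rule for
applying a momentum after it. -/
theorem lineDeriv_mul_gaussKernel (hM : M.PosDef) (hN : N.PosDef) {p : (Fin n → ℝ) → ℝ} {p' : ℝ}
    {x : Fin n → ℝ} {j : Fin n} (hp : HasLineDerivAt ℝ p p' x (Pi.single j 1))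
    (x' : Fin n → ℝ) (c : ℂ) :
    lineDeriv ℝ (fun z => c * ((p z : ℂ) * gaussKernel M N z x')) x (Pi.single j 1) =
      c * ((p' + p x * gaussSlope M N x x' j : ℝ) * gaussKernel M N x x') := by
  have h1 := hasLineDerivAt_gaussKernel hM hN x x' j
  have h2 : HasDerivAt (fun t : ℝ => ((p (x + t • Pi.single j (1 : ℝ)) : ℝ) : ℂ)) p' 0 :=
    HasDerivAt.ofReal_comp hp
  have h3 := (h2.fun_mul h1).const_mul c
  have h4 : HasLineDerivAt ℝ (fun z => c * ((p z : ℂ) * gaussKernel M N z x')) _ x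
    (Pi.single j 1) := h3
  refine h4.lineDeriv.trans ?_
  simp only [zero_smul, add_zero]
  push_cast
  ring

theorem hasLineDerivAt_gaussSlope (x x' : Fin n → ℝ) (i j : Fin n) :
    HasLineDerivAt ℝ (fun z => gaussSlope M N z x' i) (-(M⁻¹ i j) / 2 - N i j / 2)
      x (Pi.single j 1) := by
  unfold HasLineDerivAt
  have e : (fun t : ℝ => gaussSlope M N (x + t • Pi.single j (1 : ℝ)) x' i) = fun t =>
      gaussSlope M N x x' i + t * (-(M⁻¹ i j) / 2 - N i j / 2) := by
    ext t
    have e1 : x + t • Pi.single j (1 : ℝ) + x' = x + x' + t • Pi.single j (1 : ℝ) := by abel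
    have e2 : x + t • Pi.single j (1 : ℝ) - x' = x - x' + t • Pi.single j (1 : ℝ) := by abel
    simp only [gaussSlope, e1, e2, mulVec_add, mulVec_smul, Pi.add_apply, Pi.smul_apply,
      smul_eq_mul]
    simp
    ring
  rw [e]
  have := ((hasDerivAt_id (0 : ℝ)).mul_const (-(M⁻¹ i j) / 2 - N i j / 2)).const_add
    (gaussSlope M N x x' i)
  refine this.congr_deriv ?_
  simp

theorem hasLineDerivAt_coord (x : Fin n → ℝ) (i j : Fin n) :
    HasLineDerivAt ℝ (fun z : Fin n → ℝ => z i) (if i = j then 1 else 0) x (Pi.single j 1) := by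
  unfold HasLineDerivAt
  have := ((hasDerivAt_id (0 : ℝ)).mul_const ((Pi.single j (1 : ℝ) : Fin n → ℝ) i)).const_add (x i)
  refine this.congr_deriv ?_
  simp [Pi.single_apply]

theorem quadrature_inl_apply (ψ : Wave n) (x : Fin n → ℝ) (i : Fin n) :
    quadrature (Sum.inl i) ψ x = x i * ψ x := rfl

theorem quadrature_inr_apply (ψ : Wave n) (x : Fin n → ℝ) (i : Fin n) :
    quadrature (Sum.inr i) ψ x = -Complex.I * lineDeriv ℝ ψ x (Pi.single i 1) := rfl

theorem quadrature_inr_gaussKernel (hM : M.PosDef) (hN : N.PosDef) (x x' : Fin n → ℝ)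
    (i : Fin n) : quadrature (Sum.inr i) (fun z => gaussKernel M N z x') x =
      -Complex.I * (gaussSlope M N x x' i * gaussKernel M N x x') := by
  rw [quadrature_inr_apply, (hasLineDerivAt_gaussKernel hM hN x x' i).lineDeriv]

/-- On the diagonal `x' = x` the form `N` drops out, so `N` enters the second moments only through
the derivative of the slope. -/
theorem gaussSlope_self (x : Fin n → ℝ) (j : Fin n) :
    gaussSlope M N x x j = (-(M⁻¹ j)) ⬝ᵥ x := by
  rw [gaussSlope, sub_self, mulVec_zero, mulVec_add, neg_dotProduct]
  simp only [Pi.add_apply, Pi.zero_apply, mulVec]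
  ring

/-- Reduces a trace to a real moment of `gaussDensity`, with the factors of `i` collected in `c`. -/
theorem HasTrace.of_real {A : PositionKernel n} {f : (Fin n → ℝ) → ℝ} {c : ℂ} {I : ℝ}
    {z : ℂ} (h : ∀ x, A x x = c * f x) (hf : Integrable f ∧ ∫ x, f x = I) (hz : z = c * I) :
    HasTrace A z := by
  have e : (fun x => A x x) = fun x => c * (f x : ℂ) := funext h
  rw [HasTrace, e]
  refine ⟨hf.1.ofReal.const_mul c, ?_⟩
  rw [integral_const_mul, integral_complex_ofReal, hf.2, hz]

theorem isMean_gaussKernel (hM : M.PosDef) (hN : N.PosDef) : IsMean (gaussKernel M N) 0 := by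
  obtain ⟨-, h1, -⟩ := gaussDensity_moments hM
  rintro (i | i)
  · refine HasTrace.of_real (c := 1) (f := fun x => Pi.single i 1 ⬝ᵥ x * gaussDensity M x)
      (fun x => ?_) (h1 _) (by simp)
    rw [applyLeft, quadrature_inl_apply, gaussKernel_self]
    simp
  · refine HasTrace.of_real (c := -Complex.I) (f := fun x => -(M⁻¹ i) ⬝ᵥ x * gaussDensity M x)
      (fun x => ?_) (h1 _) (by simp)
    rw [applyLeft, quadrature_inr_gaussKernel hM hN, gaussKernel_self, gaussSlope_self]
    simp

theorem centred_zero (i : Fin n ⊕ Fin n) : centred (0 : Phase n) i = quadrature i := by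
  ext ψ x; simp [centred]

/-- The position moments are those of the normal density. For `q_i p_j + p_j q_i` the moment of
`x_i` with the slope is `-δ_ij / 2`; doubled, it cancels the `δ_ij` from differentiating `x_i`. For
`p_i p_j` the mean of the product of slopes, `(M⁻¹)_ij / 2`, cancels the `M⁻¹` part of the
derivative of the slope, leaving `N_ij / 2`, and the two orders add up to `N_ij`. -/
theorem isCovariance_gaussKernel (hM : M.PosDef) (hN : N.PosDef) :
    IsCovariance (gaussKernel M N) 0 (fromBlocks M 0 0 N) := by
  refine ⟨isMean_gaussKernel hM hN, ?_⟩
  obtain ⟨h0, -, h2⟩ := gaussDensity_moments hM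
  have hMu : IsUnit M.det := hM.det_pos.ne'.isUnit
  have hqq : ∀ i j, HasTrace (applyLeft (fun ψ x => quadrature (Sum.inl i) (quadrature (Sum.inl j) ψ) x
      + quadrature (Sum.inl j) (quadrature (Sum.inl i) ψ) x) (gaussKernel M N)) (M i j : ℂ) := by
    intro i j
    refine HasTrace.of_real (c := 2)
      (f := fun x => Pi.single i 1 ⬝ᵥ x * Pi.single j 1 ⬝ᵥ x * gaussDensity M x)
      (fun x => ?_) (h2 _ _) (by simp; ring)
    simp only [applyLeft, quadrature, gaussKernel_self]
    simp
    ring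
  have hqp : ∀ i j, HasTrace (applyLeft (fun ψ x => quadrature (Sum.inl i) (quadrature (Sum.inr j) ψ) x
      + quadrature (Sum.inr j) (quadrature (Sum.inl i) ψ) x) (gaussKernel M N)) 0 := by
    intro i j
    have h2' := h2 (Pi.single i 1) (-(M⁻¹ j))
    have e : Pi.single i 1 ⬝ᵥ M *ᵥ (-(M⁻¹ j)) = -(if i = j then 1 else 0) := by
      have hs : M⁻¹ j = fun k => M⁻¹ k j := by
        ext k
        have := congrFun (congrFun hM.inv.1 k) j
        simpa using this
      have : (M *ᵥ fun k => M⁻¹ k j) i = (M * M⁻¹) i j := rfl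
      rw [mul_nonsing_inv _ hMu, one_apply] at this
      rw [hs, mulVec_neg, dotProduct_neg, single_one_dotProduct, this]
    rw [e] at h2'
    refine HasTrace.of_real (c := -Complex.I)
      (f := fun x => 2 * (Pi.single i 1 ⬝ᵥ x * (-(M⁻¹ j)) ⬝ᵥ x * gaussDensity M x) +
        (if i = j then 1 else 0) * gaussDensity M x)
      (fun x => ?_) ⟨(h2'.1.const_mul 2).add (h0.1.const_mul _), rfl⟩ ?_
    · have := lineDeriv_mul_gaussKernel hM hN (hasLineDerivAt_coord x i j) x 1
      simp only [one_mul] at this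
      simp only [applyLeft]
      rw [show quadrature (Sum.inr j) (quadrature (Sum.inl i) fun z => gaussKernel M N z x) x =
        -Complex.I * lineDeriv ℝ (fun z => (z i : ℂ) * gaussKernel M N z x) x (Pi.single j 1)
        from rfl, this, quadrature_inl_apply, quadrature_inr_gaussKernel hM hN, gaussKernel_self,
        gaussSlope_self]
      simp only [single_one_dotProduct]
      push_cast
      ring
    · rw [integral_add (h2'.1.const_mul 2) (h0.1.const_mul _), integral_const_mul,
        integral_const_mul, h2'.2, h0.2]
      simp
      ring_nf
  have hpp : ∀ i j, HasTrace (applyLeft (fun ψ x => quadrature (Sum.inr i) (quadrature (Sum.inr j) ψ) x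
      + quadrature (Sum.inr j) (quadrature (Sum.inr i) ψ) x) (gaussKernel M N)) (N i j : ℂ) := by
    intro i j
    have h2' := h2 (-(M⁻¹ i)) (-(M⁻¹ j))
    have hs : ∀ a b, M⁻¹ a b = M⁻¹ b a := by
      intro a b
      have := congrFun (congrFun hM.inv.1 a) b
      simpa using this.symm
    have hsN : N j i = N i j := by
      have := congrFun (congrFun hN.1 i) j
      simpa using this
    have e : (-(M⁻¹ i)) ⬝ᵥ M *ᵥ (-(M⁻¹ j)) = M⁻¹ i j := by
      have : M *ᵥ (M⁻¹ j) = Pi.single j 1 := by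
        ext k
        have h : (M *ᵥ fun k => M⁻¹ k j) k = (M * M⁻¹) k j := rfl
        rw [mul_nonsing_inv _ hMu, one_apply] at h
        rw [show M⁻¹ j = fun k => M⁻¹ k j from funext fun k => hs j k, h, Pi.single_apply]
      rw [mulVec_neg, this]
      simp
    rw [e] at h2'
    have hpq : ∀ i j x, quadrature (Sum.inr i) (quadrature (Sum.inr j)
        fun z => gaussKernel M N z x) x = -((-(M⁻¹ j i) / 2 - N j i / 2 +
          (-(M⁻¹ j)) ⬝ᵥ x * (-(M⁻¹ i)) ⬝ᵥ x : ℝ) : ℂ) * gaussDensity M x := by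
      intro i j x
      have h := lineDeriv_mul_gaussKernel hM hN (hasLineDerivAt_gaussSlope (M := M) (N := N) x x j i)
        x (-Complex.I)
      have e : quadrature (Sum.inr j) (fun z => gaussKernel M N z x) =
          fun z => -Complex.I * (gaussSlope M N z x j * gaussKernel M N z x) :=
        funext fun z => quadrature_inr_gaussKernel hM hN z x j
      rw [e, quadrature_inr_apply, h, gaussSlope_self, gaussSlope_self, gaussKernel_self]
      linear_combination (((-(M⁻¹ j i) / 2 - N j i / 2 +
          (-(M⁻¹ j)) ⬝ᵥ x * (-(M⁻¹ i)) ⬝ᵥ x : ℝ) : ℂ) * gaussDensity M x) * Complex.I_sq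
    refine HasTrace.of_real (c := 1)
      (f := fun x => -2 * ((-(M⁻¹ i)) ⬝ᵥ x * (-(M⁻¹ j)) ⬝ᵥ x * gaussDensity M x) +
        (M⁻¹ i j + N i j) * gaussDensity M x)
      (fun x => ?_) ⟨(h2'.1.const_mul (-2)).add (h0.1.const_mul _), rfl⟩ ?_
    · simp only [applyLeft]
      rw [hpq, hpq, hs j i, hsN]
      push_cast
      ring
    · rw [integral_add (h2'.1.const_mul (-2)) (h0.1.const_mul _), integral_const_mul,
        integral_const_mul, h2'.2, h0.2]
      push_cast
      ring
  rw [show centred (n := n) 0 = quadrature from funext centred_zero]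
  rintro (i | i) (j | j)
  · simpa using hqq i j
  · simpa using hqp i j
  · have h := hqp j i
    simp_rw [add_comm (quadrature (Sum.inl j) _ _)] at h
    simpa using h
  · simpa using hpp i j

theorem isGaussian_gaussKernel (hM : M.PosDef) (hN : N.PosDef) :
    IsGaussian (gaussKernel M N) 0 (fromBlocks M 0 0 N) :=
  ⟨isCovariance_gaussKernel hM hN, posDef_fromBlocks hM hN, isWigner_gaussKernel hM hN⟩

/-- The symplectic spectrum from a simultaneous diagonalization. -/
theorem isSymplecticSpectrum_fromBlocks {L : Matrix (Fin n) (Fin n) ℝ} {ν : Fin n → ℝ}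
    (hL : IsUnit L.det) (hν : ∀ i, 0 < ν i) (h1 : M = L * diagonal ν * Lᵀ)
    (h2 : Lᵀ * N * L = diagonal ν) : IsSymplecticSpectrum (fromBlocks M 0 0 N) ν := by
  have hLT : IsUnit Lᵀ.det := by rwa [det_transpose]
  -- Positions transform by `L` and momenta contragrediently by `(L⁻¹)ᵀ`; this is exactly what
  -- preserves the symplectic form `J`.
  refine ⟨hν, fromBlocks L 0 0 (L⁻¹)ᵀ, ?_, ?_⟩
  · rw [SymplecticGroup.mem_iff]
    simp only [J, fromBlocks_transpose, fromBlocks_multiply]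
    simp [transpose_nonsing_inv, mul_nonsing_inv _ hL, nonsing_inv_mul _ hLT]
  · have hd : diagonal (Sum.elim ν ν) = fromBlocks (diagonal ν) 0 0 (diagonal ν) := by
      rw [fromBlocks_diagonal]
    have h3 : (L⁻¹)ᵀ * diagonal ν * L⁻¹ = N := by
      rw [← h2, transpose_nonsing_inv]
      calc _ = (Lᵀ⁻¹ * Lᵀ) * N * (L * L⁻¹) := by simp only [Matrix.mul_assoc]
        _ = N := by rw [nonsing_inv_mul _ hLT, mul_nonsing_inv _ hL]; simp
    rw [hd, fromBlocks_transpose, fromBlocks_multiply, fromBlocks_multiply]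
    simp [h3, ← h1]

end GaussKernelMoments

end CVSharing

end

noncomputable section

namespace CVSharing

open Polynomial

/-! ### Hermite functions of one variable -/

section Hermite

/-- `exp (i θ t - t² / 2)`. -/
def phaseGauss (θ t : ℝ) : ℂ := Complex.exp (Complex.I * θ * t - t ^ 2 / 2)

theorem norm_phaseGauss (θ t : ℝ) : ‖phaseGauss θ t‖ = Real.exp (-t ^ 2 / 2) := by
  have : Complex.I * θ * t - t ^ 2 / 2 = ((-t ^ 2 / 2 : ℝ) : ℂ) + ((θ * t : ℝ) : ℂ) * Complex.I := by
    push_cast; ring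
  rw [phaseGauss, Complex.norm_exp, this, Complex.add_re, Complex.ofReal_re, Complex.re_ofReal_mul]
  simp

theorem continuous_phaseGauss (θ : ℝ) : Continuous (phaseGauss θ) := by
  unfold phaseGauss; fun_prop

theorem integrable_aeval_mul_phaseGauss (p : ℤ[X]) (θ : ℝ) :
    Integrable fun t : ℝ => aeval (t : ℂ) p * phaseGauss θ t := by
  induction p using Polynomial.induction_on' with
  | add p q hp hq =>
    exact (hp.add hq).congr (Filter.Eventually.of_forall fun t => by simp [add_mul])
  | monomial n c =>
    have h := integrable_rpow_mul_exp_neg_mul_sq (b := 1 / 2) (by norm_num) (s := n)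
      (by linarith [n.cast_nonneg (α := ℝ)])
    simp only [Real.rpow_natCast] at h
    have h' : Integrable fun t : ℝ => (t : ℂ) ^ n * phaseGauss θ t := by
      refine h.mono ?_ (Filter.Eventually.of_forall fun t => ?_)
      · exact (Continuous.mul (by fun_prop) (continuous_phaseGauss θ)).aestronglyMeasurable
      · rw [norm_mul, norm_phaseGauss, norm_mul, norm_pow, norm_pow, Complex.norm_real,
          Real.norm_of_nonneg (Real.exp_pos _).le]
        apply le_of_eq; ring_nf
    refine (h'.const_mul (c : ℂ)).congr (Filter.Eventually.of_forall fun t => ?_)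
    simp [aeval_monomial, mul_assoc]

/-- The derivative of `p * phaseGauss θ` is integrable and so has integral zero; its three terms are
the three integrals here. -/
theorem integral_X_mul_phaseGauss (p : ℤ[X]) (θ : ℝ) :
    ∫ t : ℝ, aeval (t : ℂ) (X * p) * phaseGauss θ t =
      (∫ t : ℝ, aeval (t : ℂ) (derivative p) * phaseGauss θ t) +
        Complex.I * θ * ∫ t : ℝ, aeval (t : ℂ) p * phaseGauss θ t := by
  have hd : ∀ t : ℝ, HasDerivAt (fun t : ℝ => aeval (t : ℂ) p * phaseGauss θ t)
      (aeval (t : ℂ) (derivative p) * phaseGauss θ t +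
        Complex.I * θ * (aeval (t : ℂ) p * phaseGauss θ t) -
        aeval (t : ℂ) (X * p) * phaseGauss θ t) t := by
    intro t
    have h1 : HasDerivAt (fun t : ℝ => aeval (t : ℂ) p) (aeval (t : ℂ) (derivative p)) t :=
      (p.hasDerivAt_aeval (t : ℂ)).comp_ofReal
    have h2 : HasDerivAt (fun z : ℂ => Complex.exp (Complex.I * θ * z - z ^ 2 / 2))
        (Complex.exp (Complex.I * θ * t - t ^ 2 / 2) * (Complex.I * θ - t)) t := by
      have := ((hasDerivAt_id (t : ℂ)).const_mul (Complex.I * θ)).fun_sub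
        (((hasDerivAt_id (t : ℂ)).fun_pow 2).div_const 2)
      refine this.cexp.congr_deriv ?_
      simp
    have h3 : HasDerivAt (phaseGauss θ) (phaseGauss θ t * (Complex.I * θ - t)) t := h2.comp_ofReal
    refine (h1.fun_mul h3).congr_deriv ?_
    simp only [map_mul, aeval_X]
    ring
  have i1 := integrable_aeval_mul_phaseGauss p θ
  have i2 := integrable_aeval_mul_phaseGauss (derivative p) θ
  have i3 := integrable_aeval_mul_phaseGauss (X * p) θ
  have i12 : Integrable fun t : ℝ => aeval (t : ℂ) (derivative p) * phaseGauss θ t +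
      Complex.I * θ * (aeval (t : ℂ) p * phaseGauss θ t) := i2.add (i1.const_mul _)
  have h := integral_eq_zero_of_hasDerivAt_of_integrable hd (i12.sub i3) i1
  rw [integral_sub i12 i3, integral_add i2 (i1.const_mul _),
    integral_const_mul] at h
  exact (sub_eq_zero.1 h).symm

theorem integral_phaseGauss (θ : ℝ) :
    ∫ t : ℝ, phaseGauss θ t = (√(2 * Real.pi) : ℝ) * Complex.exp (-θ ^ 2 / 2) := by
  have h := integral_cexp_quadratic (b := -(1 / 2)) (by norm_num) (Complex.I * θ) 0
  have e : ∀ t : ℝ, phaseGauss θ t =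
      Complex.exp (-(1 / 2) * (t : ℂ) ^ 2 + Complex.I * θ * t + 0) := fun t => by
    rw [phaseGauss]; congr 1; ring
  simp_rw [e]
  rw [h, Real.sqrt_eq_rpow, Complex.ofReal_cpow (by positivity)]
  congr 2
  · push_cast; field_simp
  · push_cast; ring
  · rw [mul_pow, Complex.I_sq]; ring

/-- In `hermite (n + 1) = X * hermite n - (hermite n)'` the derivative term cancels the one from
integration by parts, so each step contributes a factor `i θ`. -/
theorem integral_hermite_mul_phaseGauss (n : ℕ) (θ : ℝ) :
    ∫ t : ℝ, aeval (t : ℂ) (hermite n) * phaseGauss θ t =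
      (√(2 * Real.pi) : ℝ) * (Complex.I * θ) ^ n * Complex.exp (-θ ^ 2 / 2) := by
  induction n with
  | zero => simp [integral_phaseGauss]
  | succ n ih =>
    have h := integral_X_mul_phaseGauss (hermite n) θ
    have i2 := integrable_aeval_mul_phaseGauss (derivative (hermite n)) θ
    have i3 := integrable_aeval_mul_phaseGauss (X * hermite n) θ
    simp_rw [hermite_succ, map_sub, sub_mul]
    rw [integral_sub i3 i2, h, ih]
    ring

/-- The same cancellation at frequency zero, where `phaseGauss 0` is the weight `exp (-t² / 2)`:
each step moves one derivative onto `q`, an integrated form of Rodrigues' formula. -/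
theorem integral_hermite_mul (n : ℕ) (q : ℤ[X]) :
    ∫ t : ℝ, aeval (t : ℂ) (hermite n * q) * phaseGauss 0 t =
      ∫ t : ℝ, aeval (t : ℂ) (derivative^[n] q) * phaseGauss 0 t := by
  induction n generalizing q with
  | zero => simp
  | succ n ih =>
    have h := integral_X_mul_phaseGauss (hermite n * q) 0
    have i2 := integrable_aeval_mul_phaseGauss (derivative (hermite n) * q) 0
    have i3 := integrable_aeval_mul_phaseGauss (X * (hermite n * q)) 0
    have i4 := integrable_aeval_mul_phaseGauss (hermite n * derivative q) 0
    have e : hermite (n + 1) * q = X * (hermite n * q) - derivative (hermite n) * q := by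
      rw [hermite_succ]; ring
    rw [e]
    simp_rw [map_sub, sub_mul]
    rw [integral_sub i3 i2, h, derivative_mul]
    simp_rw [map_add, add_mul]
    rw [integral_add i2 i4, ih (derivative q), Function.iterate_succ_apply]
    simp

/-- Moving `m` derivatives onto a polynomial of lower degree kills it; onto the monic `hermite m` it
leaves `m!`. -/
theorem integral_hermite_mul_hermite (m n : ℕ) :
    ∫ t : ℝ, aeval (t : ℂ) (hermite m * hermite n) * phaseGauss 0 t =
      if m = n then ((√(2 * Real.pi) * n.factorial : ℝ) : ℂ) else 0 := by
  have lt : ∀ m n : ℕ, n < m →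
      ∫ t : ℝ, aeval (t : ℂ) (hermite m * hermite n) * phaseGauss 0 t = 0 := by
    intro m n h
    rw [integral_hermite_mul, iterate_derivative_eq_zero (by rwa [natDegree_hermite])]
    simp
  rcases lt_trichotomy m n with h | h | h
  · rw [if_neg h.ne, mul_comm]; exact lt n m h
  · subst h
    have : derivative^[m] (hermite m) = C (m.factorial : ℤ) := by
      ext j
      rw [coeff_iterate_derivative, coeff_C]
      rcases Nat.eq_zero_or_pos j with rfl | hj
      · simp [coeff_hermite_self, Nat.descFactorial_self]
      · rw [coeff_hermite_of_lt (by omega), if_neg hj.ne', smul_zero]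
    rw [integral_hermite_mul, this, if_pos rfl]
    simp [integral_const_mul, integral_phaseGauss]
    ring
  · rw [if_neg h.ne']; exact lt m n h

/-- The normalized Hermite functions. -/
def hermiteFun (n : ℕ) (x : ℝ) : ℝ :=
  (√(√Real.pi * n.factorial))⁻¹ * aeval (√2 * x) (hermite n) * Real.exp (-x ^ 2 / 2)

theorem ofReal_aeval (t : ℝ) (p : ℤ[X]) : ((aeval t p : ℝ) : ℂ) = aeval (t : ℂ) p :=
  (aeval_algebraMap_apply ℂ t p).symm

theorem continuous_hermiteFun (n : ℕ) : Continuous (hermiteFun n) := by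
  unfold hermiteFun
  have : Continuous fun x : ℝ => aeval (√2 * x) (hermite n) :=
    (hermite n).continuous_aeval.comp (by fun_prop)
  fun_prop

theorem phaseGauss_zero (t : ℝ) : phaseGauss 0 t = (Real.exp (-t ^ 2 / 2) : ℝ) := by
  rw [phaseGauss]; push_cast; congr 1; ring

/-- The polynomials `hermite` are orthogonal for `exp (-t² / 2)`; the substitution `t = √2 x` turns
the product of the two Gaussian factors, `exp (-x²)`, into this weight. -/
theorem integral_hermiteFun_mul (m n : ℕ) :
    Integrable (fun x => hermiteFun m x * hermiteFun n x) ∧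
      ∫ x, hermiteFun m x * hermiteFun n x = if m = n then 1 else 0 := by
  set c := (√(√Real.pi * m.factorial))⁻¹ * (√(√Real.pi * n.factorial))⁻¹ with hc
  set F : ℝ → ℝ := fun t => aeval t (hermite m * hermite n) * Real.exp (-t ^ 2 / 2) with hF
  have e : (fun x => hermiteFun m x * hermiteFun n x) = fun x => c * F (√2 * x) := by
    ext x
    simp only [hermiteFun, hF, map_mul]
    have : Real.exp (-(√2 * x) ^ 2 / 2) = Real.exp (-x ^ 2 / 2) * Real.exp (-x ^ 2 / 2) := by
      rw [← Real.exp_add]; congr 1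
      rw [mul_pow, Real.sq_sqrt (by norm_num)]; ring
    rw [this]; ring
  have hFc : ∀ t, (F t : ℂ) = aeval (t : ℂ) (hermite m * hermite n) * phaseGauss 0 t := by
    intro t; rw [phaseGauss_zero, ← ofReal_aeval]; simp [hF]
  have hFi : Integrable F := by
    have := integrable_aeval_mul_phaseGauss (hermite m * hermite n) 0
    simp_rw [← hFc] at this
    simpa using this.re
  have h2 : √2 ≠ 0 := by positivity
  rw [e]
  refine ⟨(hFi.comp_mul_left' h2).const_mul c, ?_⟩
  rw [integral_const_mul, Measure.integral_comp_mul_left F]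
  have hI : ∫ t, F t = if m = n then √(2 * Real.pi) * n.factorial else 0 := by
    have := integral_hermite_mul_hermite m n
    simp_rw [← hFc] at this
    rw [integral_complex_ofReal] at this
    split_ifs at this ⊢ <;> exact_mod_cast this
  rw [hI]
  split_ifs with h
  · subst h
    have h3 : (0 : ℝ) < √Real.pi * m.factorial :=
      mul_pos (Real.sqrt_pos.2 Real.pi_pos) (by exact_mod_cast m.factorial_pos)
    have h4 := (Real.sqrt_pos.2 h3).ne'
    have h5 := Real.mul_self_sqrt h3.le
    rw [hc, abs_of_pos (by positivity), ← mul_inv, h5, Real.sqrt_mul (by norm_num), smul_eq_mul]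
    field_simp
  · simp

/-- The amplitudes of a coherent state in the number basis, up to normalization. The frequency is
taken as `√2 ξ` so that it becomes `ξ` in the variable `t = √2 x`. -/
theorem integral_hermiteFun_mul_phaseGauss (n : ℕ) (ξ : ℝ) :
    ∫ x : ℝ, (hermiteFun n x : ℂ) * Complex.exp (Complex.I * (√2 * ξ : ℝ) * x - x ^ 2 / 2) =
      (√√Real.pi * (√n.factorial)⁻¹ : ℝ) * (Complex.I * ξ) ^ n * Complex.exp (-ξ ^ 2 / 2) := by
  set F : ℝ → ℂ := fun t => aeval (t : ℂ) (hermite n) * phaseGauss ξ t with hF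
  have e : ∀ x : ℝ, (hermiteFun n x : ℂ) *
      Complex.exp (Complex.I * (√2 * ξ : ℝ) * x - x ^ 2 / 2) =
      ((√(√Real.pi * n.factorial))⁻¹ : ℝ) * F (√2 * x) := by
    intro x
    have h2 : ((√2 : ℝ) : ℂ) ^ 2 = 2 := by norm_cast; simp
    simp only [hermiteFun, hF, Complex.ofReal_mul, ofReal_aeval, phaseGauss]
    rw [Complex.ofReal_exp, mul_assoc, mul_assoc, mul_assoc, ← Complex.exp_add]
    push_cast
    congr 3
    rw [mul_pow, h2]; ring
  simp_rw [e]
  rw [integral_const_mul, Measure.integral_comp_mul_left F, hF, integral_hermite_mul_phaseGauss,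
    Complex.real_smul, ← mul_assoc, ← mul_assoc, ← mul_assoc, ← Complex.ofReal_mul,
    ← Complex.ofReal_mul]
  congr 3
  have h1 : 0 < √Real.pi := Real.sqrt_pos.2 Real.pi_pos
  have h2 : √√Real.pi * √√Real.pi = √Real.pi := Real.mul_self_sqrt h1.le
  have h3 : 0 < √√Real.pi := Real.sqrt_pos.2 h1
  have h4 : (0 : ℝ) < √n.factorial := Real.sqrt_pos.2 (by exact_mod_cast n.factorial_pos)
  have h5 : 0 < √(2:ℝ) := by positivity
  rw [Real.sqrt_mul h1.le, Real.sqrt_mul (by norm_num) Real.pi, abs_of_pos (by positivity),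
    mul_inv]
  field_simp
  rw [sq, h2]

/-- The position kernel of the thermal state of one mode with covariance matrix `ν`. -/
def thermalKernel (ν x y : ℝ) : ℝ :=
  (√(Real.pi * ν))⁻¹ * Real.exp (-(x + y) ^ 2 / (4 * ν) - ν * (x - y) ^ 2 / 4)

/-- The ratio `(ν - 1) / (ν + 1)` of successive eigenvalues of a thermal state. -/
def thermalRatio (ν : ℝ) : ℝ := (ν - 1) / (ν + 1)

/-- Mehler's formula in generating-function form: completing the square sends parameter `ξ` to `r
ξ`, so the coefficient of degree `m` in `ξ` is damped by `r^m`. This encodes the whole spectrum of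
the thermal state without any computation on individual Hermite functions. -/
theorem integral_thermalKernel_mul_phaseGauss {ν : ℝ} (hν : 0 < ν) (x ξ : ℝ) :
    ∫ y : ℝ, (thermalKernel ν x y : ℂ) * phaseGauss (√2 * ξ) y =
      (2 / (ν + 1) : ℝ) * Complex.exp ((thermalRatio ν ^ 2 - 1) * ξ ^ 2 / 2) *
        phaseGauss (√2 * (thermalRatio ν * ξ)) x := by
  have hν1 : ν + 1 ≠ 0 := by positivity
  have hνc : (ν : ℂ) ≠ 0 := by exact_mod_cast hν.ne'
  have hν1c : (ν : ℂ) + 1 ≠ 0 := by exact_mod_cast hν1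
  -- The coefficient of `-y²`, namely `1 / (4 ν) + ν / 4` from the kernel plus `1 / 2` from the
  -- packet; `b` and `d` collect the linear and constant terms.
  set A : ℝ := (ν + 1) ^ 2 / (4 * ν) with hA
  have hApos : 0 < A := by positivity
  set b : ℂ := x * (ν ^ 2 - 1) / (2 * ν) + Complex.I * √2 * ξ with hb
  set d : ℂ := -(1 / (4 * ν) + ν / 4) * x ^ 2 with hd
  have e : ∀ y : ℝ, (thermalKernel ν x y : ℂ) * phaseGauss (√2 * ξ) y =
      ((√(Real.pi * ν))⁻¹ : ℝ) * Complex.exp ((-A : ℝ) * (y : ℂ) ^ 2 + b * y + d) := by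
    intro y
    rw [thermalKernel, phaseGauss, Complex.ofReal_mul, Complex.ofReal_exp, mul_assoc,
      ← Complex.exp_add]
    congr 2
    rw [hA, hb, hd]
    push_cast
    field_simp
    ring
  simp_rw [e]
  rw [integral_const_mul, integral_cexp_quadratic (by simpa using hApos)]
  have hpre : ((Real.pi : ℂ) / -((-A : ℝ) : ℂ)) ^ (1 / 2 : ℂ) = (√(Real.pi / A) : ℝ) := by
    rw [Real.sqrt_eq_rpow, Complex.ofReal_cpow (by positivity)]
    push_cast; rw [neg_neg]
  rw [hpre, phaseGauss, mul_assoc (((2 / (ν + 1) : ℝ)) : ℂ), ← Complex.exp_add, ← mul_assoc,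
    ← Complex.ofReal_mul]
  congr 2
  · have h1 : Real.pi / A = (√(Real.pi * ν) * (2 / (ν + 1))) ^ 2 := by
      rw [mul_pow, Real.sq_sqrt (by positivity), hA]; field_simp
      try norm_num
    rw [h1, Real.sqrt_sq (by positivity)]
    have : √(Real.pi * ν) ≠ 0 := by positivity
    field_simp
  · have h2 : ((√2 : ℝ) : ℂ) ^ 2 = 2 := by norm_cast; simp
    rw [hA, hb, hd, thermalRatio]
    push_cast
    have h3 := Complex.I_sq
    field_simp
    ring_nf
    simp only [h2, h3]
    ring

end Hermite

end CVSharing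

end

noncomputable section

namespace CVSharing

/-! ### Operators diagonal in a Hilbert basis -/

section DiagonalOperator

variable {H : Type*} [NormedAddCommGroup H] [InnerProductSpace ℂ H] {ι : Type*}

theorem norm_sub_sum_inner_sq {e : ι → H} (he : Orthonormal ℂ e) (g : H) (s : Finset ι) :
    ‖g - ∑ i ∈ s, inner ℂ (e i) g • e i‖ ^ 2 = ‖g‖ ^ 2 - ∑ i ∈ s, ‖inner ℂ (e i) g‖ ^ 2 := by
  have h₂ : (∑ i ∈ s, ∑ j ∈ s, inner ℂ (e i) g * inner ℂ g (e j) * inner ℂ (e j) (e i)) =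
      (∑ k ∈ s, inner ℂ (e k) g * inner ℂ g (e k) : ℂ) := he.inner_left_right_finset
  have h₃ : ∀ z : ℂ, RCLike.re (z * conj z) = ‖z‖ ^ 2 := by
    intro z
    simp only [RCLike.mul_conj]
    norm_cast
  rw [@norm_sub_sq ℂ, sub_add]
  simp only [@InnerProductSpace.norm_sq_eq_re_inner ℂ H, inner_sum, sum_inner]
  simp only [inner_smul_right, two_mul, inner_smul_left, inner_conj_symm, ← mul_assoc, h₂,
    add_sub_cancel_right, sub_right_inj]
  simp only [map_sum, ← inner_conj_symm g, ← h₃]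

/-- If Parseval's identity holds for `g` and an orthonormal family, then vectors orthogonal to the
family are orthogonal to `g`. -/
theorem inner_eq_zero_of_parseval {e : ι → H} (he : Orthonormal ℂ e) {f g : H}
    (hg : HasSum (fun i => ‖inner ℂ (e i) g‖ ^ 2) (‖g‖ ^ 2)) (hf : ∀ i, inner ℂ f (e i) = 0) :
    inner ℂ f g = 0 := by
  -- Since `f` is orthogonal to the family, a partial expansion may be subtracted from `g` before
  -- Cauchy–Schwarz is applied; Parseval makes the remainder tend to zero.
  have h1 : ∀ s : Finset ι, ‖inner ℂ f g‖ ^ 2 ≤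
      ‖f‖ ^ 2 * (‖g‖ ^ 2 - ∑ i ∈ s, ‖inner ℂ (e i) g‖ ^ 2) := by
    intro s
    rw [← norm_sub_sum_inner_sq he, ← mul_pow]
    refine pow_le_pow_left₀ (norm_nonneg _) ?_ 2
    have : inner ℂ f g = inner ℂ f (g - ∑ i ∈ s, inner ℂ (e i) g • e i) := by
      rw [inner_sub_right, inner_sum]
      simp [inner_smul_right, hf]
    rw [this]
    exact norm_inner_le_norm _ _
  have h2 : Filter.Tendsto (fun s : Finset ι => ‖f‖ ^ 2 *
      (‖g‖ ^ 2 - ∑ i ∈ s, ‖inner ℂ (e i) g‖ ^ 2)) Filter.atTop (nhds 0) := by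
    have := ((tendsto_const_nhds (x := ‖g‖ ^ 2)).sub hg).const_mul (‖f‖ ^ 2)
    simpa using this
  have h3 := ge_of_tendsto' h2 h1
  have h4 : ‖inner ℂ f g‖ = 0 := by
    have := le_antisymm h3 (sq_nonneg _)
    exact pow_eq_zero_iff two_ne_zero |>.1 this
  exact norm_eq_zero.1 h4

variable [CompleteSpace H]

/-- The operator `∑ i, w i |b i⟩⟨b i|`. -/
def diagonalOperator (b : HilbertBasis ι ℂ H) (w : ι → ℝ) : H →L[ℂ] H :=
  ∑' i, (w i : ℂ) • InnerProductSpace.rankOne ℂ (b i) (b i)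

variable (b : HilbertBasis ι ℂ H) {w : ι → ℝ}

open scoped Classical in
-- The rank-one projections have norm one, so summability of `w` gives norm convergence of the
-- series, and evaluation and inner product pass through it.
theorem inner_diagonalOperator (hw : Summable w) (i : ι) (x : H) :
    inner ℂ (b i) (diagonalOperator b w x) = w i * inner ℂ (b i) x := by
  have hs : Summable fun i => (w i : ℂ) • InnerProductSpace.rankOne ℂ (b i) (b i) := by
    refine Summable.of_norm ?_
    have : ∀ i, ‖(w i : ℂ) • InnerProductSpace.rankOne ℂ (b i) (b i)‖ = ‖w i‖ := by
      intro i
      rw [norm_smul, InnerProductSpace.norm_rankOne, b.orthonormal.1 i]; simp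
    simp_rw [this]
    exact hw.norm
  have h1 := ContinuousLinearMap.hasSum (ContinuousLinearMap.apply ℂ H x) hs.hasSum
  have h2 := ContinuousLinearMap.hasSum (innerSL ℂ (b i)) h1
  have h3 : HasSum (fun j => innerSL ℂ (b i) (ContinuousLinearMap.apply ℂ H x
      ((w j : ℂ) • InnerProductSpace.rankOne ℂ (b j) (b j)))) (w i * inner ℂ (b i) x) := by
    have e : ∀ j, innerSL ℂ (b i) (ContinuousLinearMap.apply ℂ H x
      ((w j : ℂ) • InnerProductSpace.rankOne ℂ (b j) (b j))) =
        if j = i then w i * inner ℂ (b i) x else 0 := by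
      intro j
      have := orthonormal_iff_ite.1 b.orthonormal i j
      simp only [ContinuousLinearMap.apply_apply, smul_apply,
        InnerProductSpace.rankOne_apply, innerSL_apply_apply, inner_smul_right, this]
      by_cases h : j = i
      · subst h; simp
      · rw [if_neg h, if_neg (Ne.symm h)]; simp
    simp_rw [e]
    convert hasSum_ite_eq i ((w i : ℂ) * inner ℂ (b i) x)
  exact h2.unique h3

omit [CompleteSpace H] in
theorem ext_inner_hilbertBasis {x y : H} (h : ∀ i, inner ℂ (b i) x = inner ℂ (b i) y) : x = y := by
  apply b.repr.injective
  ext i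
  rw [b.repr_apply_apply, b.repr_apply_apply, h]

theorem hasSum_inner_diagonalOperator (hw : Summable w) (x : H) :
    HasSum (fun i => w i * ‖inner ℂ (b i) x‖ ^ 2) (inner ℂ x (diagonalOperator b w x)).re := by
  have h := Complex.hasSum_re (b.hasSum_inner_mul_inner x (diagonalOperator b w x))
  convert h using 1
  ext i
  rw [inner_diagonalOperator b hw, mul_left_comm, ← inner_conj_symm x, mul_comm (conj _),
    Complex.mul_conj, Complex.normSq_eq_norm_sq, ← Complex.ofReal_mul, Complex.ofReal_re]

theorem inner_diagonalOperator_symm (hw : Summable w) (x y : H) :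
    inner ℂ (diagonalOperator b w x) y = inner ℂ x (diagonalOperator b w y) := by
  have h1 := b.hasSum_inner_mul_inner (diagonalOperator b w x) y
  have h2 := b.hasSum_inner_mul_inner x (diagonalOperator b w y)
  have e : (fun i => inner ℂ (diagonalOperator b w x) (b i) * inner ℂ (b i) y) =
      fun i => inner ℂ x (b i) * inner ℂ (b i) (diagonalOperator b w y) := by
    ext i
    rw [inner_diagonalOperator b hw, ← inner_conj_symm, inner_diagonalOperator b hw, map_mul,
      inner_conj_symm, Complex.conj_ofReal]
    ring
  rw [e] at h1
  exact h1.unique h2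

theorem isPositive_diagonalOperator (hw : Summable w) (hw0 : ∀ i, 0 ≤ w i) :
    (diagonalOperator b w).IsPositive := by
  refine ⟨fun x y => inner_diagonalOperator_symm b hw x y, fun x => ?_⟩
  rw [ContinuousLinearMap.reApplyInnerSelf_apply, inner_diagonalOperator_symm b hw]
  exact (hasSum_inner_diagonalOperator b hw x).nonneg fun i => mul_nonneg (hw0 i) (sq_nonneg _)

omit [CompleteSpace H] in
theorem hasSum_norm_inner_sq {κ : Type*} (c : HilbertBasis κ ℂ H) (x : H) :
    HasSum (fun i => ‖inner ℂ (c i) x‖ ^ 2) (‖x‖ ^ 2) := by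
  have h := Complex.hasSum_re (c.hasSum_inner_mul_inner x x)
  rw [inner_self_eq_norm_sq_to_K] at h
  convert h using 1
  · ext i
    rw [← inner_conj_symm x, mul_comm, Complex.mul_conj, Complex.ofReal_re,
      Complex.normSq_eq_norm_sq]
  · norm_cast

/-- The trace of a diagonal operator, in any basis. -/
theorem hasSum_trace_diagonalOperator {κ : Type*} {t : ℝ} (hw : HasSum w t) (hw0 : ∀ i, 0 ≤ w i)
    (c : HilbertBasis κ ℂ H) :
    HasSum (fun k => inner ℂ (c k) (diagonalOperator b w (c k))) (t : ℂ) := by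
  have hrow : ∀ i, HasSum (fun k => w i * ‖inner ℂ (b i) (c k)‖ ^ 2) (w i) := by
    intro i
    have := (hasSum_norm_inner_sq c (b i)).mul_left (w i)
    simpa [b.orthonormal.1 i, norm_inner_symm (b i)] using this
  -- A nonnegative double series: summed over `k` first, Parseval gives `w i`; summed over `i`
  -- first, it gives the diagonal entry at `c k`.
  have hs : Summable fun p : ι × κ => w p.1 * ‖inner ℂ (b p.1) (c p.2)‖ ^ 2 := by
    rw [summable_prod_of_nonneg fun p => mul_nonneg (hw0 _) (sq_nonneg _)]
    refine ⟨fun i => (hrow i).summable, ?_⟩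
    simp_rw [(hrow _).tsum_eq]
    exact hw.summable
  have ht : HasSum (fun p : ι × κ => w p.1 * ‖inner ℂ (b p.1) (c p.2)‖ ^ 2) t := by
    have := hs.hasSum
    rwa [← (this.prod_fiberwise hrow).unique hw]
  have ht' := (Equiv.prodComm κ ι).hasSum_iff.2 ht
  have := ht'.prod_fiberwise fun k => hasSum_inner_diagonalOperator b hw.summable (c k)
  have h := Complex.hasSum_ofReal.2 this
  convert h using 1
  ext k
  refine (Complex.conj_eq_iff_re.1 ?_).symm
  rw [inner_conj_symm, inner_diagonalOperator_symm b hw.summable]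

/-- For `p ≠ 0` only finitely many `w i` equal `p`, because `w` tends to zero. An eigenvector has no
coefficients elsewhere, so it is a finite combination and the span needs no closure. -/
theorem eigenspace_diagonalOperator (hw : Summable w) {p : ℝ} (hp : p ≠ 0) :
    Module.End.eigenspace (diagonalOperator b w : H →ₗ[ℂ] H) (p : ℂ) =
      Submodule.span ℂ (Set.range fun i : {i // w i = p} => b i) := by
  ext x
  rw [Module.End.mem_eigenspace_iff]
  constructor
  · intro hx
    have hz : ∀ i, w i ≠ p → inner ℂ (b i) x = 0 := by
      intro i hi
      have h := inner_diagonalOperator b hw i x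
      have hx' : diagonalOperator b w x = (p : ℂ) • x := hx
      rw [hx', inner_smul_right] at h
      have : ((w i : ℂ) - p) * inner ℂ (b i) x = 0 := by rw [sub_mul, h, sub_self]
      refine (mul_eq_zero.1 this).resolve_left ?_
      exact sub_ne_zero.2 (by exact_mod_cast hi)
    have hfin : {i | w i = p}.Finite := by
      have := hw.tendsto_cofinite_zero.eventually_ne hp.symm
      rw [Filter.eventually_cofinite] at this
      simpa using this
    have h1 : HasSum (fun i => inner ℂ (b i) x • b i) (∑ i ∈ hfin.toFinset, inner ℂ (b i) x • b i) :=
      hasSum_sum_of_ne_finset_zero fun i hi => by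
        rw [hz i (by simpa using hi), zero_smul]
    have h2 := b.hasSum_repr x
    simp_rw [b.repr_apply_apply] at h2
    rw [h2.unique h1]
    refine Submodule.sum_mem _ fun i hi => Submodule.smul_mem _ _ (Submodule.subset_span ?_)
    exact ⟨⟨i, by simpa using hi⟩, rfl⟩
  · intro hx
    induction hx using Submodule.span_induction with
    | mem x hx =>
      obtain ⟨⟨i, hi⟩, rfl⟩ := hx
      refine ext_inner_hilbertBasis b fun j => ?_
      change inner ℂ (b j) (diagonalOperator b w (b i)) = _
      rw [inner_diagonalOperator b hw, inner_smul_right]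
      classical
      rw [orthonormal_iff_ite.1 b.orthonormal]
      split_ifs with h
      · rw [h, hi]
      · simp
    | zero => simp
    | add x y _ _ hx hy => rw [map_add, hx, hy, smul_add]
    | smul a x _ hx => rw [map_smul, hx, smul_comm]

theorem finrank_eigenspace_diagonalOperator (hw : Summable w) {p : ℝ} (hp : p ≠ 0) :
    Module.finrank ℂ (Module.End.eigenspace (diagonalOperator b w : H →ₗ[ℂ] H) (p : ℂ)) =
      Nat.card {i // w i = p} := by
  have hfin : {i | w i = p}.Finite := by
    have := hw.tendsto_cofinite_zero.eventually_ne hp.symm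
    rw [Filter.eventually_cofinite] at this
    simpa using this
  have : Fintype {i // w i = p} := hfin.fintype
  rw [eigenspace_diagonalOperator b hw hp, Nat.card_eq_fintype_card]
  exact finrank_span_eq_card (b.orthonormal.linearIndependent.comp _ Subtype.val_injective)

end DiagonalOperator

theorem isDensityOperator_diagonalOperator {n : ℕ} {ι : Type*} (b : HilbertBasis ι ℂ (ModeSpace n))
    {w : ι → ℝ} (hw : HasSum w 1) (hw0 : ∀ i, 0 ≤ w i) :
    IsDensityOperator (diagonalOperator b w) :=
  ⟨isPositive_diagonalOperator b hw.summable hw0, fun κ c => by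
    simpa using hasSum_trace_diagonalOperator b hw hw0 c⟩

/-- The entropy series is regrouped along the fibres of `w`; over `p ≠ 0` the fibre has as many
elements as the multiplicity of `p`. -/
theorem hasSum_spectralEntropy {n : ℕ} {ι : Type*} (b : HilbertBasis ι ℂ (ModeSpace n))
    {w : ι → ℝ} (hw : Summable w) {S : ℝ} (hS : HasSum (fun i => -(w i * Real.logb 2 (w i))) S) :
    HasSum (spectralEntropy (diagonalOperator b w)) S := by
  have h1 := (Equiv.sigmaFiberEquiv w).hasSum_iff.2 hS
  refine h1.sigma fun p => ?_
  have e : (fun c : {i // w i = p} => ((fun i => -(w i * Real.logb 2 (w i))) ∘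
      (Equiv.sigmaFiberEquiv w)) ⟨p, c⟩) = fun _ => -(p * Real.logb 2 p) := by
    ext ⟨i, hi⟩
    simp [Equiv.sigmaFiberEquiv, hi]
  rw [e, spectralEntropy]
  by_cases hp : p = 0
  -- The fibre over `0` may be infinite and need not match `finrank`, but all its terms vanish.
  · simp [hp, hasSum_zero]
  · have hfin : {i | w i = p}.Finite := by
      have := hw.tendsto_cofinite_zero.eventually_ne (Ne.symm hp)
      rw [Filter.eventually_cofinite] at this
      simpa using this
    have : Fintype {i // w i = p} := hfin.fintype
    rw [finrank_eigenspace_diagonalOperator b hw hp, Nat.card_eq_fintype_card]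
    have := hasSum_fintype fun _ : {i // w i = p} => -(p * Real.logb 2 p)
    simpa using this

/-! ### Products of sequences -/

theorem hasSum_pi_prod {n : ℕ} {f : Fin n → ℕ → ℝ} {a : Fin n → ℝ}
    (hf : ∀ j, HasSum (f j) (a j)) :
    HasSum (fun α : Fin n → ℕ => ∏ j, f j (α j)) (∏ j, a j) := by
  induction n with
  | zero => simp
  | succ n ih =>
    have h := ih fun j : Fin n => hf j.succ
    have h0 := hf 0
    have hs : Summable fun x : ℕ × (Fin n → ℕ) => f 0 x.1 * ∏ j, f (Fin.succ j) (x.2 j) :=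
      summable_mul_of_summable_norm (f := f 0) (g := fun α : Fin n → ℕ => ∏ j, f (Fin.succ j) (α j))
        h0.summable.norm h.summable.norm
    have h1 := HasSum.mul (f := f 0) (g := fun α : Fin n → ℕ => ∏ j, f (Fin.succ j) (α j)) h0 h hs
    rw [← (Fin.consEquiv fun _ : Fin (n + 1) => ℕ).hasSum_iff, Fin.prod_univ_succ]
    have e : ((fun α : Fin (n + 1) → ℕ => ∏ j, f j (α j)) ∘ Fin.consEquiv fun _ => ℕ) =
        fun x => f 0 x.1 * ∏ j, f (Fin.succ j) (x.2 j) := by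
      funext p
      simp [Fin.consEquiv, Fin.prod_univ_succ]
    rw [e]
    exact h1

end CVSharing

end

noncomputable section

namespace CVSharing

open Matrix

/-! ### Injectivity of the Fourier transform on integrable functions -/

section FourierInjective

variable {n : ℕ}

theorem norm_exp_I_mul_sum (θ x : Fin n → ℝ) :
    ‖Complex.exp (Complex.I * ((∑ j, θ j * x j : ℝ) : ℂ))‖ = 1 := by
  rw [mul_comm, Complex.norm_exp_ofReal_mul_I]

theorem Integrable.mul_exp_I {F : (Fin n → ℝ) → ℂ} (hF : Integrable F) (θ : Fin n → ℝ) :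
    Integrable fun x => F x * Complex.exp (Complex.I * ((∑ j, θ j * x j : ℝ) : ℂ)) := by
  refine hF.mono (hF.1.mul (Continuous.aestronglyMeasurable (by fun_prop)))
    (Filter.Eventually.of_forall fun x => ?_)
  rw [norm_mul, norm_exp_I_mul_sum, mul_one]

/-- The positive and negative parts of `f` are densities of finite measures with equal
characteristic functions, so they agree almost everywhere. At each point one of the two parts is
zero, hence both are. -/
theorem ae_eq_zero_of_real_fourier {f : (Fin n → ℝ) → ℝ} (hf : Integrable f)
    (h : ∀ θ : Fin n → ℝ,
      ∫ x, (f x : ℂ) * Complex.exp (Complex.I * ((∑ j, θ j * x j : ℝ) : ℂ)) = 0) :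
    f =ᵐ[volume] 0 := by
  have hm := hf.1.aemeasurable
  have hm1 : AEMeasurable (fun x => ENNReal.ofReal (f x)) volume := hm.ennreal_ofReal
  have hm2 : AEMeasurable (fun x => ENNReal.ofReal (-f x)) volume := hm.neg.ennreal_ofReal
  have hfin1 : IsFiniteMeasure (volume.withDensity fun x => ENNReal.ofReal (f x)) :=
    isFiniteMeasure_withDensity_ofReal hf.2
  have hfin2 : IsFiniteMeasure (volume.withDensity fun x => ENNReal.ofReal (-f x)) :=
    isFiniteMeasure_withDensity_ofReal hf.neg.2
  have key : (volume.withDensity fun x => ENNReal.ofReal (f x)) =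
      volume.withDensity fun x => ENNReal.ofReal (-f x) := by
    apply Measure.ext_of_charFunDual
    ext Λ
    rw [charFunDual_apply, charFunDual_apply,
      integral_withDensity_eq_integral_toReal_smul₀ hm1 (by simp),
      integral_withDensity_eq_integral_toReal_smul₀ hm2 (by simp), ← sub_eq_zero]
    set θ : Fin n → ℝ := fun j => Λ (Pi.single j 1) with hθ
    have hΛ : ∀ x, Complex.exp (Λ x * Complex.I) =
        Complex.exp (Complex.I * ((∑ j, θ j * x j : ℝ) : ℂ)) := by
      intro x
      have : Λ x = ∑ j, θ j * x j := by
        conv_lhs => rw [← Finset.univ_sum_single x]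
        rw [map_sum]
        refine Finset.sum_congr rfl fun j _ => ?_
        have : (Pi.single j (x j) : Fin n → ℝ) = x j • Pi.single j 1 := by
          rw [← Pi.single_smul, smul_eq_mul, mul_one]
        rw [this, map_smul, smul_eq_mul, mul_comm]
      rw [this, mul_comm]
    simp_rw [hΛ]
    have i1 := Integrable.mul_exp_I (F := fun x => (((ENNReal.ofReal (f x)).toReal : ℝ) : ℂ))
      (by simp only [ENNReal.toReal_ofReal']; exact hf.pos_part.ofReal) θ
    have i2 := Integrable.mul_exp_I (F := fun x => (((ENNReal.ofReal (-f x)).toReal : ℝ) : ℂ))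
      (by simp only [ENNReal.toReal_ofReal']; exact hf.neg_part.ofReal) θ
    simp_rw [Complex.real_smul]
    rw [← integral_sub i1 i2, ← h θ]
    congr 1
    ext x
    rw [← sub_mul]
    congr 1
    rw [ENNReal.toReal_ofReal', ENNReal.toReal_ofReal', ← Complex.ofReal_sub]
    congr 1
    rcases le_total 0 (f x) with hx | hx
    · rw [max_eq_left hx, max_eq_right (by linarith)]; ring
    · rw [max_eq_right hx, max_eq_left (by linarith)]; ring
  have hne : ∫⁻ x, ENNReal.ofReal (f x) ≠ ⊤ := by
    have := hfin1.measure_univ_lt_top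
    rw [withDensity_apply _ MeasurableSet.univ, Measure.restrict_univ] at this
    exact this.ne
  have := (withDensity_eq_iff hm1 hm2 hne).1 key
  filter_upwards [this] with x hx
  rcases le_total 0 (f x) with h0 | h0
  · have h1 : ENNReal.ofReal (-f x) = 0 := ENNReal.ofReal_of_nonpos (by linarith)
    rw [h1, ENNReal.ofReal_eq_zero] at hx
    exact le_antisymm hx h0
  · have h1 : ENNReal.ofReal (f x) = 0 := ENNReal.ofReal_of_nonpos h0
    rw [h1, eq_comm, ENNReal.ofReal_eq_zero] at hx
    exact le_antisymm h0 (by simpa using hx)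

theorem ae_eq_zero_of_fourier {F : (Fin n → ℝ) → ℂ} (hF : Integrable F)
    (h : ∀ θ : Fin n → ℝ,
      ∫ x, F x * Complex.exp (Complex.I * ((∑ j, θ j * x j : ℝ) : ℂ)) = 0) :
    F =ᵐ[volume] 0 := by
  have hc : Integrable fun x => conj (F x) := by
    refine hF.mono (Complex.continuous_conj.comp_aestronglyMeasurable hF.1)
      (Filter.Eventually.of_forall fun x => ?_)
    simp
  -- The transform of the conjugate at `θ` is the conjugate of the transform at `-θ`, so real and
  -- imaginary parts also have vanishing transforms.
  have h' : ∀ θ : Fin n → ℝ,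
      ∫ x, conj (F x) * Complex.exp (Complex.I * ((∑ j, θ j * x j : ℝ) : ℂ)) = 0 := by
    intro θ
    have e : ∀ x, conj (F x) * Complex.exp (Complex.I * ((∑ j, θ j * x j : ℝ) : ℂ)) =
        conj (F x * Complex.exp (Complex.I * ((∑ j, (-θ) j * x j : ℝ) : ℂ))) := by
      intro x
      rw [map_mul, ← Complex.exp_conj, map_mul, Complex.conj_I, Complex.conj_ofReal]
      congr 2
      simp [Finset.sum_neg_distrib]
    simp_rw [e]
    rw [integral_conj, h (-θ), map_zero]
  have hre : (fun x => (F x).re) =ᵐ[volume] 0 := by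
    refine ae_eq_zero_of_real_fourier hF.re fun θ => ?_
    have e : ∀ x, ((F x).re : ℂ) * Complex.exp (Complex.I * ((∑ j, θ j * x j : ℝ) : ℂ)) =
        (1 / 2) * (F x * Complex.exp (Complex.I * ((∑ j, θ j * x j : ℝ) : ℂ)) +
          conj (F x) * Complex.exp (Complex.I * ((∑ j, θ j * x j : ℝ) : ℂ))) := by
      intro x
      rw [Complex.re_eq_add_conj]; ring
    simp_rw [e]
    rw [integral_const_mul, integral_add (Integrable.mul_exp_I hF θ) (Integrable.mul_exp_I hc θ),
      h, h']
    simp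
  have him : (fun x => (F x).im) =ᵐ[volume] 0 := by
    refine ae_eq_zero_of_real_fourier hF.im fun θ => ?_
    have e : ∀ x, ((F x).im : ℂ) * Complex.exp (Complex.I * ((∑ j, θ j * x j : ℝ) : ℂ)) =
        (1 / (2 * Complex.I)) * (F x * Complex.exp (Complex.I * ((∑ j, θ j * x j : ℝ) : ℂ)) -
          conj (F x) * Complex.exp (Complex.I * ((∑ j, θ j * x j : ℝ) : ℂ))) := by
      intro x
      rw [Complex.im_eq_sub_conj]; ring
    simp_rw [e]
    rw [integral_const_mul, integral_sub (Integrable.mul_exp_I hF θ) (Integrable.mul_exp_I hc θ),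
      h, h']
    simp
  filter_upwards [hre, him] with x h1 h2
  exact Complex.ext h1 h2

end FourierInjective

/-! ### Operators with square integrable kernels -/

section Kernel

variable {n : ℕ}

theorem inner_toLp {f g : (Fin n → ℝ) → ℂ} (hf : MemLp f 2) (hg : MemLp g 2) :
    inner ℂ (hf.toLp f) (hg.toLp g) = ∫ x, conj (f x) * g x := by
  rw [L2.inner_def]
  refine integral_congr_ae ?_
  filter_upwards [hf.coeFn_toLp, hg.coeFn_toLp] with x h1 h2
  rw [h1, h2, RCLike.inner_apply, mul_comm]

theorem inner_toLp_right (ψ : ModeSpace n) {g : (Fin n → ℝ) → ℂ} (hg : MemLp g 2) :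
    inner ℂ ψ (hg.toLp g) = ∫ x, conj (ψ x) * g x := by
  conv_lhs => rw [← Lp.toLp_coeFn ψ (Lp.memLp ψ)]
  exact inner_toLp _ hg

theorem inner_toLp_left {f : (Fin n → ℝ) → ℂ} (hf : MemLp f 2) (ψ : ModeSpace n) :
    inner ℂ (hf.toLp f) ψ = ∫ x, conj (f x) * ψ x := by
  conv_lhs => rw [← Lp.toLp_coeFn ψ (Lp.memLp ψ)]
  exact inner_toLp hf _

theorem memLp_conj {f : (Fin n → ℝ) → ℂ} (hf : MemLp f 2) : MemLp (fun x => conj (f x)) 2 :=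
  hf.star

/-- A bounded operator that is given by a square integrable kernel on a total family of vectors is
given by that kernel on all vectors. -/
theorem hasKernel_of_total {T : ModeSpace n →L[ℂ] ModeSpace n} {K : PositionKernel n} {κ : Type*}
    (g : κ → ModeSpace n) (hg : ∀ f, (∀ k, inner ℂ f (g k) = 0) → f = 0)
    (hK : ∀ x, MemLp (K x) 2) (hT : ∀ k, ∀ᵐ x, T (g k) x = ∫ y, K x y * g k y) :
    HasKernel T K := by
  -- For every fixed `x` the kernel integral is a continuous functional of the vector, because `K x`
  -- is square integrable.
  set Φ : (Fin n → ℝ) → ModeSpace n →L[ℂ] ℂ := fun x =>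
    innerSL ℂ ((memLp_conj (hK x)).toLp _) with hΦ
  have hΦ' : ∀ x ψ, Φ x ψ = ∫ y, K x y * ψ y := by
    intro x ψ
    rw [hΦ]
    simp only [innerSL_apply_apply]
    rw [inner_toLp_left]
    simp
  let W : Submodule ℂ (ModeSpace n) :=
    { carrier := {ψ | ∀ᵐ x, T ψ x = Φ x ψ}
      add_mem' := by
        intro ψ φ h1 h2
        have h3 := Lp.coeFn_add (T ψ) (T φ)
        simp only [Set.mem_ofPred_eq, map_add] at *
        filter_upwards [h1, h2, h3] with x e1 e2 e3
        rw [e3, Pi.add_apply, e1, e2]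
      zero_mem' := by
        simp only [Set.mem_ofPred_eq, map_zero]
        exact Lp.coeFn_zero ℂ 2 volume
      smul_mem' := by
        intro c ψ h1
        have h3 := Lp.coeFn_smul c (T ψ)
        simp only [Set.mem_ofPred_eq, map_smul] at *
        filter_upwards [h1, h3] with x e1 e3
        rw [e3, Pi.smul_apply, e1] }
  -- `L²` convergence of `T ψ_m` yields a subsequence converging almost everywhere, while `Φ x ψ_m`
  -- converges at every `x`; the countably many exceptional sets together are still null.
  have hclosed : IsClosed (W : Set (ModeSpace n)) := by
    rw [← isSeqClosed_iff_isClosed]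
    intro ψ φ hψ hlim
    have h1 : Filter.Tendsto (fun m => T (ψ m)) Filter.atTop (nhds (T φ)) :=
      (T.continuous.tendsto φ).comp hlim
    obtain ⟨ns, hns, hae⟩ := (tendstoInMeasure_of_tendsto_Lp h1).exists_seq_tendsto_ae
    have h2 : ∀ᵐ x, ∀ m, T (ψ m) x = Φ x (ψ m) := ae_all_iff.2 hψ
    change ∀ᵐ x, T φ x = Φ x φ
    filter_upwards [hae, h2] with x hx1 hx2
    have h3 : Filter.Tendsto (fun i => Φ x (ψ (ns i))) Filter.atTop (nhds (Φ x φ)) :=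
      ((Φ x).continuous.tendsto φ).comp (hlim.comp hns.tendsto_atTop)
    simp_rw [hx2] at hx1
    exact tendsto_nhds_unique hx1 h3
  have hspan : Submodule.span ℂ (Set.range g) ≤ W := by
    rw [Submodule.span_le]
    rintro _ ⟨k, rfl⟩
    change ∀ᵐ x, T (g k) x = Φ x (g k)
    simpa only [hΦ'] using hT k
  have hdense : (Submodule.span ℂ (Set.range g)).topologicalClosure = ⊤ := by
    rw [Submodule.topologicalClosure_eq_top_iff, Submodule.eq_bot_iff]
    intro f hf
    refine hg f fun k => ?_
    rw [Submodule.mem_orthogonal'] at hf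
    exact hf _ (Submodule.subset_span ⟨k, rfl⟩)
  have htop : W = ⊤ := by
    rw [eq_top_iff, ← hdense]
    exact Submodule.topologicalClosure_minimal _ hspan hclosed
  intro ψ
  have hψ : ψ ∈ W := by rw [htop]; trivial
  have hψ' : ∀ᵐ x, T ψ x = Φ x ψ := hψ
  filter_upwards [hψ'] with x hx
  exact ⟨(hK x).integrable_mul (Lp.memLp ψ), by rw [hx, hΦ']⟩

end Kernel

end CVSharing

end

noncomputable section

namespace CVSharing

open Matrix

/-! ### The spectral decomposition of a Gaussian state -/

section Modes

variable {n : ℕ} {L : Matrix (Fin n) (Fin n) ℝ}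

theorem isUnit_det_inv (hL : IsUnit L.det) : IsUnit L⁻¹.det := by
  rw [det_nonsing_inv]; exact hL.ringInverse

theorem integral_prod_coord {𝕜 : Type*} [RCLike 𝕜] (hL : IsUnit L.det) (f : Fin n → ℝ → 𝕜) :
    ∫ x, ∏ j, f j ((L⁻¹ *ᵥ x) j) = ((|L.det| : ℝ) : 𝕜) * ∏ j, ∫ t, f j t := by
  have h := integral_mulVec L⁻¹ (isUnit_det_inv hL) fun y => ∏ j, f j (y j)
  rw [h, integral_fintype_prod_volume_eq_prod, det_nonsing_inv, Ring.inverse_eq_inv', abs_inv,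
    inv_inv, RCLike.real_smul_eq_coe_mul]

theorem integrable_prod_coord {𝕜 : Type*} [RCLike 𝕜] (hL : IsUnit L.det) {f : Fin n → ℝ → 𝕜}
    (hf : ∀ j, Integrable (f j)) : Integrable fun x => ∏ j, f j ((L⁻¹ *ᵥ x) j) :=
  (integrable_mulVec_iff L⁻¹ (isUnit_det_inv hL) fun y => ∏ j, f j (y j)).2
    (Integrable.fintype_prod hf)

theorem memLp_prod_coord (hL : IsUnit L.det) {f : Fin n → ℝ → ℂ} (hc : ∀ j, Continuous (f j))
    (hf : ∀ j, Integrable fun t => ‖f j t‖ ^ 2) (c : ℂ) :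
    MemLp (fun x => c * ∏ j, f j ((L⁻¹ *ᵥ x) j)) 2 := by
  have hcont : Continuous fun x => c * ∏ j, f j ((L⁻¹ *ᵥ x) j) := by
    refine continuous_const.mul (continuous_finsetProd _ fun j _ => (hc j).comp ?_)
    exact (continuous_apply j).comp (Continuous.matrix_mulVec continuous_const continuous_id)
  rw [memLp_two_iff_integrable_sq_norm hcont.aestronglyMeasurable]
  simp_rw [norm_mul, mul_pow, norm_prod, ← Finset.prod_pow]
  exact (integrable_prod_coord hL hf).const_mul _

/-- The product of normalized Hermite functions in the coordinates `L⁻¹ x`. -/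
def hermiteMode (L : Matrix (Fin n) (Fin n) ℝ) (α : Fin n → ℕ) (x : Fin n → ℝ) : ℂ :=
  ((√|L.det|)⁻¹ : ℝ) * ∏ j, (hermiteFun (α j) ((L⁻¹ *ᵥ x) j) : ℂ)

/-- Gaussian wave packet with momentum parameters `ξ` in the coordinates `L⁻¹ x`. -/
def wavePacket (L : Matrix (Fin n) (Fin n) ℝ) (ξ : Fin n → ℝ) (x : Fin n → ℝ) : ℂ :=
  -- The factor `1` gives the expression the shape handled by `memLp_prod_coord`.
  1 * ∏ j, phaseGauss (√2 * ξ j) ((L⁻¹ *ᵥ x) j)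

theorem memLp_hermiteMode (hL : IsUnit L.det) (α : Fin n → ℕ) : MemLp (hermiteMode L α) 2 := by
  refine memLp_prod_coord hL (fun j => Complex.continuous_ofReal.comp (continuous_hermiteFun _))
    (fun j => ?_) _
  refine ((integral_hermiteFun_mul (α j) (α j)).1).congr (Filter.Eventually.of_forall fun t => ?_)
  simp [sq]

theorem norm_phaseGauss_sq (θ t : ℝ) : ‖phaseGauss θ t‖ ^ 2 = Real.exp (-t ^ 2) := by
  rw [norm_phaseGauss, ← Real.exp_nat_mul]; congr 1; push_cast; ring

theorem memLp_wavePacket (hL : IsUnit L.det) (ξ : Fin n → ℝ) : MemLp (wavePacket L ξ) 2 := by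
  refine memLp_prod_coord hL (fun j => continuous_phaseGauss _) (fun j => ?_) _
  simpa [norm_phaseGauss_sq] using integrable_pow_mul_exp_neg_sq 0

theorem orthonormal_hermiteMode (hL : IsUnit L.det) :
    Orthonormal ℂ fun α => (memLp_hermiteMode hL α).toLp := by
  rw [orthonormal_iff_ite]
  intro α β
  rw [inner_toLp]
  have hd : 0 < |L.det| := abs_pos.2 hL.ne_zero
  have e : ∀ x, conj (hermiteMode L α x) * hermiteMode L β x =
      ((|L.det|⁻¹ * ∏ j, (hermiteFun (α j) ((L⁻¹ *ᵥ x) j) * hermiteFun (β j) ((L⁻¹ *ᵥ x) j)) : ℝ) : ℂ) := by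
    intro x
    have h1 : (√|L.det|)⁻¹ * (√|L.det|)⁻¹ = |L.det|⁻¹ := by
      rw [← mul_inv, Real.mul_self_sqrt hd.le]
    rw [← h1]
    simp only [hermiteMode, map_mul, map_prod, Complex.conj_ofReal, Finset.prod_mul_distrib]
    push_cast
    ring
  simp_rw [e]
  rw [integral_complex_ofReal, integral_const_mul,
    integral_prod_coord hL fun j t => hermiteFun (α j) t * hermiteFun (β j) t]
  simp_rw [(integral_hermiteFun_mul _ _).2]
  rw [RCLike.ofReal_real_eq_id, id, ← mul_assoc, inv_mul_cancel₀ hd.ne', one_mul]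
  split_ifs with h
  · subst h; simp
  · obtain ⟨j, hj⟩ := Function.ne_iff.1 h
    rw [Finset.prod_eq_zero (Finset.mem_univ j) (by simp [hj])]
    simp

theorem inner_hermiteMode_wavePacket (hL : IsUnit L.det) (α : Fin n → ℕ) (ξ : Fin n → ℝ) :
    inner ℂ (memLp_hermiteMode hL α).toLp (memLp_wavePacket hL ξ).toLp =
      (√|L.det| : ℝ) * ∏ j, ((√√Real.pi * (√(α j).factorial)⁻¹ : ℝ) *
        (Complex.I * ξ j) ^ α j * Complex.exp (-ξ j ^ 2 / 2)) := by
  rw [inner_toLp]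
  have hd : 0 < |L.det| := abs_pos.2 hL.ne_zero
  have e : ∀ x, conj (hermiteMode L α x) * wavePacket L ξ x =
      ((√|L.det|)⁻¹ : ℝ) * ∏ j, ((hermiteFun (α j) ((L⁻¹ *ᵥ x) j) : ℂ) *
        phaseGauss (√2 * ξ j) ((L⁻¹ *ᵥ x) j)) := by
    intro x
    simp only [hermiteMode, wavePacket, map_mul, map_prod, Complex.conj_ofReal,
      Finset.prod_mul_distrib]
    ring
  simp_rw [e]
  rw [integral_const_mul, integral_prod_coord hL fun j t =>
    (hermiteFun (α j) t : ℂ) * phaseGauss (√2 * ξ j) t]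
  have h1 : ∀ j, ∫ t, (hermiteFun (α j) t : ℂ) * phaseGauss (√2 * ξ j) t = _ := fun j =>
    integral_hermiteFun_mul_phaseGauss (α j) (ξ j)
  simp_rw [h1]
  rw [← mul_assoc]
  congr 1
  change (((√|L.det|)⁻¹ : ℝ) : ℂ) * ((|L.det| : ℝ) : ℂ) = _
  rw [← Complex.ofReal_mul]
  congr 1
  have h2 := (Real.sqrt_pos.2 hd).ne'
  have h3 := Real.mul_self_sqrt hd.le
  field_simp
  rw [sq, h3]

theorem norm_wavePacket_sq (hL : IsUnit L.det) (ξ : Fin n → ℝ) :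
    ‖(memLp_wavePacket hL ξ).toLp‖ ^ 2 = |L.det| * √Real.pi ^ n := by
  have h := inner_self_eq_norm_sq_to_K (𝕜 := ℂ) (memLp_wavePacket hL ξ).toLp
  rw [inner_toLp] at h
  have e : ∀ x, conj (wavePacket L ξ x) * wavePacket L ξ x =
      ((∏ j, Real.exp (-((L⁻¹ *ᵥ x) j) ^ 2) : ℝ) : ℂ) := by
    intro x
    rw [mul_comm, Complex.mul_conj, Complex.normSq_eq_norm_sq, wavePacket, one_mul, norm_prod,
      ← Finset.prod_pow]
    simp_rw [norm_phaseGauss_sq]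
  simp_rw [e] at h
  rw [integral_complex_ofReal, integral_prod_coord hL fun _ t => Real.exp (-t ^ 2)] at h
  have e2 := integral_gaussian 1
  simp only [neg_mul, one_mul, div_one] at e2
  rw [RCLike.ofReal_real_eq_id, id] at h
  simp only [e2, Finset.prod_const, Finset.card_univ, Fintype.card_fin] at h
  refine Complex.ofReal_injective ?_
  rw [h]
  push_cast
  rfl

theorem hasSum_exp_real (x : ℝ) : HasSum (fun m : ℕ => x ^ m / m.factorial) (Real.exp x) := by
  rw [Real.exp_eq_exp_ℝ]
  exact NormedSpace.expSeries_div_hasSum_exp x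

/-- The squared overlaps are `|det L|` times a product of Poisson weights of mean `(ξ j)²`, each
scaled by `√π`, so the exponential series sums them to the squared norm of the packet. -/
theorem parseval_wavePacket (hL : IsUnit L.det) (ξ : Fin n → ℝ) :
    HasSum (fun α => ‖inner ℂ (memLp_hermiteMode hL α).toLp (memLp_wavePacket hL ξ).toLp‖ ^ 2)
      (‖(memLp_wavePacket hL ξ).toLp‖ ^ 2) := by
  have h1 : ∀ j, HasSum (fun m : ℕ => √Real.pi * ((ξ j ^ 2) ^ m / m.factorial) *
      Real.exp (-ξ j ^ 2)) (√Real.pi) := by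
    intro j
    have := ((hasSum_exp_real (ξ j ^ 2)).mul_left √Real.pi).mul_right (Real.exp (-ξ j ^ 2))
    rwa [mul_assoc, ← Real.exp_add, add_neg_cancel, Real.exp_zero, mul_one] at this
  have h2 := (hasSum_pi_prod h1).mul_left |L.det|
  have e : (fun α => ‖inner ℂ (memLp_hermiteMode hL α).toLp (memLp_wavePacket hL ξ).toLp‖ ^ 2) =
      fun α : Fin n → ℕ => |L.det| * ∏ j, √Real.pi * ((ξ j ^ 2) ^ α j / (α j).factorial) *
        Real.exp (-ξ j ^ 2) := by
    funext α
    rw [inner_hermiteMode_wavePacket hL, norm_mul, mul_pow, norm_prod, ← Finset.prod_pow,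
      Complex.norm_real, Real.norm_of_nonneg (Real.sqrt_nonneg _), Real.sq_sqrt (abs_nonneg _)]
    congr 1
    refine Finset.prod_congr rfl fun j _ => ?_
    have hf : (0 : ℝ) < (α j).factorial := by exact_mod_cast (α j).factorial_pos
    have h3 : ‖Complex.exp (-(ξ j : ℂ) ^ 2 / 2)‖ ^ 2 = Real.exp (-ξ j ^ 2) := by
      have : -(ξ j : ℂ) ^ 2 / 2 = ((-ξ j ^ 2 / 2 : ℝ) : ℂ) := by push_cast; ring
      rw [this, ← Complex.ofReal_exp, Complex.norm_real, Real.norm_of_nonneg (Real.exp_pos _).le,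
        ← Real.exp_nat_mul]
      congr 1; push_cast; ring
    have h4 : ‖(Complex.I * ξ j) ^ α j‖ ^ 2 = (ξ j ^ 2) ^ α j := by
      rw [norm_pow, norm_mul, Complex.norm_I, one_mul, Complex.norm_real, ← pow_mul,
        mul_comm (α j) 2, pow_mul, Real.norm_eq_abs, sq_abs]
    have h5 : ‖((√√Real.pi * (√(α j).factorial)⁻¹ : ℝ) : ℂ)‖ ^ 2 =
        √Real.pi * ((α j).factorial : ℝ)⁻¹ := by
      rw [Complex.norm_real, Real.norm_eq_abs, sq_abs, mul_pow, Real.sq_sqrt (Real.sqrt_nonneg _),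
        inv_pow, Real.sq_sqrt hf.le]
    rw [norm_mul, norm_mul, mul_pow, mul_pow, h3, h4, h5]
    ring
  rw [norm_wavePacket_sq hL, e]
  simpa using h2

/-- The wave packets form a total family. -/
theorem eq_zero_of_inner_wavePacket (hL : IsUnit L.det) (f : ModeSpace n)
    (hf : ∀ ξ, inner ℂ f (memLp_wavePacket hL ξ).toLp = 0) : f = 0 := by
  have hLT : IsUnit Lᵀ.det := by rwa [det_transpose]
  have hsplit : ∀ ξ x, wavePacket L ξ x = wavePacket L 0 x *
      Complex.exp (Complex.I * ((∑ j, √2 * ξ j * (L⁻¹ *ᵥ x) j : ℝ) : ℂ)) := by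
    intro ξ x
    simp only [wavePacket, one_mul, phaseGauss, ← Complex.exp_sum]
    rw [← Complex.exp_add]
    congr 1
    push_cast
    rw [Finset.mul_sum, ← Finset.sum_add_distrib]
    refine Finset.sum_congr rfl fun j _ => ?_
    simp only [Pi.zero_apply, Complex.ofReal_zero]
    ring
  have hF : Integrable fun x => conj (f x) * wavePacket L 0 x :=
    (memLp_conj (Lp.memLp f)).integrable_mul (memLp_wavePacket hL 0)
  have h0 := ae_eq_zero_of_fourier hF fun θ => by
    -- With the parameter `Lᵀ θ / √2` the phase in the coordinates `L⁻¹ x` is exactly `θ ⬝ x`.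
    have h := hf ((√2)⁻¹ • (Lᵀ *ᵥ θ))
    rw [inner_toLp_right] at h
    rw [← h]
    congr 1
    ext x
    rw [hsplit ((√2)⁻¹ • _) x, ← mul_assoc (conj _)]
    congr 4
    have h2 : √2 ≠ 0 := by positivity
    have h3 : ∀ j, √2 * ((√2)⁻¹ • (Lᵀ *ᵥ θ)) j = (Lᵀ *ᵥ θ) j := by
      intro j; rw [Pi.smul_apply, smul_eq_mul, ← mul_assoc, mul_inv_cancel₀ h2, one_mul]
    simp_rw [h3]
    change θ ⬝ᵥ x = (Lᵀ *ᵥ θ) ⬝ᵥ (L⁻¹ *ᵥ x)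
    rw [mulVec_transpose, ← dotProduct_mulVec, mulVec_mulVec, mul_nonsing_inv _ hL, one_mulVec]
  apply Lp.ext
  filter_upwards [h0, Lp.coeFn_zero ℂ 2 (volume : Measure (Fin n → ℝ))] with x hx hz
  rw [hz]
  -- The packet with parameter zero vanishes nowhere, so it can be divided out.
  have hne : wavePacket L 0 x ≠ 0 := by
    rw [wavePacket, one_mul]
    exact Finset.prod_ne_zero_iff.2 fun j _ => Complex.exp_ne_zero _
  have := (mul_eq_zero.1 hx).resolve_right hne
  simpa using this

/-- The Hilbert basis of Hermite functions. -/
def hermiteBasis (hL : IsUnit L.det) : HilbertBasis (Fin n → ℕ) ℂ (ModeSpace n) :=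
  HilbertBasis.mkOfOrthogonalEqBot (orthonormal_hermiteMode hL) (by
    rw [Submodule.eq_bot_iff]
    intro f hf
    rw [Submodule.mem_orthogonal'] at hf
    -- By Parseval, a vector orthogonal to all Hermite modes is orthogonal to all wave packets,
    -- which are total.
    refine eq_zero_of_inner_wavePacket hL f fun ξ => ?_
    exact inner_eq_zero_of_parseval (orthonormal_hermiteMode hL) (parseval_wavePacket hL ξ)
      fun α => hf _ (Submodule.subset_span ⟨α, rfl⟩))

theorem hermiteBasis_apply (hL : IsUnit L.det) (α : Fin n → ℕ) :
    hermiteBasis hL α = (memLp_hermiteMode hL α).toLp := by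
  rw [hermiteBasis, HilbertBasis.coe_mkOfOrthogonalEqBot]

end Modes

end CVSharing

end

noncomputable section

namespace CVSharing

open Matrix

/-! ### Spectrum and entropy of thermal states -/

section ThermalSpectrum

/-- The eigenvalues of a thermal state of one mode. -/
def thermalWeight (ν : ℝ) (m : ℕ) : ℝ := 2 / (ν + 1) * thermalRatio ν ^ m

variable {ν : ℝ}

theorem thermalRatio_nonneg (hν : 1 ≤ ν) : 0 ≤ thermalRatio ν :=
  div_nonneg (by linarith) (by linarith)

theorem thermalRatio_lt_one (hν : 1 ≤ ν) : thermalRatio ν < 1 := by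
  rw [thermalRatio, div_lt_one (by linarith)]; linarith

theorem one_sub_thermalRatio (hν : 1 ≤ ν) : 1 - thermalRatio ν = 2 / (ν + 1) := by
  have : ν + 1 ≠ 0 := by linarith
  rw [thermalRatio]; field_simp; ring

theorem thermalWeight_nonneg (hν : 1 ≤ ν) (m : ℕ) : 0 ≤ thermalWeight ν m :=
  mul_nonneg (div_nonneg (by norm_num) (by linarith)) (pow_nonneg (thermalRatio_nonneg hν) m)

theorem hasSum_thermalWeight (hν : 1 ≤ ν) : HasSum (thermalWeight ν) 1 := by
  have h := (hasSum_geometric_of_lt_one (thermalRatio_nonneg hν) (thermalRatio_lt_one hν)).mul_left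
    (2 / (ν + 1))
  rwa [one_sub_thermalRatio hν, mul_inv_cancel₀ (by positivity)] at h

/-- The logarithm of a geometric weight is affine in `m`, so only the total mass `1` and the mean
`(ν - 1) / 2` of the distribution are needed. The pure case `ν = 1` is separate since there the
ratio is `0` and its logarithm is not additive. -/
theorem hasSum_entropy_thermalWeight (hν : 1 ≤ ν) :
    HasSum (fun m => -(thermalWeight ν m * Real.logb 2 (thermalWeight ν m))) (modeEntropy ν) := by
  have hν1 : 0 < ν + 1 := by linarith
  rcases hν.eq_or_lt with rfl | hlt
  · have e : (fun m => -(thermalWeight 1 m * Real.logb 2 (thermalWeight 1 m))) = fun _ => 0 := by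
      ext m
      rcases m.eq_zero_or_pos with rfl | hm
      · norm_num [thermalWeight, thermalRatio]
      · simp [thermalWeight, thermalRatio, hm.ne']
    rw [e]
    have : modeEntropy 1 = 0 := by norm_num [modeEntropy]
    rw [this]
    exact hasSum_zero
  · set r := thermalRatio ν with hr
    have hr0 : 0 < r := div_pos (by linarith) hν1
    have hr1 : r < 1 := thermalRatio_lt_one hν
    have hs : 1 - r = 2 / (ν + 1) := one_sub_thermalRatio hν
    have hg := hasSum_thermalWeight hν
    have hm := (hasSum_coe_mul_geometric_of_norm_lt_one
      (by rwa [Real.norm_of_nonneg hr0.le] : ‖r‖ < 1)).mul_left (2 / (ν + 1))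
    have h := (hg.mul_left (-Real.logb 2 (2 / (ν + 1)))).add (hm.mul_left (-Real.logb 2 r))
    have hval : -Real.logb 2 (2 / (ν + 1)) * 1 +
        -Real.logb 2 r * (2 / (ν + 1) * (r / (1 - r) ^ 2)) = modeEntropy ν := by
      have h1 : 2 / (ν + 1) * (r / (1 - r) ^ 2) = (ν - 1) / 2 := by
        rw [hs, hr, thermalRatio]; field_simp
      have h2 : Real.logb 2 (2 / (ν + 1)) = -Real.logb 2 ((ν + 1) / 2) := by
        rw [← Real.logb_inv, inv_div]
      have h3 : Real.logb 2 r = Real.logb 2 ((ν - 1) / 2) - Real.logb 2 ((ν + 1) / 2) := by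
        rw [← Real.logb_div (by linarith) (by linarith), hr, thermalRatio]
        congr 1
        field_simp
      rw [h1, h2, h3, modeEntropy]; ring
    rw [hval] at h
    have e : (fun m => -(thermalWeight ν m * Real.logb 2 (thermalWeight ν m))) = fun m =>
        -Real.logb 2 (2 / (ν + 1)) * thermalWeight ν m +
          -Real.logb 2 r * (2 / (ν + 1) * ((m : ℝ) * r ^ m)) := by
      ext m
      rw [thermalWeight, ← hr, Real.logb_mul (by positivity) (by positivity), Real.logb_pow]
      ring
    rw [e]
    exact h

/-- Additivity of entropy at the level of single terms, in a form where each summand is again a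
product over the modes. If some factor vanishes, both sides are zero. -/
theorem neg_prod_mul_logb_prod {κ : Type*} [Fintype κ] [DecidableEq κ] (w : κ → ℝ) :
    -((∏ l, w l) * Real.logb 2 (∏ l, w l)) =
      ∑ j, ∏ l, if l = j then -(w l * Real.logb 2 (w l)) else w l := by
  by_cases h : ∀ l, w l ≠ 0
  · rw [Real.logb, Real.log_prod fun l _ => h l, Finset.sum_div, Finset.mul_sum,
      ← Finset.sum_neg_distrib]
    refine Finset.sum_congr rfl fun j _ => ?_
    rw [← Finset.mul_prod_erase _ w (Finset.mem_univ j),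
      ← Finset.mul_prod_erase _ (fun l => if l = j then _ else w l) (Finset.mem_univ j), if_pos rfl]
    have : ∏ l ∈ Finset.univ.erase j, (if l = j then -(w l * Real.logb 2 (w l)) else w l) =
        ∏ l ∈ Finset.univ.erase j, w l :=
      Finset.prod_congr rfl fun l hl => if_neg (Finset.ne_of_mem_erase hl)
    rw [this, Real.logb]
    ring
  · push Not at h
    obtain ⟨l, hl⟩ := h
    rw [Finset.prod_eq_zero (Finset.mem_univ l) hl, zero_mul, neg_zero]
    refine (Finset.sum_eq_zero fun j _ => Finset.prod_eq_zero (Finset.mem_univ l) ?_).symm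
    split_ifs <;> simp [hl]

variable {n : ℕ} {ν : Fin n → ℝ}

theorem hasSum_prod_thermalWeight (hν : ∀ j, 1 ≤ ν j) :
    HasSum (fun α : Fin n → ℕ => ∏ j, thermalWeight (ν j) (α j)) 1 := by
  simpa using hasSum_pi_prod fun j => hasSum_thermalWeight (hν j)

theorem hasSum_entropy_prod_thermalWeight (hν : ∀ j, 1 ≤ ν j) :
    HasSum (fun α : Fin n → ℕ => -((∏ j, thermalWeight (ν j) (α j)) *
      Real.logb 2 (∏ j, thermalWeight (ν j) (α j)))) (∑ j, modeEntropy (ν j)) := by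
  simp_rw [neg_prod_mul_logb_prod]
  refine hasSum_sum fun j _ => ?_
  -- In the `j`-th summand mode `j` carries its entropy series and every other mode a probability
  -- series of sum `1`.
  have h : ∀ l, HasSum (fun m => if l = j then
      -(thermalWeight (ν l) m * Real.logb 2 (thermalWeight (ν l) m)) else thermalWeight (ν l) m)
      (if l = j then modeEntropy (ν l) else 1) := by
    intro l
    split_ifs
    · exact hasSum_entropy_thermalWeight (hν l)
    · exact hasSum_thermalWeight (hν l)
  simpa using hasSum_pi_prod h

end ThermalSpectrum

/-! ### Gaussian kernels as density operators -/

section GaussOperator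

variable {n : ℕ} {M N L : Matrix (Fin n) (Fin n) ℝ} {ν : Fin n → ℝ}

/-- Congruence by `L` turns `M⁻¹` into `diag ν⁻¹` and `N` into `diag ν`, so the exponent separates
in the coordinates `L⁻¹ x`; the normalization splits because `det M = (det L)² ∏ ν j`. -/
theorem gaussKernel_eq_prod (hL : IsUnit L.det) (hν : ∀ j, 0 < ν j)
    (h1 : M = L * diagonal ν * Lᵀ) (h2 : Lᵀ * N * L = diagonal ν) (x x' : Fin n → ℝ) :
    gaussKernel M N x x' =
      ((|L.det|⁻¹ * ∏ j, thermalKernel (ν j) ((L⁻¹ *ᵥ x) j) ((L⁻¹ *ᵥ x') j) : ℝ) : ℂ) := by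
  have hLT : IsUnit Lᵀ.det := by rwa [det_transpose]
  have hdet : M.det = L.det ^ 2 * ∏ j, ν j := by
    rw [h1, det_mul, det_mul, det_transpose, det_diagonal]; ring
  have hprod : 0 < ∏ j, ν j := Finset.prod_pos fun j _ => hν j
  have hMu : IsUnit M.det := by
    rw [hdet]; exact (mul_ne_zero (pow_ne_zero 2 hL.ne_zero) hprod.ne').isUnit
  have hM : Lᵀ * M⁻¹ * L = diagonal fun j => (ν j)⁻¹ := by
    have e1 : Lᵀ * M⁻¹ * L * diagonal ν = 1 := by
      have : L * diagonal ν = M * Lᵀ⁻¹ := by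
        rw [h1, Matrix.mul_assoc, mul_nonsing_inv _ hLT, Matrix.mul_one]
      calc Lᵀ * M⁻¹ * L * diagonal ν = Lᵀ * M⁻¹ * (L * diagonal ν) := by rw [Matrix.mul_assoc]
        _ = Lᵀ * (M⁻¹ * M) * Lᵀ⁻¹ := by rw [this]; simp only [Matrix.mul_assoc]
        _ = 1 := by rw [nonsing_inv_mul _ hMu, Matrix.mul_one, mul_nonsing_inv _ hLT]
    have e2 : diagonal ν * (diagonal fun j => (ν j)⁻¹) = 1 := by
      rw [diagonal_mul_diagonal, ← diagonal_one]
      congr 1; ext j; exact mul_inv_cancel₀ (hν j).ne'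
    calc Lᵀ * M⁻¹ * L = Lᵀ * M⁻¹ * L * (diagonal ν * (diagonal fun j => (ν j)⁻¹)) := by
          rw [e2, Matrix.mul_one]
      _ = _ := by rw [← Matrix.mul_assoc, e1, Matrix.one_mul]
  have hquad : ∀ (A : Matrix (Fin n) (Fin n) ℝ) (d : Fin n → ℝ) (z : Fin n → ℝ),
      Lᵀ * A * L = diagonal d → z ⬝ᵥ A *ᵥ z = ∑ j, d j * (L⁻¹ *ᵥ z) j ^ 2 := by
    intro A d z hA
    have hz : z = L *ᵥ (L⁻¹ *ᵥ z) := by rw [mulVec_mulVec, mul_nonsing_inv _ hL, one_mulVec]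
    conv_lhs => rw [hz]
    generalize L⁻¹ *ᵥ z = y
    have : (L *ᵥ y) ⬝ᵥ A *ᵥ (L *ᵥ y) = y ⬝ᵥ (Lᵀ * A * L) *ᵥ y := by
      simp only [← mulVec_mulVec]
      rw [dotProduct_mulVec y, vecMul_transpose]
    rw [this, hA]
    simp only [dotProduct, mulVec_diagonal]
    exact Finset.sum_congr rfl fun j _ => by ring
  rw [gaussKernel, hquad _ _ _ hM, hquad _ _ _ h2]
  congr 1
  simp only [thermalKernel, Finset.prod_mul_distrib, ← Real.exp_sum]
  rw [← mul_assoc]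
  congr 1
  · have e : Real.pi ^ n * M.det = |L.det| ^ 2 * ∏ j, (Real.pi * ν j) := by
      rw [hdet, Finset.prod_mul_distrib, sq_abs]; simp; ring
    rw [e, Real.sqrt_mul (sq_nonneg _), Real.sqrt_sq (abs_nonneg _), mul_inv,
      Real.sqrt_prod _ fun j _ => (mul_pos Real.pi_pos (hν j)).le, Finset.prod_inv_distrib]
  · congr 1
    rw [← Finset.sum_neg_distrib, Finset.sum_div, Finset.sum_div, ← Finset.sum_sub_distrib]
    refine Finset.sum_congr rfl fun j _ => ?_
    rw [mulVec_add, mulVec_sub, Pi.add_apply, Pi.sub_apply]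
    have := (hν j).ne'
    field_simp

theorem integrable_thermalKernel_sq {ν : ℝ} (hν : 0 < ν) (x : ℝ) :
    Integrable fun y => ‖(thermalKernel ν x y : ℂ)‖ ^ 2 := by
  have hg := ((integrable_exp_neg_mul_sq (b := ν / 2) (by positivity)).comp_sub_left x).const_mul
    ((√(Real.pi * ν))⁻¹ ^ 2)
  refine hg.mono' (Continuous.aestronglyMeasurable (by unfold thermalKernel; fun_prop))
    (Filter.Eventually.of_forall fun y => ?_)
  rw [Complex.norm_real, norm_pow, norm_norm, Real.norm_eq_abs, sq_abs, thermalKernel, mul_pow,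
    ← Real.exp_nat_mul]
  refine mul_le_mul_of_nonneg_left (Real.exp_le_exp.2 ?_) (by positivity)
  have : 0 ≤ (x + y) ^ 2 / (4 * ν) := by positivity
  push_cast
  rw [neg_div]
  nlinarith

theorem memLp_gaussKernel (hL : IsUnit L.det) (hν : ∀ j, 0 < ν j)
    (h1 : M = L * diagonal ν * Lᵀ) (h2 : Lᵀ * N * L = diagonal ν) (x : Fin n → ℝ) :
    MemLp (gaussKernel M N x) 2 := by
  have e : gaussKernel M N x = fun x' => ((|L.det|⁻¹ : ℝ) : ℂ) *
      ∏ j, (thermalKernel (ν j) ((L⁻¹ *ᵥ x) j) ((L⁻¹ *ᵥ x') j) : ℂ) := by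
    ext x'
    rw [gaussKernel_eq_prod hL hν h1 h2]; push_cast; rfl
  rw [e]
  exact memLp_prod_coord hL (f := fun j t => (thermalKernel (ν j) ((L⁻¹ *ᵥ x) j) t : ℂ))
    (fun j => by unfold thermalKernel; fun_prop)
    (fun j => integrable_thermalKernel_sq (hν j) _) _

/-- The factor by which a Gaussian state damps a wave packet. -/
def dampingFactor (ν ξ : Fin n → ℝ) : ℂ :=
  ∏ j, ((2 / (ν j + 1) : ℝ) * Complex.exp ((thermalRatio (ν j) ^ 2 - 1) * ξ j ^ 2 / 2))

theorem integral_gaussKernel_mul_wavePacket (hL : IsUnit L.det) (hν : ∀ j, 0 < ν j)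
    (h1 : M = L * diagonal ν * Lᵀ) (h2 : Lᵀ * N * L = diagonal ν) (x ξ : Fin n → ℝ) :
    ∫ x', gaussKernel M N x x' * wavePacket L ξ x' =
      dampingFactor ν ξ * wavePacket L (fun j => thermalRatio (ν j) * ξ j) x := by
  have e : ∀ x', gaussKernel M N x x' * wavePacket L ξ x' = ((|L.det|⁻¹ : ℝ) : ℂ) *
      ∏ j, ((thermalKernel (ν j) ((L⁻¹ *ᵥ x) j) ((L⁻¹ *ᵥ x') j) : ℂ) *
        phaseGauss (√2 * ξ j) ((L⁻¹ *ᵥ x') j)) := by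
    intro x'
    rw [gaussKernel_eq_prod hL hν h1 h2, wavePacket, Finset.prod_mul_distrib]
    push_cast; ring
  simp_rw [e]
  rw [integral_const_mul, integral_prod_coord hL fun j t =>
    (thermalKernel (ν j) ((L⁻¹ *ᵥ x) j) t : ℂ) * phaseGauss (√2 * ξ j) t]
  simp_rw [integral_thermalKernel_mul_phaseGauss (hν _)]
  rw [← mul_assoc]
  have hd : |L.det| ≠ 0 := abs_ne_zero.2 hL.ne_zero
  have : ((|L.det|⁻¹ : ℝ) : ℂ) * ((|L.det| : ℝ) : ℂ) = 1 := by
    rw [← Complex.ofReal_mul, inv_mul_cancel₀ hd, Complex.ofReal_one]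
  rw [show (RCLike.ofReal |L.det| : ℂ) = ((|L.det| : ℝ) : ℂ) from rfl, this, one_mul,
    Finset.prod_mul_distrib, dampingFactor, wavePacket, one_mul]

/-- A Gaussian state is a density operator, with the entropy determined by its symplectic
spectrum. -/
theorem exists_operator_gaussKernel (hL : IsUnit L.det) (hν : ∀ j, 1 ≤ ν j)
    (h1 : M = L * diagonal ν * Lᵀ) (h2 : Lᵀ * N * L = diagonal ν) :
    ∃ T : ModeSpace n →L[ℂ] ModeSpace n, HasKernel T (gaussKernel M N) ∧ IsDensityOperator T ∧
      Summable (spectralEntropy T) ∧ vonNeumannEntropy T = ∑ j, modeEntropy (ν j) := by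
  have hν0 : ∀ j, 0 < ν j := fun j => one_pos.trans_le (hν j)
  set w : (Fin n → ℕ) → ℝ := fun α => ∏ j, thermalWeight (ν j) (α j) with hw
  have hw0 : ∀ α, 0 ≤ w α := fun α => Finset.prod_nonneg fun j _ => thermalWeight_nonneg (hν j) _
  have hw1 : HasSum w 1 := hasSum_prod_thermalWeight hν
  have hS := hasSum_spectralEntropy (hermiteBasis hL) hw1.summable
    (hasSum_entropy_prod_thermalWeight hν)
  refine ⟨diagonalOperator (hermiteBasis hL) w, ?_,
    isDensityOperator_diagonalOperator _ hw1 hw0, hS.summable, hS.tsum_eq⟩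
  -- The operator is defined by its spectral decomposition, so only its kernel has to be verified,
  -- and only on wave packets.
  refine hasKernel_of_total (fun ξ => (memLp_wavePacket hL ξ).toLp)
    (eq_zero_of_inner_wavePacket hL) (memLp_gaussKernel hL hν0 h1 h2) fun ξ => ?_
  -- Compare Hermite coefficients: the factor `r^m` of the eigenvalue turns `(i ξ)^m` into `(i r
  -- ξ)^m`, and the damping factor accounts for replacing `exp (-ξ² / 2)` by `exp (-(r ξ)² / 2)`.
  have hT : diagonalOperator (hermiteBasis hL) w (memLp_wavePacket hL ξ).toLp =
      dampingFactor ν ξ • (memLp_wavePacket hL fun j => thermalRatio (ν j) * ξ j).toLp := by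
    refine ext_inner_hilbertBasis (hermiteBasis hL) fun α => ?_
    rw [inner_diagonalOperator _ hw1.summable, inner_smul_right, hermiteBasis_apply,
      inner_hermiteMode_wavePacket hL, inner_hermiteMode_wavePacket hL, mul_left_comm,
      mul_left_comm (dampingFactor ν ξ), hw, dampingFactor]
    push_cast
    rw [← Finset.prod_mul_distrib, ← Finset.prod_mul_distrib]
    congr 1
    refine Finset.prod_congr rfl fun j _ => ?_
    have : Complex.exp (-(ξ j : ℂ) ^ 2 / 2) =
        Complex.exp ((thermalRatio (ν j) ^ 2 - 1) * ξ j ^ 2 / 2) *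
          Complex.exp (-(thermalRatio (ν j) * ξ j : ℂ) ^ 2 / 2) := by
      rw [← Complex.exp_add]; congr 1; ring
    rw [this, thermalWeight]
    push_cast
    ring
  rw [hT]
  filter_upwards [Lp.coeFn_smul (dampingFactor ν ξ)
    (memLp_wavePacket hL fun j => thermalRatio (ν j) * ξ j).toLp,
    (memLp_wavePacket hL fun j => thermalRatio (ν j) * ξ j).coeFn_toLp] with x hx1 hx2
  rw [hx1, Pi.smul_apply, hx2, smul_eq_mul, ← integral_gaussKernel_mul_wavePacket hL hν0 h1 h2]
  refine integral_congr_ae ?_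
  filter_upwards [(memLp_wavePacket hL ξ).coeFn_toLp] with y hy
  rw [hy]

end GaussOperator

end CVSharing

end

noncomputable section

namespace CVSharing

open Matrix

/-! ### The dealer's input and the partial trace -/

theorem twoModeSqueezedVacuum_eq (ζ : ℂ) (y x : ℝ) :
    twoModeSqueezedVacuum ζ y x = (((√Real.pi)⁻¹ * Real.exp (-(Real.cosh (2 * ‖ζ‖) / 2) * (y ^ 2 + x ^ 2)
      + Real.sinh (2 * ‖ζ‖) * (y * x)) : ℝ) : ℂ) := by
  rw [twoModeSqueezedVacuum, Real.cosh_eq, Real.sinh_eq, neg_mul 2]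
  congr 3
  ring

/-- The two kinds of ancilla are paired because their normalizations then lose the dependence on
`a`. -/
theorem squeezedVacuum_mul {a : ℝ} (ha : 0 < a) (y z : ℝ) :
    squeezedVacuum a y * squeezedVacuum (1 / a) z =
      (((√Real.pi)⁻¹ * Real.exp (-y ^ 2 / (2 * a ^ 2) - a ^ 2 * z ^ 2 / 2) : ℝ) : ℂ) := by
  rw [squeezedVacuum, squeezedVacuum, ← Complex.ofReal_mul]
  congr 1
  rw [mul_mul_mul_comm, ← Real.exp_add, ← Real.mul_rpow (by positivity) (by positivity)]
  congr 1
  · have : Real.pi * a ^ 2 * (Real.pi * (1 / a) ^ 2) = Real.pi ^ (2 : ℝ) := by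
      rw [Real.rpow_two]; field_simp
    rw [this, ← Real.rpow_mul Real.pi_pos.le, Real.sqrt_eq_rpow, ← Real.rpow_neg Real.pi_pos.le]
    norm_num
  · congr 1
    field_simp
    ring

theorem inputWave_eq (k : ℕ) (ζ : ℂ) {a : ℝ} (ha : 0 < a) (y : ℝ) (x : Share k → ℝ) :
    inputWave k ζ a y x = (((√Real.pi)⁻¹ ^ (k - 1 + 1) * Real.exp (
      -(Real.cosh (2 * ‖ζ‖) / 2) * (y ^ 2 + x (Sum.inl (Sum.inl ())) ^ 2)
      + Real.sinh (2 * ‖ζ‖) * (y * x (Sum.inl (Sum.inl ())))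
      - (∑ i, x (Sum.inl (Sum.inr i)) ^ 2) / (2 * a ^ 2)
      - a ^ 2 * (∑ i, x (Sum.inr i) ^ 2) / 2) : ℝ) : ℂ) := by
  rw [inputWave, mul_assoc, ← Finset.prod_mul_distrib]
  simp_rw [squeezedVacuum_mul ha]
  rw [twoModeSqueezedVacuum_eq, ← Complex.ofReal_prod, ← Complex.ofReal_mul]
  congr 1
  rw [Finset.prod_mul_distrib, ← Real.exp_sum, Finset.prod_const, Finset.card_univ,
    Fintype.card_fin, mul_mul_mul_comm, ← Real.exp_add]
  refine congrArg₂ (· * ·) (pow_succ' _ _).symm (congrArg Real.exp ?_)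
  rw [Finset.sum_sub_distrib, ← Finset.sum_div, ← Finset.sum_div, ← Finset.mul_sum,
    Finset.sum_neg_distrib]
  ring

namespace Scheme

variable {k : ℕ} (P : Scheme k)

theorem isUnit_det_extendDecode : IsUnit (extendDecode P.decode).det := by
  rw [extendDecode, det_fromBlocks_zero₂₁, det_one, mul_one]
  exact P.isUnit_decode

theorem isUnit_det_xi : IsUnit P.xi.det := by
  rw [xi, det_mul]
  exact P.isUnit_det_extendDecode.mul P.isUnit_encode

theorem xi_secret_secret (t t' : Unit) : P.xi (Sum.inl (Sum.inl t)) (Sum.inl (Sum.inl t')) = 1 :=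
  P.alpha_secret

theorem xi_secret_y (t : Unit) (j) : P.xi (Sum.inl (Sum.inl t)) (Sum.inl (Sum.inr j)) = 0 :=
  P.beta_secret j

theorem xi_secret_z (t : Unit) (j) : P.xi (Sum.inl (Sum.inl t)) (Sum.inr j) = P.v j := rfl

theorem xi_collaborator_secret (i) (t : Unit) :
    P.xi (Sum.inl (Sum.inr i)) (Sum.inl (Sum.inl t)) = P.alpha i := rfl

theorem xi_collaborator_y (i j) : P.xi (Sum.inl (Sum.inr i)) (Sum.inl (Sum.inr j)) = P.beta i j :=
  rfl

theorem xi_other_secret (i) (t : Unit) : P.xi (Sum.inr i) (Sum.inl (Sum.inl t)) = P.alpha i :=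
  (P.alpha_eq i).symm

theorem xi_other_y (i j) : P.xi (Sum.inr i) (Sum.inl (Sum.inr j)) = P.beta i j :=
  (P.beta_eq i j).symm

/-- The matrix `(β_{i+1, j})` is invertible. -/
theorem isUnit_det_beta : IsUnit P.beta.det := by
  rw [isUnit_iff_ne_zero]
  intro h0
  obtain ⟨x, hx, hβ⟩ := exists_mulVec_eq_zero_iff.2 h0
  -- A null vector of `β`, placed in the `y`-slots, is annihilated by `xi`: share 1 has no `y`-part,
  -- and both other groups of shares have `β` as theirs.
  refine P.isUnit_det_xi.ne_zero (exists_mulVec_eq_zero_iff.1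
    ⟨Sum.elim (Sum.elim (fun _ => 0) x) (fun _ => 0), fun h => hx ?_, ?_⟩)
  · ext j
    exact congrFun h (Sum.inl (Sum.inr j))
  · ext i
    rcases i with (t | i) | i
    · simp [mulVec, dotProduct, Fintype.sum_sum_type, xi_secret_y]
    · have := congrFun hβ i
      simpa [mulVec, dotProduct, Fintype.sum_sum_type, xi_collaborator_y] using this
    · have := congrFun hβ i
      simpa [mulVec, dotProduct, Fintype.sum_sum_type, xi_other_y] using this

theorem totalWave_eq (ζ : ℂ) (a y : ℝ) (w : Share k → ℝ) :
    P.totalWave ζ a y w =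
      ((|P.xi.det| ^ (-(1 / 2) : ℝ) : ℝ) : ℂ) * inputWave k ζ a y (P.xi⁻¹ *ᵥ w) := by
  rw [totalWave, pointTransform, pointTransform, mulVec_mulVec, ← Matrix.mul_inv_rev, ← mul_assoc,
    ← Complex.ofReal_mul, ← Real.mul_rpow (abs_nonneg _) (abs_nonneg _), ← abs_mul, ← det_mul]
  rfl

/-- The matrix that gives the coordinates of the traced-out shares, up to a shift, in terms of the
ancilla coordinates when the coordinate of the first share is fixed. -/
def residual : Matrix (Fin (k - 1) ⊕ Fin (k - 1)) (Fin (k - 1) ⊕ Fin (k - 1)) ℝ :=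
  fromBlocks P.beta (of fun i j => P.xi (Sum.inl (Sum.inr i)) (Sum.inr j) - P.alpha i * P.v j)
    P.beta (of fun i j => P.xi (Sum.inr i) (Sum.inr j) - P.alpha i * P.v j)

/-- `residual` is the Schur complement in `xi` of the entry `α_1 = 1`. -/
theorem det_residual : P.residual.det = P.xi.det := by
  set e := Equiv.sumAssoc Unit (Fin (k - 1)) (Fin (k - 1)) with he
  rw [← det_submatrix_equiv_self e.symm P.xi]
  have : P.xi.submatrix e.symm e.symm = fromBlocks 1
      (of fun (_ : Unit) => Sum.elim (fun _ => 0) P.v) (of fun i (_ : Unit) => Sum.elim P.alpha P.alpha i)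
      (fromBlocks P.beta (of fun i j => P.xi (Sum.inl (Sum.inr i)) (Sum.inr j))
        P.beta (of fun i j => P.xi (Sum.inr i) (Sum.inr j))) := by
    ext i j
    rcases i with t | i | i <;> rcases j with t' | j | j <;>
      simp [he, xi_secret_secret, xi_secret_y, xi_secret_z, xi_other_secret, xi_other_y,
        xi_collaborator_secret, xi_collaborator_y]
  rw [this, det_fromBlocks_one₁₁]
  congr 1
  ext i j
  rcases i with i | i <;> rcases j with j | j <;> simp [residual, Matrix.mul_apply]

/-- The dealer's coordinates in terms of the coordinate of the first share and of the shifted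
ancilla coordinates. -/
def inputCoord (u : Fin (k - 1) → ℝ) (η : ℝ) (r : Fin (k - 1) ⊕ Fin (k - 1) → ℝ) : Share k → ℝ :=
  Sum.elim (Sum.elim (fun _ => η - ∑ j, P.v j * r (Sum.inr j))
    (fun j => r (Sum.inl j) - η * u j)) (fun j => r (Sum.inr j))

/-- The heart of the scheme: since `α = β u`, shifting the `y`-ancillas by `-η u` cancels the
contribution `η α` of the secret, and the traced-out coordinates no longer depend on `η`. -/
theorem xi_mulVec_inputCoord {u : Fin (k - 1) → ℝ} (hu : ∀ i, P.alpha i = ∑ j, u j * P.beta i j)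
    (η : ℝ) (r : Fin (k - 1) ⊕ Fin (k - 1) → ℝ) :
    P.xi *ᵥ P.inputCoord u η r = assemble η (P.residual *ᵥ r) := by
  have hα : ∀ i, ∑ j, P.beta i j * (η * u j) = η * P.alpha i := by
    intro i
    rw [hu, Finset.mul_sum]
    exact Finset.sum_congr rfl fun j _ => by ring
  have hb : ∀ i, ∑ j, P.beta i j * (r (Sum.inl j) - η * u j) =
      ∑ j, P.beta i j * r (Sum.inl j) - η * P.alpha i := by
    intro i
    simp_rw [mul_sub]
    rw [Finset.sum_sub_distrib, hα]
  have hg : ∀ (g : Fin (k - 1) → ℝ) (α : ℝ), ∑ j, (g j - α * P.v j) * r (Sum.inr j) =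
      ∑ j, g j * r (Sum.inr j) - α * ∑ j, P.v j * r (Sum.inr j) := by
    intro g α
    simp_rw [sub_mul, mul_assoc]
    rw [Finset.sum_sub_distrib, Finset.mul_sum]
  ext i
  rcases i with (t | i) | i
  · simp [mulVec, dotProduct, Fintype.sum_sum_type, inputCoord, assemble, xi_secret_secret,
      xi_secret_y, xi_secret_z]
  · have h1 := hb i
    have h2 := hg (fun j => P.xi (Sum.inl (Sum.inr i)) (Sum.inr j)) (P.alpha i)
    simp only [mulVec, dotProduct, Fintype.sum_sum_type, inputCoord, assemble, residual, Sum.elim_inl,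
      Sum.elim_inr, fromBlocks_apply₁₁, fromBlocks_apply₁₂, of_apply, Finset.univ_unique,
      Finset.sum_singleton]
    rw [h2]
    change P.alpha i * _ + ∑ j, P.beta i j * (r (Sum.inl j) - η * u j) + _ = _
    rw [h1]; ring
  · have h1 := hb i
    have h2 := hg (fun j => P.xi (Sum.inr i) (Sum.inr j)) (P.alpha i)
    simp only [mulVec, dotProduct, Fintype.sum_sum_type, inputCoord, assemble, residual, Sum.elim_inl,
      Sum.elim_inr, fromBlocks_apply₂₁, fromBlocks_apply₂₂, of_apply, Finset.univ_unique,
      Finset.sum_singleton, xi_other_secret, xi_other_y]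
    rw [h2, h1]; ring

theorem totalWave_assemble {u : Fin (k - 1) → ℝ} (hu : ∀ i, P.alpha i = ∑ j, u j * P.beta i j)
    (ζ : ℂ) (a y η : ℝ) (r : Fin (k - 1) ⊕ Fin (k - 1) → ℝ) :
    P.totalWave ζ a y (assemble η (P.residual *ᵥ r)) =
      ((|P.xi.det| ^ (-(1 / 2) : ℝ) : ℝ) : ℂ) * inputWave k ζ a y (P.inputCoord u η r) := by
  rw [totalWave_eq, ← P.xi_mulVec_inputCoord hu, mulVec_mulVec,
    nonsing_inv_mul _ P.isUnit_det_xi, one_mulVec]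

end Scheme

/-! ### The Gaussian integral over the traced-out shares -/

section TraceIntegral

variable {ι : Type*} [Fintype ι] [DecidableEq ι]

/-- The quadratic form of the Gaussian integral over the ancilla coordinates. -/
def ancillaForm (a c : ℝ) (v : ι → ℝ) : Matrix (ι ⊕ ι) (ι ⊕ ι) ℝ :=
  fromBlocks ((a ^ 2)⁻¹ • (1 : Matrix ι ι ℝ)) 0 0 (a ^ 2 • (1 : Matrix ι ι ℝ) + c • vecMulVec v v)

theorem ancillaForm_quadratic (a c : ℝ) (v : ι → ℝ) (r : ι ⊕ ι → ℝ) :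
    r ⬝ᵥ ancillaForm a c v *ᵥ r = (∑ i, r (Sum.inl i) ^ 2) / a ^ 2 + a ^ 2 * ∑ i, r (Sum.inr i) ^ 2 +
      c * (∑ i, v i * r (Sum.inr i)) ^ 2 := by
  rw [ancillaForm, fromBlocks_mulVec]
  have hv : v ⬝ᵥ (r ∘ Sum.inr) = ∑ i, v i * r (Sum.inr i) := rfl
  have h1 : (a ^ 2 • (1 : Matrix ι ι ℝ) + c • vecMulVec v v) *ᵥ (r ∘ Sum.inr) =
      a ^ 2 • (r ∘ Sum.inr) + (c * ∑ i, v i * r (Sum.inr i)) • v := by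
    rw [add_mulVec, smul_mulVec, one_mulVec, smul_mulVec, vecMulVec_mulVec, ← hv]
    ext i; simp; ring
  rw [h1]
  simp only [zero_mulVec, add_zero, zero_add, smul_mulVec, one_mulVec, dotProduct,
    Fintype.sum_sum_type, Sum.elim_inl, Sum.elim_inr, Pi.smul_apply, Pi.add_apply, smul_eq_mul,
    Function.comp_apply]
  have e1 : ∑ i, r (Sum.inl i) * ((a ^ 2)⁻¹ * r (Sum.inl i)) = (∑ i, r (Sum.inl i) ^ 2) / a ^ 2 := by
    rw [Finset.sum_div]; exact Finset.sum_congr rfl fun i _ => by ring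
  have e2 : ∑ i, r (Sum.inr i) * (a ^ 2 * r (Sum.inr i) + (c * ∑ j, v j * r (Sum.inr j)) * v i) =
      a ^ 2 * ∑ i, r (Sum.inr i) ^ 2 + c * (∑ i, v i * r (Sum.inr i)) ^ 2 := by
    have : ∀ i, r (Sum.inr i) * (a ^ 2 * r (Sum.inr i) + (c * ∑ j, v j * r (Sum.inr j)) * v i) =
        a ^ 2 * r (Sum.inr i) ^ 2 + (c * ∑ j, v j * r (Sum.inr j)) * (v i * r (Sum.inr i)) :=
      fun i => by ring
    simp_rw [this]
    rw [Finset.sum_add_distrib, ← Finset.mul_sum, ← Finset.mul_sum]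
    ring
  rw [e1, e2]; ring

theorem posDef_ancillaForm {a c : ℝ} (ha : 0 < a) (hc : 0 ≤ c) (v : ι → ℝ) :
    (ancillaForm a c v).PosDef := by
  refine PosDef.of_dotProduct_mulVec_pos ?_ fun r hr => ?_
  · rw [IsHermitian, conjTranspose_eq_transpose_of_trivial, ancillaForm, fromBlocks_transpose]
    simp [transpose_add, transpose_smul, transpose_vecMulVec]
  · rw [star_trivial, ancillaForm_quadratic]
    have h3 : 0 ≤ c * (∑ i, v i * r (Sum.inr i)) ^ 2 := mul_nonneg hc (sq_nonneg _)
    have h1 : 0 ≤ ∑ i, r (Sum.inl i) ^ 2 := Finset.sum_nonneg fun i _ => sq_nonneg _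
    have h2 : 0 ≤ ∑ i, r (Sum.inr i) ^ 2 := Finset.sum_nonneg fun i _ => sq_nonneg _
    obtain ⟨i, hi⟩ := Function.ne_iff.1 hr
    rcases i with i | i
    · have : 0 < ∑ i, r (Sum.inl i) ^ 2 :=
        Finset.sum_pos' (fun i _ => sq_nonneg _) ⟨i, Finset.mem_univ i, sq_pos_of_ne_zero hi⟩
      positivity
    · have : 0 < ∑ i, r (Sum.inr i) ^ 2 :=
        Finset.sum_pos' (fun i _ => sq_nonneg _) ⟨i, Finset.mem_univ i, sq_pos_of_ne_zero hi⟩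
      positivity

/-- The matrix determinant lemma for the rank-one term; the powers of `a` from the two blocks cancel
except for the one in the denominator. -/
theorem det_ancillaForm {a : ℝ} (ha : 0 < a) (c : ℝ) (v : ι → ℝ) :
    (ancillaForm a c v).det = (a ^ 2 + c * ∑ i, v i ^ 2) / a ^ 2 := by
  have e : a ^ 2 • (1 : Matrix ι ι ℝ) + c • vecMulVec v v =
      a ^ 2 • (1 + replicateCol Unit ((c / a ^ 2) • v) * replicateRow Unit v) := by
    rw [smul_add, ← vecMulVec_eq]
    congr 1
    ext i j
    simp [vecMulVec_apply]
    field_simp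
  rw [ancillaForm, det_fromBlocks_zero₂₁, e, det_smul, det_smul, det_one, mul_one,
    det_one_add_replicateCol_mul_replicateRow, ← mul_assoc, ← mul_pow,
    inv_mul_cancel₀ (by positivity), one_pow, one_mul]
  have : v ⬝ᵥ ((c / a ^ 2) • v) = c / a ^ 2 * ∑ i, v i ^ 2 := by
    rw [dotProduct_smul, smul_eq_mul]; simp [dotProduct, sq]
  rw [this]
  field_simp

theorem ancilla_integral {a c : ℝ} (ha : 0 < a) (hc : 0 ≤ c) (u v : ι → ℝ) (σ κ : ℝ) :
    Integrable (fun r : ι ⊕ ι → ℝ => Real.exp (-((∑ i, r (Sum.inl i) ^ 2) / a ^ 2 +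
        a ^ 2 * ∑ i, r (Sum.inr i) ^ 2 + c * (∑ i, v i * r (Sum.inr i)) ^ 2) +
        (σ / a ^ 2 * ∑ i, u i * r (Sum.inl i) + κ * ∑ i, v i * r (Sum.inr i)))) ∧
    ∫ r : ι ⊕ ι → ℝ, Real.exp (-((∑ i, r (Sum.inl i) ^ 2) / a ^ 2 +
        a ^ 2 * ∑ i, r (Sum.inr i) ^ 2 + c * (∑ i, v i * r (Sum.inr i)) ^ 2) +
        (σ / a ^ 2 * ∑ i, u i * r (Sum.inl i) + κ * ∑ i, v i * r (Sum.inr i))) =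
      Real.pi ^ Fintype.card ι * (a * √(1 / (a ^ 2 + c * ∑ i, v i ^ 2))) *
        Real.exp (σ ^ 2 * (∑ i, u i ^ 2) / (4 * a ^ 2) +
          κ ^ 2 * (∑ i, v i ^ 2) / (4 * (a ^ 2 + c * ∑ i, v i ^ 2))) := by
  set v2 := ∑ i, v i ^ 2 with hv2
  have hv2n : 0 ≤ v2 := Finset.sum_nonneg fun i _ => sq_nonneg _
  set A := a ^ 2 + c * v2 with hA
  have hAp : 0 < A := by positivity
  set b : ι ⊕ ι → ℝ := Sum.elim (fun i => σ / a ^ 2 * u i) (fun i => κ * v i) with hb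
  -- The preimage of the linear term under the quadratic form: `v` is fixed up to the factor `A = a²
  -- + c v²` by `a² + c v vᵀ`, whence `κ / A`.
  set w : ι ⊕ ι → ℝ := Sum.elim (fun i => σ * u i) (fun i => κ / A * v i) with hw
  have hbw : b = ancillaForm a c v *ᵥ w := by
    rw [ancillaForm, fromBlocks_mulVec]
    have hvw : v ⬝ᵥ (w ∘ Sum.inr) = κ / A * v2 := by
      simp only [dotProduct, hw, Function.comp_apply, Sum.elim_inr, hv2, Finset.mul_sum]
      exact Finset.sum_congr rfl fun i _ => by ring
    have h1 : (a ^ 2 • (1 : Matrix ι ι ℝ) + c • vecMulVec v v) *ᵥ (w ∘ Sum.inr) =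
        a ^ 2 • (w ∘ Sum.inr) + (c * (κ / A * v2)) • v := by
      rw [add_mulVec, smul_mulVec, one_mulVec, smul_mulVec, vecMulVec_mulVec, hvw]
      ext i; simp; ring
    rw [h1]
    ext i
    rcases i with i | i
    · simp [hb, hw]
      rw [smul_mulVec]
      simp; ring
    · simp [hb, hw]
      have : a ^ 2 * (κ / A * v i) + c * (κ / A * v2) * v i = κ / A * v i * A := by rw [hA]; ring
      rw [this]; field_simp
  have hg := gaussian_integral (posDef_ancillaForm ha hc v) (fun i => (w i : ℂ)) (fun i => (b i : ℂ))
    (by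
      ext i
      rw [hbw]
      simp [mulVec, dotProduct])
  have e : ∀ r : ι ⊕ ι → ℝ, Complex.exp (-((r ⬝ᵥ ancillaForm a c v *ᵥ r : ℝ) : ℂ) +
      ∑ i, (b i : ℂ) * r i) = ((Real.exp (-((∑ i, r (Sum.inl i) ^ 2) / a ^ 2 +
        a ^ 2 * ∑ i, r (Sum.inr i) ^ 2 + c * (∑ i, v i * r (Sum.inr i)) ^ 2) +
        (σ / a ^ 2 * ∑ i, u i * r (Sum.inl i) + κ * ∑ i, v i * r (Sum.inr i))) : ℝ) : ℂ) := by
    intro r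
    rw [ancillaForm_quadratic, Complex.ofReal_exp]
    congr 1
    have : ∑ i, (b i : ℂ) * r i = ((∑ i, b i * r i : ℝ) : ℂ) := by push_cast; rfl
    rw [this, ← Complex.ofReal_neg, ← Complex.ofReal_add]
    congr 2
    rw [Fintype.sum_sum_type, Finset.mul_sum, Finset.mul_sum]
    simp only [hb, Sum.elim_inl, Sum.elim_inr, mul_assoc]
  simp_rw [e] at hg
  refine ⟨hg.1.re, ?_⟩
  have h := hg.2
  rw [integral_complex_ofReal] at h
  have hwb : (fun i => (w i : ℂ)) ⬝ᵥ (fun i => (b i : ℂ)) / 4 = ((σ ^ 2 * (∑ i, u i ^ 2) / (4 * a ^ 2) +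
          κ ^ 2 * v2 / (4 * A) : ℝ) : ℂ) := by
    have : (fun i => (w i : ℂ)) ⬝ᵥ (fun i => (b i : ℂ)) = ((∑ i, w i * b i : ℝ) : ℂ) := by
      simp [dotProduct]
    rw [this, Fintype.sum_sum_type]
    have e1 : ∑ i, w (Sum.inl i) * b (Sum.inl i) = σ ^ 2 / a ^ 2 * ∑ i, u i ^ 2 := by
      rw [Finset.mul_sum]
      exact Finset.sum_congr rfl fun i _ => by simp only [hw, hb, Sum.elim_inl]; ring
    have e2 : ∑ i, w (Sum.inr i) * b (Sum.inr i) = κ ^ 2 / A * v2 := by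
      rw [hv2, Finset.mul_sum]
      exact Finset.sum_congr rfl fun i _ => by simp only [hw, hb, Sum.elim_inr]; ring
    rw [e1, e2]
    push_cast
    field_simp
  rw [hwb, ← Complex.ofReal_exp, ← Complex.ofReal_mul] at h
  rw [Complex.ofReal_injective h, det_ancillaForm ha, ← hv2, ← hA]
  congr 1
  rw [Fintype.card_sum]
  have : Real.pi ^ (Fintype.card ι + Fintype.card ι) / (A / a ^ 2) =
      (Real.pi ^ Fintype.card ι * a) ^ 2 * (1 / A) := by
    field_simp
    ring
  rw [this, Real.sqrt_mul (by positivity), Real.sqrt_sq (by positivity)]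
  ring

end TraceIntegral

/-! ### The density matrix of the reference and the extracted secret -/

namespace Scheme

variable {k : ℕ} (P : Scheme k)

/-- Expanding the squares separates a factor free of `r` from the integrand of `ancilla_integral`,
with `σ = η + η'` and `κ = c (η + η') - s (ω + ω')`. -/
theorem inputWave_inputCoord_mul_conj (u : Fin (k - 1) → ℝ) (ζ : ℂ) {a : ℝ} (ha : 0 < a)
    {c s : ℝ} (hc : c = Real.cosh (2 * ‖ζ‖)) (hs : s = Real.sinh (2 * ‖ζ‖)) (ω η ω' η' : ℝ)
    (r : Fin (k - 1) ⊕ Fin (k - 1) → ℝ) :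
    inputWave k ζ a ω (P.inputCoord u η r) * conj (inputWave k ζ a ω' (P.inputCoord u η' r)) =
      ((((Real.pi ^ (k - 1 + 1))⁻¹ * Real.exp (-(c / 2) * (ω ^ 2 + ω' ^ 2 + η ^ 2 + η' ^ 2)
        + s * (ω * η + ω' * η') - (∑ j, u j ^ 2) * (η ^ 2 + η' ^ 2) / (2 * a ^ 2))) *
        Real.exp (-((∑ i, r (Sum.inl i) ^ 2) / a ^ 2 +
        a ^ 2 * ∑ i, r (Sum.inr i) ^ 2 + c * (∑ i, P.v i * r (Sum.inr i)) ^ 2) +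
        ((η + η') / a ^ 2 * ∑ i, u i * r (Sum.inl i) +
          (c * (η + η') - s * (ω + ω')) * ∑ i, P.v i * r (Sum.inr i))) : ℝ) : ℂ) := by
  rw [inputWave_eq k ζ ha, inputWave_eq k ζ ha, Complex.conj_ofReal, ← Complex.ofReal_mul, ← hc, ← hs]
  congr 1
  have hπ : (√Real.pi)⁻¹ ^ (k - 1 + 1) * (√Real.pi)⁻¹ ^ (k - 1 + 1) = (Real.pi ^ (k - 1 + 1))⁻¹ := by
    rw [← mul_pow, ← mul_inv, Real.mul_self_sqrt Real.pi_pos.le, inv_pow]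
  rw [mul_mul_mul_comm, hπ, ← Real.exp_add, mul_assoc, ← Real.exp_add]
  refine congrArg₂ (· * ·) rfl (congrArg Real.exp ?_)
  have hsq : ∀ t : ℝ, ∑ i, (r (Sum.inl i) - t * u i) ^ 2 = ∑ i, r (Sum.inl i) ^ 2
      - 2 * t * ∑ i, u i * r (Sum.inl i) + t ^ 2 * ∑ i, u i ^ 2 := by
    intro t
    rw [Finset.mul_sum, Finset.mul_sum, ← Finset.sum_sub_distrib, ← Finset.sum_add_distrib]
    exact Finset.sum_congr rfl fun i _ => by ring
  simp only [inputCoord, Sum.elim_inl, Sum.elim_inr, hsq]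
  field_simp
  ring

/-- The integrand of the partial trace is integrable, and the joint state of the reference and the
extracted secret is an explicit Gaussian. -/
theorem integrable_traceIntegrand_and_extractedState {u : Fin (k - 1) → ℝ}
    (hu : ∀ i, P.alpha i = ∑ j, u j * P.beta i j) (ζ : ℂ) {a : ℝ} (ha : 0 < a)
    {c s v2 u2 : ℝ} (hc : c = Real.cosh (2 * ‖ζ‖)) (hs : s = Real.sinh (2 * ‖ζ‖))
    (hv2 : v2 = ∑ j, P.v j ^ 2) (hu2 : u2 = ∑ j, u j ^ 2) (x x' : Fin 2 → ℝ) :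
    Integrable (P.traceIntegrand ζ a x x') ∧ P.extractedState ζ a x x' =
      ((a / Real.pi * √(1 / (a ^ 2 + c * v2)) * Real.exp (
        (-(c / 2) + s ^ 2 * v2 / (4 * (a ^ 2 + c * v2))) * (x 0 ^ 2 + x' 0 ^ 2)
        + (-(c / 2) + c ^ 2 * v2 / (4 * (a ^ 2 + c * v2)) - u2 / (4 * a ^ 2)) * (x 1 ^ 2 + x' 1 ^ 2)
        + (s - c * s * v2 / (2 * (a ^ 2 + c * v2))) * (x 0 * x 1 + x' 0 * x' 1)
        - c * s * v2 / (2 * (a ^ 2 + c * v2)) * (x 1 * x' 0 + x' 1 * x 0)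
        + s ^ 2 * v2 / (2 * (a ^ 2 + c * v2)) * (x 0 * x' 0)
        + (c ^ 2 * v2 / (2 * (a ^ 2 + c * v2)) + u2 / (2 * a ^ 2)) * (x 1 * x' 1)) : ℝ) : ℂ) := by
  have hc0 : 0 ≤ c := hc ▸ (Real.cosh_pos _).le
  have hv0 : 0 ≤ v2 := hv2 ▸ Finset.sum_nonneg fun i _ => sq_nonneg _
  have hA : 0 < a ^ 2 + c * v2 := by positivity
  have hdet : IsUnit P.residual.det := P.det_residual ▸ P.isUnit_det_xi
  have hdet0 : 0 < |P.xi.det| := abs_pos.2 P.isUnit_det_xi.ne_zero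
  set C := |P.xi.det|⁻¹ * ((Real.pi ^ (k - 1 + 1))⁻¹ * Real.exp (-(c / 2) *
    (x 0 ^ 2 + x' 0 ^ 2 + x 1 ^ 2 + x' 1 ^ 2) + s * (x 0 * x 1 + x' 0 * x' 1)
      - (∑ j, u j ^ 2) * (x 1 ^ 2 + x' 1 ^ 2) / (2 * a ^ 2))) with hC
  obtain ⟨hint, hval⟩ := ancilla_integral ha hc0 u P.v (x 1 + x' 1)
    (c * (x 1 + x' 1) - s * (x 0 + x' 0))
  have key : ∀ r, P.traceIntegrand ζ a x x' (P.residual *ᵥ r) = ((C * Real.exp (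
      -((∑ i, r (Sum.inl i) ^ 2) / a ^ 2 +
        a ^ 2 * ∑ i, r (Sum.inr i) ^ 2 + c * (∑ i, P.v i * r (Sum.inr i)) ^ 2) +
        ((x 1 + x' 1) / a ^ 2 * ∑ i, u i * r (Sum.inl i) +
          (c * (x 1 + x' 1) - s * (x 0 + x' 0)) * ∑ i, P.v i * r (Sum.inr i))) : ℝ) : ℂ) := by
    intro r
    rw [traceIntegrand, P.totalWave_assemble hu, P.totalWave_assemble hu, map_mul,
      Complex.conj_ofReal, mul_mul_mul_comm, P.inputWave_inputCoord_mul_conj u ζ ha hc hs,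
      ← Complex.ofReal_mul, ← Complex.ofReal_mul, ← Real.rpow_add hdet0]
    congr 1
    -- The factors `|det|^(-1/2)` from ket and bra make `|det|⁻¹`, which the Jacobian of the
    -- substitution by `residual` later cancels.
    rw [show (-(1 / 2) + -(1 / 2) : ℝ) = -1 by norm_num, Real.rpow_neg_one, hC]
    simp only [mul_assoc]
  have hkey := funext key
  constructor
  · rw [← integrable_mulVec_iff P.residual hdet, hkey]
    exact (hint.const_mul C).ofReal
  · have h := integral_mulVec P.residual hdet (P.traceIntegrand ζ a x x')
    rw [hkey, integral_complex_ofReal, integral_const_mul, hval, P.det_residual, ← hv2, ← hu2] at h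
    change (∫ e, P.traceIntegrand ζ a x x' e) = _
    have h' : (∫ e, P.traceIntegrand ζ a x x' e) = |P.xi.det| • ((|P.xi.det|)⁻¹ •
        ∫ e, P.traceIntegrand ζ a x x' e) := by
      rw [smul_smul, mul_inv_cancel₀ hdet0.ne', one_smul]
    rw [h', ← h, Complex.real_smul, ← Complex.ofReal_mul]
    congr 1
    rw [hC, ← hu2, Fintype.card_fin]
    have regroup : ∀ d p q t e e' : ℝ, d * (d⁻¹ * (p * e) * (q * t * e')) =
        d * d⁻¹ * (q * p) * t * (e * e') := fun d p q t e e' => by ring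
    rw [regroup, mul_inv_cancel₀ hdet0.ne', ← Real.exp_add, pow_succ, mul_inv,
      ← mul_assoc (Real.pi ^ (k - 1)), mul_inv_cancel₀ (by positivity), one_mul, one_mul,
      ← mul_assoc, inv_mul_eq_div]
    refine congrArg₂ (· * ·) rfl (congrArg Real.exp ?_)
    field_simp
    ring

end Scheme

end CVSharing

end

noncomputable section

namespace CVSharing

open Matrix

/-! ### One- and two-mode Gaussian states -/

theorem posDef_fin_one {p : ℝ} (hp : 0 < p) : (!![p] : Matrix (Fin 1) (Fin 1) ℝ).PosDef := by
  have : (!![p] : Matrix (Fin 1) (Fin 1) ℝ) = diagonal fun _ => p := by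
    ext i j; fin_cases i; fin_cases j; simp
  rw [this]
  exact posDef_diagonal_iff.2 fun _ => hp

theorem posDef_fin_two {p q r : ℝ} (hp : 0 < p) (hd : 0 < p * r - q ^ 2) :
    (!![p, q; q, r] : Matrix (Fin 2) (Fin 2) ℝ).PosDef := by
  refine PosDef.of_dotProduct_mulVec_pos ?_ fun x hx => ?_
  · ext i j
    fin_cases i <;> fin_cases j <;> simp
  · have e : star x ⬝ᵥ (!![p, q; q, r] : Matrix (Fin 2) (Fin 2) ℝ) *ᵥ x =
        ((p * x 0 + q * x 1) ^ 2 + (p * r - q ^ 2) * x 1 ^ 2) / p := by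
      simp [dotProduct, mulVec, Fin.sum_univ_two]
      field_simp
      ring
    rw [e]
    refine div_pos ?_ hp
    by_cases h1 : x 1 = 0
    · have h0 : x 0 ≠ 0 := fun h0 => hx (by ext i; fin_cases i <;> simp [h0, h1])
      rw [h1]
      have := sq_pos_of_ne_zero (mul_ne_zero hp.ne' h0)
      simpa using this
    · have := sq_pos_of_ne_zero h1
      positivity

theorem inv_fin_two {p q r : ℝ} : (!![p, q; q, r] : Matrix (Fin 2) (Fin 2) ℝ)⁻¹ =
    (p * r - q ^ 2)⁻¹ • !![r, -q; -q, p] := by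
  rw [Matrix.inv_def, adjugate_fin_two_of, det_fin_two_of, Ring.inverse_eq_inv', sq]

theorem modeBlock_fromBlocks {n : ℕ} (M N : Matrix (Fin n) (Fin n) ℝ) (i j : Fin n) :
    modeBlock (fromBlocks M 0 0 N) i j = fromBlocks !![M i j] 0 0 !![N i j] := by
  ext a b
  rcases a with a | a <;> rcases b with b | b <;> simp [modeBlock]

theorem det_modeBlock_fromBlocks {n : ℕ} (M N : Matrix (Fin n) (Fin n) ℝ) (i j : Fin n) :
    (modeBlock (fromBlocks M 0 0 N) i j).det = M i j * N i j := by
  rw [modeBlock_fromBlocks, det_fromBlocks_zero₂₁]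
  simp

theorem gaussKernel_fin_one (p p' : ℝ) (x x' : Fin 1 → ℝ) : gaussKernel !![p] !![p'] x x' =
    (((√(Real.pi * p))⁻¹ * Real.exp (-(x 0 + x' 0) ^ 2 / (4 * p) - p' * (x 0 - x' 0) ^ 2 / 4) : ℝ) : ℂ) := by
  have hi : (!![p] : Matrix (Fin 1) (Fin 1) ℝ)⁻¹ = !![p⁻¹] := by
    rw [Matrix.inv_def]; ext i j; fin_cases i; fin_cases j; simp
  rw [gaussKernel, hi, pow_one]
  congr 1
  refine congrArg₂ (· * ·) (by simp) (congrArg Real.exp ?_)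
  simp [dotProduct, mulVec]
  ring

theorem gaussKernel_fin_two (p q r p' q' r' : ℝ) (x x' : Fin 2 → ℝ) :
    gaussKernel !![p, q; q, r] !![p', q'; q', r'] x x' =
    (((√(Real.pi ^ 2 * (p * r - q ^ 2)))⁻¹ * Real.exp (-(r * (x 0 + x' 0) ^ 2
      - 2 * q * ((x 0 + x' 0) * (x 1 + x' 1)) + p * (x 1 + x' 1) ^ 2) / (p * r - q ^ 2) / 4
      - (p' * (x 0 - x' 0) ^ 2 + 2 * q' * ((x 0 - x' 0) * (x 1 - x' 1)) + r' * (x 1 - x' 1) ^ 2) / 4)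
      : ℝ) : ℂ) := by
  rw [gaussKernel, inv_fin_two, det_fin_two_of, ← sq]
  congr 1
  refine congrArg₂ (· * ·) rfl (congrArg Real.exp ?_)
  simp [dotProduct, mulVec, Fin.sum_univ_two]
  ring

theorem integral_exp_shifted_quadratic {b : ℝ} (m e : ℝ) :
    ∫ t : ℝ, Real.exp (-b * (t - m) ^ 2 + e) = √(Real.pi / b) * Real.exp e := by
  simp_rw [Real.exp_add]
  rw [integral_mul_const, integral_sub_right_eq_self (fun t => Real.exp (-b * t ^ 2)) m,
    integral_gaussian]

theorem sqrt_ratio {p d : ℝ} (hp : 0 < p) (hd : 0 < d) :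
    (√(Real.pi ^ 2 * d))⁻¹ * √(Real.pi / (p / d)) = (√(Real.pi * p))⁻¹ := by
  rw [← Real.sqrt_inv, ← Real.sqrt_inv, ← Real.sqrt_mul (by positivity)]
  congr 1
  field_simp

/-- Setting both coordinates of the traced mode to `t` removes its differences, so only the corner
of `N` survives. Completing the square in `t` leaves the reciprocal of the retained diagonal entry
of `M`: a reduced state has the corresponding blocks as its covariance. -/
theorem traceSecond_gaussKernel {p q r : ℝ} (p' q' r' : ℝ) (hp : 0 < p) (hd : 0 < p * r - q ^ 2) :
    traceSecond (gaussKernel !![p, q; q, r] !![p', q'; q', r']) = gaussKernel !![p] !![p'] := by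
  funext x x'
  rw [traceSecond, gaussKernel_fin_one]
  simp_rw [gaussKernel_fin_two]
  rw [integral_complex_ofReal, integral_const_mul]
  congr 1
  have : ∀ t : ℝ, -(r * (x 0 + x' 0) ^ 2 - 2 * q * ((x 0 + x' 0) * (t + t)) + p * (t + t) ^ 2) /
      (p * r - q ^ 2) / 4 - (p' * (x 0 - x' 0) ^ 2 + 2 * q' * ((x 0 - x' 0) * (t - t))
        + r' * (t - t) ^ 2) / 4 = -(p / (p * r - q ^ 2)) * (t - q * (x 0 + x' 0) / (2 * p)) ^ 2
      + (-(x 0 + x' 0) ^ 2 / (4 * p) - p' * (x 0 - x' 0) ^ 2 / 4) := by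
    intro t
    -- The determinant is kept as an opaque nonzero quantity while denominators are cleared.
    obtain ⟨d, hd'⟩ : ∃ d, d = p * r - q ^ 2 := ⟨_, rfl⟩
    rw [← hd'] at hd ⊢
    field_simp
    rw [hd']
    ring
  simp only [cons_val_zero, cons_val_one, this]
  rw [integral_exp_shifted_quadratic, ← mul_assoc, sqrt_ratio hp hd]

theorem traceFirst_gaussKernel {p q r : ℝ} (p' q' r' : ℝ) (hr : 0 < r) (hd : 0 < p * r - q ^ 2) :
    traceFirst (gaussKernel !![p, q; q, r] !![p', q'; q', r']) = gaussKernel !![r] !![r'] := by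
  funext x x'
  rw [traceFirst, gaussKernel_fin_one]
  simp_rw [gaussKernel_fin_two]
  rw [integral_complex_ofReal, integral_const_mul]
  congr 1
  have : ∀ t : ℝ, -(r * (t + t) ^ 2 - 2 * q * ((t + t) * (x 0 + x' 0)) + p * (x 0 + x' 0) ^ 2) /
      (p * r - q ^ 2) / 4 - (p' * (t - t) ^ 2 + 2 * q' * ((t - t) * (x 0 - x' 0))
        + r' * (x 0 - x' 0) ^ 2) / 4 = -(r / (p * r - q ^ 2)) * (t - q * (x 0 + x' 0) / (2 * r)) ^ 2
      + (-(x 0 + x' 0) ^ 2 / (4 * r) - r' * (x 0 - x' 0) ^ 2 / 4) := by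
    intro t
    obtain ⟨d, hd'⟩ : ∃ d, d = p * r - q ^ 2 := ⟨_, rfl⟩
    rw [← hd'] at hd ⊢
    field_simp
    rw [hd']
    ring
  simp only [cons_val_zero, cons_val_one, this]
  rw [integral_exp_shifted_quadratic, ← mul_assoc, sqrt_ratio hr hd]

/-! ### Symplectic eigenvalues of one- and two-mode covariance matrices -/

section SimultaneousDiagonal

variable {n : ℕ} {M N L : Matrix (Fin n) (Fin n) ℝ} {ν : Fin n → ℝ}

/-- `M * N` is similar to `diag ν²`; its determinant and its trace are the symmetric functions that
determine the spectrum for two modes. -/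
theorem det_mul_det_of_diagonal (hL : IsUnit L.det) (h1 : M = L * diagonal ν * Lᵀ)
    (h2 : Lᵀ * N * L = diagonal ν) : M.det * N.det = (∏ i, ν i) ^ 2 := by
  have e1 := congrArg det h1
  have e2 := congrArg det h2
  simp only [det_mul, det_transpose, det_diagonal] at e1 e2
  refine mul_left_cancel₀ (mul_ne_zero hL.ne_zero hL.ne_zero) ?_
  rw [e1]
  linear_combination L.det * L.det * (∏ i, ν i) * e2

theorem trace_mul_of_diagonal (h1 : M = L * diagonal ν * Lᵀ) (h2 : Lᵀ * N * L = diagonal ν) :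
    (M * N).trace = ∑ i, ν i ^ 2 := by
  have : (M * N).trace = (diagonal ν * (Lᵀ * N * L)).trace := by
    rw [h1, Matrix.mul_assoc L, Matrix.mul_assoc L, trace_mul_comm L]
    simp only [Matrix.mul_assoc]
  rw [this, h2, diagonal_mul_diagonal, trace_diagonal]
  exact Finset.sum_congr rfl fun i _ => (sq _).symm

theorem reindex_diagonal (σ : Equiv.Perm (Fin n)) (hL : IsUnit L.det)
    (h1 : M = L * diagonal ν * Lᵀ) (h2 : Lᵀ * N * L = diagonal ν) :
    IsUnit (L.submatrix id σ).det ∧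
      M = L.submatrix id σ * diagonal (ν ∘ σ) * (L.submatrix id σ)ᵀ ∧
      (L.submatrix id σ)ᵀ * N * L.submatrix id σ = diagonal (ν ∘ σ) := by
  refine ⟨?_, ?_, ?_⟩
  · rw [det_permute']
    refine IsUnit.mul ?_ hL
    rcases Int.units_eq_one_or (Equiv.Perm.sign σ) with h | h <;> simp [h]
  · rw [← submatrix_diagonal_equiv, transpose_submatrix, submatrix_mul_equiv, submatrix_mul_equiv,
      ← h1, submatrix_id_id]
  · rw [← submatrix_diagonal_equiv, ← h2, transpose_submatrix]
    rfl

end SimultaneousDiagonal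

theorem exists_simultaneous_diagonal_fin_one {p p' : ℝ} (hp : 0 < p) (hp' : 0 < p') :
    ∃ L : Matrix (Fin 1) (Fin 1) ℝ, IsUnit L.det ∧
      !![p] = L * diagonal ![√(p * p')] * Lᵀ ∧ Lᵀ * !![p'] * L = diagonal ![√(p * p')] := by
  obtain ⟨L, ν, hL, hν, h1, h2⟩ :=
    exists_simultaneous_diagonal (posDef_fin_one hp) (posDef_fin_one hp')
  have h := det_mul_det_of_diagonal hL h1 h2
  simp only [det_fin_one_of, Finset.univ_unique, Finset.prod_singleton] at h
  have e : ν = ![√(p * p')] := by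
    ext i
    fin_cases i
    simp only [h]
    exact (Real.sqrt_sq (hν _).le).symm
  exact ⟨L, hL, e ▸ h1, e ▸ h2⟩

/-- The squares of the eigenvalues have sum `Δ` and product `D`, so the discriminant is `(ν₀² -
ν₁²)²`, which also proves `4 D ≤ Δ²`. -/
theorem exists_simultaneous_diagonal_fin_two {M N : Matrix (Fin 2) (Fin 2) ℝ} (hM : M.PosDef)
    (hN : N.PosDef) {Δ D : ℝ} (hΔ : (M * N).trace = Δ) (hD : M.det * N.det = D) :
    4 * D ≤ Δ ^ 2 ∧ ∃ L : Matrix (Fin 2) (Fin 2) ℝ, IsUnit L.det ∧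
      M = L * diagonal ![√((Δ + √(Δ ^ 2 - 4 * D)) / 2), √((Δ - √(Δ ^ 2 - 4 * D)) / 2)] * Lᵀ ∧
      Lᵀ * N * L = diagonal ![√((Δ + √(Δ ^ 2 - 4 * D)) / 2), √((Δ - √(Δ ^ 2 - 4 * D)) / 2)] := by
  -- The modes are swapped if necessary, so that the larger eigenvalue carries the plus sign of the
  -- root.
  have key : ∃ (L : Matrix (Fin 2) (Fin 2) ℝ) (ν : Fin 2 → ℝ), IsUnit L.det ∧ (∀ i, 0 < ν i) ∧
      ν 1 ≤ ν 0 ∧ M = L * diagonal ν * Lᵀ ∧ Lᵀ * N * L = diagonal ν := by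
    obtain ⟨L, ν, hL, hν, h1, h2⟩ := exists_simultaneous_diagonal hM hN
    rcases le_total (ν 1) (ν 0) with h | h
    · exact ⟨L, ν, hL, hν, h, h1, h2⟩
    · obtain ⟨hL', h1', h2'⟩ := reindex_diagonal (Equiv.swap 0 1) hL h1 h2
      exact ⟨_, _, hL', fun i => hν _, by simpa using h, h1', h2'⟩
  obtain ⟨L, ν, hL, hν, hle, h1, h2⟩ := key
  have ht := trace_mul_of_diagonal h1 h2
  have hd := det_mul_det_of_diagonal hL h1 h2
  rw [hΔ, Fin.sum_univ_two] at ht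
  rw [hD, Fin.prod_univ_two] at hd
  have hdisc : Δ ^ 2 - 4 * D = (ν 0 ^ 2 - ν 1 ^ 2) ^ 2 := by rw [ht, hd]; ring
  have hsq : ν 1 ^ 2 ≤ ν 0 ^ 2 := pow_le_pow_left₀ (hν 1).le hle 2
  refine ⟨by nlinarith [sq_nonneg (ν 0 ^ 2 - ν 1 ^ 2)], L, hL, ?_⟩
  have e : ν = ![√((Δ + √(Δ ^ 2 - 4 * D)) / 2), √((Δ - √(Δ ^ 2 - 4 * D)) / 2)] := by
    rw [hdisc, Real.sqrt_sq (sub_nonneg.2 hsq), ht,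
      show (ν 0 ^ 2 + ν 1 ^ 2 + (ν 0 ^ 2 - ν 1 ^ 2)) / 2 = ν 0 ^ 2 by ring,
      show (ν 0 ^ 2 + ν 1 ^ 2 - (ν 0 ^ 2 - ν 1 ^ 2)) / 2 = ν 1 ^ 2 by ring,
      Real.sqrt_sq (hν 0).le, Real.sqrt_sq (hν 1).le]
    ext i
    fin_cases i <;> simp
  rw [← e]
  exact ⟨h1, h2⟩

/-! ### The covariance matrix of the extracted state -/

section ExtractedCovariance

variable {c s p q : ℝ}

theorem posDef_position_block (hc : 1 ≤ c) (hcs : c ^ 2 - s ^ 2 = 1) (hp : 0 ≤ p) :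
    (!![c, s; s, c + p] : Matrix (Fin 2) (Fin 2) ℝ).PosDef := by
  refine posDef_fin_two (by linarith) ?_
  have : c * (c + p) - s ^ 2 = 1 + c * p := by linear_combination hcs
  rw [this]
  have : 0 ≤ c * p := mul_nonneg (by linarith) hp
  linarith

theorem trace_blocks : ((!![c, s; s, c + p] : Matrix (Fin 2) (Fin 2) ℝ) *
    !![c, -s; -s, c + q]).trace = c ^ 2 + (c + p) * (c + q) - 2 * s ^ 2 := by
  rw [trace_fin_two]
  simp [Matrix.mul_apply, Fin.sum_univ_two]
  ring

theorem det_block (hcs : c ^ 2 - s ^ 2 = 1) :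
    (!![c, s; s, c + p] : Matrix (Fin 2) (Fin 2) ℝ).det = 1 + c * p := by
  rw [det_fin_two_of]
  linear_combination hcs

/-- The lower bound amounts to `√(Δ² - 4 D) ≤ Δ - 2`. Here `Δ - 2 = c (p + q) + p q` is nonnegative,
and after squaring what remains is `D - Δ + 1 = s² p q ≥ 0`. -/
theorem one_le_symplectic_roots (hc : 1 ≤ c) (hcs : c ^ 2 - s ^ 2 = 1) (hp : 0 ≤ p) (hq : 0 ≤ q)
    {Δ D : ℝ} (hΔ : Δ = c ^ 2 + (c + p) * (c + q) - 2 * s ^ 2)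
    (hD : D = (1 + c * p) * (1 + c * q)) :
    1 ≤ √((Δ - √(Δ ^ 2 - 4 * D)) / 2) ∧
      √((Δ - √(Δ ^ 2 - 4 * D)) / 2) ≤ √((Δ + √(Δ ^ 2 - 4 * D)) / 2) := by
  have hpq : 0 ≤ p * q := mul_nonneg hp hq
  have hcpq : 0 ≤ c * (p + q) := mul_nonneg (by linarith) (by linarith)
  have hΔ' : Δ - 2 = c * (p + q) + p * q := by rw [hΔ]; linear_combination 2 * hcs
  have hD' : D - Δ + 1 = s ^ 2 * (p * q) := by
    rw [hD, hΔ]; linear_combination (-2 + p * q) * hcs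
  have hnn : 0 ≤ s ^ 2 * (p * q) := mul_nonneg (sq_nonneg _) hpq
  have hle : √(Δ ^ 2 - 4 * D) ≤ Δ - 2 := by
    rw [Real.sqrt_le_left (by linarith)]
    nlinarith
  have h0 := Real.sqrt_nonneg (Δ ^ 2 - 4 * D)
  exact ⟨Real.one_le_sqrt.2 (by linarith), Real.sqrt_le_sqrt (by linarith)⟩

end ExtractedCovariance

namespace Scheme

variable {k : ℕ} (P : Scheme k)

theorem extractedState_eq_gaussKernel {u : Fin (k - 1) → ℝ}
    (hu : ∀ i, P.alpha i = ∑ j, u j * P.beta i j) (ζ : ℂ) {a : ℝ} (ha : 0 < a)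
    {c s v2 u2 : ℝ} (hc : c = Real.cosh (2 * ‖ζ‖)) (hs : s = Real.sinh (2 * ‖ζ‖))
    (hv2 : v2 = ∑ j, P.v j ^ 2) (hu2 : u2 = ∑ j, u j ^ 2) :
    P.extractedState ζ a = gaussKernel !![c, s; s, c + v2 / a ^ 2] !![c, -s; -s, c + u2 / a ^ 2] := by
  have hc0 : 0 < c := hc ▸ Real.cosh_pos _
  have hv0 : 0 ≤ v2 := hv2 ▸ Finset.sum_nonneg fun i _ => sq_nonneg _
  have hcs : c ^ 2 - s ^ 2 = 1 := by rw [hc, hs]; exact Real.cosh_sq_sub_sinh_sq _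
  have hd : c * (c + v2 / a ^ 2) - s ^ 2 = (a ^ 2 + c * v2) / a ^ 2 := by
    field_simp
    linear_combination a ^ 2 * hcs
  funext x x'
  rw [(P.integrable_traceIntegrand_and_extractedState hu ζ ha hc hs hv2 hu2 x x').2,
    gaussKernel_fin_two, hd]
  obtain ⟨A, hA⟩ : ∃ A, A = a ^ 2 + c * v2 := ⟨_, rfl⟩
  have hA0 : 0 < A := by rw [hA]; positivity
  rw [← hA]
  congr 1
  have hpre : a / Real.pi * √(1 / A) = (√(Real.pi ^ 2 * (A / a ^ 2)))⁻¹ := by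
    rw [← Real.sqrt_inv, show (Real.pi ^ 2 * (A / a ^ 2))⁻¹ = (a / Real.pi) ^ 2 * (1 / A) by
      field_simp, Real.sqrt_mul (by positivity), Real.sqrt_sq (by positivity)]
  rw [hpre]
  refine congrArg₂ (· * ·) rfl (congrArg Real.exp ?_)
  -- Eliminating `v2` in favour of `A` and `s²` in favour of `c²` turns the comparison of exponents
  -- into a polynomial identity.
  have hv : v2 = (A - a ^ 2) / c := by rw [hA]; field_simp; ring
  have hs2 : s ^ 2 = c ^ 2 - 1 := by linear_combination -hcs
  rw [hv]
  field_simp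
  ring_nf
  rw [hs2]
  ring

end Scheme

end CVSharing

end

noncomputable section

namespace CVSharing

open Matrix

/-- The explicit form of the Gaussian Wigner function of the extracted state. -/
theorem gaussian_eq_wigner_formula {c s a v2 u2 : ℝ} (ha : 0 < a) (hc : 1 ≤ c) (hcs : c ^ 2 - s ^ 2 = 1)
    (hv : 0 ≤ v2) (hu : 0 ≤ u2) (x : Phase 2) :
    (Real.pi ^ 2 * √(fromBlocks (!![c, s; s, c + v2 / a ^ 2] : Matrix (Fin 2) (Fin 2) ℝ) 0 0
        !![c, -s; -s, c + u2 / a ^ 2]).det)⁻¹ *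
      Real.exp (-((x - 0) ⬝ᵥ (fromBlocks (!![c, s; s, c + v2 / a ^ 2] : Matrix (Fin 2) (Fin 2) ℝ) 0 0
        !![c, -s; -s, c + u2 / a ^ 2])⁻¹.mulVec (x - 0))) =
      a ^ 2 / (Real.pi ^ 2 * √((a ^ 2 + c * v2) * (a ^ 2 + c * u2))) * Real.exp (
        -((a ^ 2 * c + v2) / (a ^ 2 + c * v2)) * x (Sum.inl 0) ^ 2
        - a ^ 2 * c / (a ^ 2 + c * v2) * x (Sum.inl 1) ^ 2
        + 2 * a ^ 2 * s / (a ^ 2 + c * v2) * (x (Sum.inl 0) * x (Sum.inl 1))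
        - (a ^ 2 * c + u2) / (a ^ 2 + c * u2) * x (Sum.inr 0) ^ 2
        - a ^ 2 * c / (a ^ 2 + c * u2) * x (Sum.inr 1) ^ 2
        - 2 * a ^ 2 * s / (a ^ 2 + c * u2) * (x (Sum.inr 0) * x (Sum.inr 1))) := by
  have hvp : 0 ≤ v2 / a ^ 2 := by positivity
  have hup : 0 ≤ u2 / a ^ 2 := by positivity
  have hcs' : c ^ 2 - (-s) ^ 2 = 1 := by rw [neg_sq]; exact hcs
  have hA : 0 < a ^ 2 + c * v2 := by positivity
  have hB : 0 < a ^ 2 + c * u2 := by positivity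
  have hM := posDef_position_block hc hcs hvp
  have hN := posDef_position_block hc hcs' hup
  have hdM : c * (c + v2 / a ^ 2) - s ^ 2 = (a ^ 2 + c * v2) / a ^ 2 := by
    field_simp
    linear_combination a ^ 2 * hcs
  have hdN : c * (c + u2 / a ^ 2) - (-s) ^ 2 = (a ^ 2 + c * u2) / a ^ 2 := by
    field_simp
    linear_combination a ^ 2 * hcs
  have hinv : (fromBlocks (!![c, s; s, c + v2 / a ^ 2] : Matrix (Fin 2) (Fin 2) ℝ) 0 0
      !![c, -s; -s, c + u2 / a ^ 2])⁻¹ = fromBlocks (!![c, s; s, c + v2 / a ^ 2])⁻¹ 0 0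
        (!![c, -s; -s, c + u2 / a ^ 2])⁻¹ := by
    rw [inv_fromBlocks_zero₂₁_of_isUnit_iff _ _ _ (iff_of_true hM.isUnit hN.isUnit)]
    simp
  have hdet : (fromBlocks (!![c, s; s, c + v2 / a ^ 2] : Matrix (Fin 2) (Fin 2) ℝ) 0 0
      !![c, -s; -s, c + u2 / a ^ 2]).det = ((a ^ 2 + c * v2) * (a ^ 2 + c * u2)) * (1 / a ^ 2) ^ 2 := by
    rw [det_fromBlocks_zero₂₁, det_block hcs, det_block hcs']
    field_simp
  rw [hinv, hdet, Real.sqrt_mul (by positivity), Real.sqrt_sq (by positivity), sub_zero, inv_fin_two,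
    inv_fin_two, hdM, hdN]
  refine congrArg₂ (· * ·) (by field_simp) (congrArg Real.exp ?_)
  rw [fromBlocks_mulVec]
  simp [dotProduct, Fin.sum_univ_two]
  field_simp
  ring

end CVSharing

end

/-! ### Assembly of the results for the extracted state -/

theorem mainTheorem5 (k : ℕ) (hk : 1 ≤ k) (P : CVSharing.Scheme k) (ζ : ℂ) (a : ℝ) (ha : 0 < a) :
    IsUnit P.beta.det ∧
    ∀ u : Fin (k - 1) → ℝ, (∀ i, P.alpha i = ∑ j, u j * P.beta i j) →
    ∀ c s v2 u2 : ℝ, c = Real.cosh (2 * ‖ζ‖) → s = Real.sinh (2 * ‖ζ‖) →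
      v2 = ∑ j, P.v j ^ 2 → u2 = ∑ j, u j ^ 2 →
    ∀ V : Matrix (Fin 2 ⊕ Fin 2) (Fin 2 ⊕ Fin 2) ℝ,
      V = Matrix.fromBlocks !![c, s; s, c + v2 / a ^ 2] 0 0 !![c, -s; -s, c + u2 / a ^ 2] →
    ∀ νR νS νp νm : ℝ,
      νR = √(CVSharing.modeBlock V 0 0).det → νS = √(CVSharing.modeBlock V 1 1).det →
      νp = √((CVSharing.blockInvariant V + √(CVSharing.blockInvariant V ^ 2 - 4 * V.det)) / 2) →
      νm = √((CVSharing.blockInvariant V - √(CVSharing.blockInvariant V ^ 2 - 4 * V.det)) / 2) →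
    -- the density matrix in the position representation
    (∀ x x', MeasureTheory.Integrable (P.traceIntegrand ζ a x x')) ∧
    (∀ ω η ω' η' : ℝ, P.extractedState ζ a ![ω, η] ![ω', η'] =
      ((a / Real.pi * √(1 / (a ^ 2 + c * v2)) * Real.exp (
        (-(c / 2) + s ^ 2 * v2 / (4 * (a ^ 2 + c * v2))) * (ω ^ 2 + ω' ^ 2)
        + (-(c / 2) + c ^ 2 * v2 / (4 * (a ^ 2 + c * v2)) - u2 / (4 * a ^ 2)) * (η ^ 2 + η' ^ 2)
        + (s - c * s * v2 / (2 * (a ^ 2 + c * v2))) * (ω * η + ω' * η')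
        - c * s * v2 / (2 * (a ^ 2 + c * v2)) * (η * ω' + η' * ω)
        + s ^ 2 * v2 / (2 * (a ^ 2 + c * v2)) * (ω * ω')
        + (c ^ 2 * v2 / (2 * (a ^ 2 + c * v2)) + u2 / (2 * a ^ 2)) * (η * η')) : ℝ) : ℂ)) ∧
    -- the Wigner function
    CVSharing.IsWigner (P.extractedState ζ a) (fun x =>
      a ^ 2 / (Real.pi ^ 2 * √((a ^ 2 + c * v2) * (a ^ 2 + c * u2))) * Real.exp (
        -((a ^ 2 * c + v2) / (a ^ 2 + c * v2)) * x (Sum.inl 0) ^ 2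
        - a ^ 2 * c / (a ^ 2 + c * v2) * x (Sum.inl 1) ^ 2
        + 2 * a ^ 2 * s / (a ^ 2 + c * v2) * (x (Sum.inl 0) * x (Sum.inl 1))
        - (a ^ 2 * c + u2) / (a ^ 2 + c * u2) * x (Sum.inr 0) ^ 2
        - a ^ 2 * c / (a ^ 2 + c * u2) * x (Sum.inr 1) ^ 2
        - 2 * a ^ 2 * s / (a ^ 2 + c * u2) * (x (Sum.inr 0) * x (Sum.inr 1)))) ∧
    -- Gaussianity and covariance matrices of the joint state, the reference, the extracted secret
    CVSharing.IsGaussian (P.extractedState ζ a) 0 V ∧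
    CVSharing.IsGaussian (CVSharing.traceSecond (P.extractedState ζ a)) 0
      (CVSharing.modeBlock V 0 0) ∧
    CVSharing.IsGaussian (CVSharing.traceFirst (P.extractedState ζ a)) 0
      (CVSharing.modeBlock V 1 1) ∧
    -- the symplectic eigenvalues
    CVSharing.IsSymplecticSpectrum (CVSharing.modeBlock V 0 0) ![νR] ∧
    CVSharing.IsSymplecticSpectrum (CVSharing.modeBlock V 1 1) ![νS] ∧
    CVSharing.IsSymplecticSpectrum V ![νp, νm] ∧
    νR = c ∧
    νS = √((c + v2 / a ^ 2) * (c + u2 / a ^ 2)) ∧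
    CVSharing.blockInvariant V = c ^ 2 + (c + v2 / a ^ 2) * (c + u2 / a ^ 2) - 2 * s ^ 2 ∧
    V.det = (1 + c * v2 / a ^ 2) * (1 + c * u2 / a ^ 2) ∧
    4 * V.det ≤ CVSharing.blockInvariant V ^ 2 ∧
    1 ≤ νR ∧ 1 ≤ νS ∧ 1 ≤ νm ∧ νm ≤ νp ∧
    -- the entropies and the quantum mutual information
    ∃ (ρRS : CVSharing.ModeSpace 2 →L[ℂ] CVSharing.ModeSpace 2)
      (ρR ρS : CVSharing.ModeSpace 1 →L[ℂ] CVSharing.ModeSpace 1),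
      (CVSharing.HasKernel ρRS (P.extractedState ζ a) ∧
        CVSharing.HasKernel ρR (CVSharing.traceSecond (P.extractedState ζ a)) ∧
        CVSharing.HasKernel ρS (CVSharing.traceFirst (P.extractedState ζ a))) ∧
      (CVSharing.IsDensityOperator ρRS ∧ CVSharing.IsDensityOperator ρR ∧
        CVSharing.IsDensityOperator ρS) ∧
      (Summable (CVSharing.spectralEntropy ρRS) ∧ Summable (CVSharing.spectralEntropy ρR) ∧
        Summable (CVSharing.spectralEntropy ρS)) ∧
      CVSharing.vonNeumannEntropy ρR = CVSharing.modeEntropy νR ∧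
      CVSharing.vonNeumannEntropy ρS = CVSharing.modeEntropy νS ∧
      CVSharing.vonNeumannEntropy ρRS = CVSharing.modeEntropy νp + CVSharing.modeEntropy νm ∧
      CVSharing.quantumMutualInformation ρR ρS ρRS =
        CVSharing.modeEntropy νR + CVSharing.modeEntropy νS
          - CVSharing.modeEntropy νp - CVSharing.modeEntropy νm := by
  refine ⟨P.isUnit_det_beta, ?_⟩
  intro u hu c s v2 u2 hc hs hv2 hu2 V hV νR νS νp νm hνR hνS hνp hνm
  have hc1 : 1 ≤ c := hc ▸ Real.one_le_cosh _
  have hc0 : 0 < c := by linarith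
  have hcs : c ^ 2 - s ^ 2 = 1 := by rw [hc, hs]; exact Real.cosh_sq_sub_sinh_sq _
  have hcs' : c ^ 2 - (-s) ^ 2 = 1 := by rw [neg_sq]; exact hcs
  have hv0 : 0 ≤ v2 := hv2 ▸ Finset.sum_nonneg fun i _ => sq_nonneg _
  have hu0 : 0 ≤ u2 := hu2 ▸ Finset.sum_nonneg fun i _ => sq_nonneg _
  have hvp : 0 ≤ v2 / a ^ 2 := by positivity
  have hup : 0 ≤ u2 / a ^ 2 := by positivity
  have hM := CVSharing.posDef_position_block hc1 hcs hvp
  have hN := CVSharing.posDef_position_block hc1 hcs' hup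
  have hρ := P.extractedState_eq_gaussKernel hu ζ ha hc hs hv2 hu2
  have hdM : 0 < c * (c + v2 / a ^ 2) - s ^ 2 := by nlinarith [mul_nonneg hc0.le hvp]
  have hρR := CVSharing.traceSecond_gaussKernel c (-s) (c + u2 / a ^ 2) hc0 hdM
  have hρS := CVSharing.traceFirst_gaussKernel c (-s) (c + u2 / a ^ 2)
    (show 0 < c + v2 / a ^ 2 by linarith) hdM
  have hVR : CVSharing.modeBlock V 0 0 = Matrix.fromBlocks !![c] 0 0 !![c] := by
    rw [hV, CVSharing.modeBlock_fromBlocks]; simp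
  have hVS : CVSharing.modeBlock V 1 1 =
      Matrix.fromBlocks !![c + v2 / a ^ 2] 0 0 !![c + u2 / a ^ 2] := by
    rw [hV, CVSharing.modeBlock_fromBlocks]; simp
  have hdR : (CVSharing.modeBlock V 0 0).det = c * c := by
    rw [hV, CVSharing.det_modeBlock_fromBlocks]; simp
  have hdS : (CVSharing.modeBlock V 1 1).det = (c + v2 / a ^ 2) * (c + u2 / a ^ 2) := by
    rw [hV, CVSharing.det_modeBlock_fromBlocks]; simp
  have hΔ : CVSharing.blockInvariant V =
      c ^ 2 + (c + v2 / a ^ 2) * (c + u2 / a ^ 2) - 2 * s ^ 2 := by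
    rw [CVSharing.blockInvariant, hdR, hdS, hV, CVSharing.det_modeBlock_fromBlocks]
    simp
    ring
  have hD' : V.det = (1 + c * (v2 / a ^ 2)) * (1 + c * (u2 / a ^ 2)) := by
    rw [hV, Matrix.det_fromBlocks_zero₂₁, CVSharing.det_block hcs, CVSharing.det_block hcs']
  have hR1 : νR = c := by rw [hνR, hdR, Real.sqrt_mul_self hc0.le]
  have hS1 : νS = √((c + v2 / a ^ 2) * (c + u2 / a ^ 2)) := by rw [hνS, hdS]
  have hS2 : 1 ≤ νS := by
    rw [hS1]
    exact Real.one_le_sqrt.2 (one_le_mul_of_one_le_of_one_le (by linarith) (by linarith))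
  obtain ⟨hm1, hmp⟩ := CVSharing.one_le_symplectic_roots hc1 hcs hvp hup hΔ hD'
  rw [← hνm] at hm1 hmp
  rw [← hνp] at hmp
  obtain ⟨LR, hLR, hR2, hR3⟩ := CVSharing.exists_simultaneous_diagonal_fin_one hc0 hc0
  obtain ⟨LS, hLS, hS3, hS4⟩ := CVSharing.exists_simultaneous_diagonal_fin_one
    (show 0 < c + v2 / a ^ 2 by linarith) (show 0 < c + u2 / a ^ 2 by linarith)
  -- The block invariant is `∑ M_ij N_ij`, which for symmetric blocks is `tr (M N)`; likewise `det V
  -- = det M * det N`.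
  obtain ⟨hdisc, L, hL, h1, h2⟩ := CVSharing.exists_simultaneous_diagonal_fin_two hM hN
    (CVSharing.trace_blocks.trans hΔ.symm) (D := V.det)
    (by rw [CVSharing.det_block hcs, CVSharing.det_block hcs', hD'])
  rw [← hνp, ← hνm] at h1 h2
  rw [← hdR, ← hνR] at hR2 hR3
  rw [← hS1] at hS3 hS4
  have hνRS : ∀ i, 1 ≤ ![νp, νm] i := by
    intro i; fin_cases i
    · exact hm1.trans hmp
    · exact hm1
  have hνR' : ∀ i, 1 ≤ ![νR] i := by intro i; fin_cases i; exact hR1 ▸ hc1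
  have hνS' : ∀ i, 1 ≤ ![νS] i := by intro i; fin_cases i; exact hS2
  obtain ⟨ρRS, hkRS, hdoRS, hsRS, heRS⟩ := CVSharing.exists_operator_gaussKernel hL hνRS h1 h2
  obtain ⟨ρR, hkR, hdoR, hsR, heR⟩ := CVSharing.exists_operator_gaussKernel hLR hνR' hR2 hR3
  obtain ⟨ρS, hkS, hdoS, hsS, heS⟩ := CVSharing.exists_operator_gaussKernel hLS hνS' hS3 hS4
  rw [Fin.sum_univ_two] at heRS
  simp only [Finset.univ_unique, Finset.sum_singleton] at heR heS
  have hpos : ∀ {n : ℕ} {ν : Fin n → ℝ}, (∀ i, 1 ≤ ν i) → ∀ i, 0 < ν i :=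
    fun h i => zero_lt_one.trans_le (h i)
  refine ⟨fun x x' => (P.integrable_traceIntegrand_and_extractedState hu ζ ha hc hs hv2 hu2 x x').1,
    fun ω η ω' η' =>
      (P.integrable_traceIntegrand_and_extractedState hu ζ ha hc hs hv2 hu2 ![ω, η] ![ω', η']).2,
    ?_, ?_, ?_, ?_, ?_, ?_, ?_, hR1, hS1, hΔ, ?_, hdisc, hR1 ▸ hc1, hS2, hm1, hmp,
    ρRS, ρR, ρS, ⟨?_, ?_, ?_⟩, ⟨hdoRS, hdoR, hdoS⟩, ⟨hsRS, hsR, hsS⟩, heR, heS, heRS, ?_⟩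
  · rw [hρ, ← funext (CVSharing.gaussian_eq_wigner_formula ha hc1 hcs hv0 hu0)]
    exact CVSharing.isWigner_gaussKernel hM hN
  · rw [hρ, hV]
    exact CVSharing.isGaussian_gaussKernel hM hN
  · rw [hρ, hρR, hVR]
    exact CVSharing.isGaussian_gaussKernel (CVSharing.posDef_fin_one hc0)
      (CVSharing.posDef_fin_one hc0)
  · rw [hρ, hρS, hVS]
    exact CVSharing.isGaussian_gaussKernel (CVSharing.posDef_fin_one (by linarith))
      (CVSharing.posDef_fin_one (by linarith))
  · rw [hVR]
    exact CVSharing.isSymplecticSpectrum_fromBlocks hLR (hpos hνR') hR2 hR3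
  · rw [hVS]
    exact CVSharing.isSymplecticSpectrum_fromBlocks hLS (hpos hνS') hS3 hS4
  · rw [hV]
    exact CVSharing.isSymplecticSpectrum_fromBlocks hL (hpos hνRS) h1 h2
  · rw [hD', mul_div_assoc, mul_div_assoc]
  · rw [hρ]; exact hkRS
  · rw [hρ, hρR]; exact hkR
  · rw [hρ, hρS]; exact hkS
  · rw [CVSharing.quantumMutualInformation, heR, heS, heRS, sub_sub]
    rfl
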